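/- \textbf{Conventions.} Let $\mathcal V$ be a full sub-2-category of $\mathbf{Cat}$ (small categories) that is closed under small limits and exponentials in $\mathbf{Cat}$, has small colimits, and contains the arrow category $\mathbf 2$. A $\mathcal V$-category is a strict 2-category whose hom-categories lie in $\mathcal V$; $\mathcal V$-functors and $\mathcal V$-natural transformations are strict 2-functors and 2-natural transformations. $\mathcal V$ is itself a $\mathcal V$-category. For a $\mathcal V$-category $\mathcal C$, $\mathcal C^{\mathbf 2}$ is the $\mathcal V$-category of arrows, commutative squares and compatible pairs of 2-cells, and $\mathbb S\mathrm q(\mathcal C)=(\mathcal C^{\mathbf 2}\rightrightarrows\mathcal C)$ is the internal category of squares. $\mathcal C$ is cocomplete if it has all small weighted ($\mathcal V$-enriched) colimits, and a $\mathcal V$-functor is cocontinuous if it preserves them. A ($\mathcal V$-enriched) AWFS $(\mathsf L,\mathsf R)$ on $\mathcal C$ is a $\mathcal V$-functorial factorisation $f=\rho_f\cdot\lambda_f$ through $Kf$, with $\mathcal V$-functor $K\colon\mathcal C^{\mathbf 2}\to\mathcal C$, together with a comultiplication $(1,\sigma_f)\colon\lambda_f\to\lambda_{\lambda_f}$ making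 $f\mapsto\lambda_f$ (with counit $(1,\rho_f)$) a comonad $\mathsf L$ on $\mathcal C^{\mathbf 2}$ and a multiplication $(\pi_f,1)\colon\rho_{\rho_f}\to\rho_f$ making $f\mapsto\rho_f$ (with unit $(\lambda_f,1)$) a monad $\mathsf R$ on $\mathcal C^{\mathbf 2}$, such that the transformation $\mathsf L\mathsf R\Rightarrow\mathsf R\mathsf L$ with components $(\sigma_f,\pi_f)$ is a mixed distributive law. $\mathsf R\text-\mathrm{Alg}$ denotes the $\mathcal V$-category of $\mathsf R$-algebras over $\mathcal C^{\mathbf 2}$; with the usual composition of algebras, $(f,p)$ and $(g,q)$ giving the algebra on $g\cdot f$ with structure map $p\cdot K(1,\,q\cdot K(f,1))\cdot\sigma_{gf}$, it is the $\mathcal V$-category of arrows of an internal category $\mathsf R\text-\mathbb A\mathrm{lg}$ over $\mathbb S\mathrm q(\mathcal C)$. An AWFS is cocontinuous if $K$ is cocontinuous. Fix an AWFS $(\mathsf E,\mathsf M)$ on $\mathcal V$. Let $\mathbb J=(\mathcal J\rightrightarrows\mathcal J_0)$ be a small internal category in $\mathcal V$-categories and $U\colon\mathbb J\to\mathbb S\mathrm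 q(\mathcal C)$ an internal functor. For a morphism $g$ of $\mathcal C$ and $j\in\mathcal J$, let $$w_g(j)\colon \mathcal C^{\mathbf 2}(Uj,1_{\mathrm{dom}\,g})\to\mathcal C^{\mathbf 2}(Uj,g)$$ be composition with the square $(1,g)\colon 1_{\mathrm{dom}\,g}\to g$. The $\mathcal V$-category $\mathcal J^{\pitchfork_{\mathsf M}}$ over $\mathcal C^{\mathbf 2}$ has as objects the morphisms $g$ of $\mathcal C$ equipped with an $\mathsf M$-algebra structure on $w_g$ that is $\mathcal V$-natural in $j$, and as morphisms and 2-cells those of $\mathcal C^{\mathbf 2}$ that are compatible with these structures. $\mathbb J^{{\pitchfork\hspace{-4.9pt}\pitchfork}_{\mathsf M}}$ is its full sub-$\mathcal V$-category on those objects for which, for every composable pair $(i,j)$ of $\mathcal J$ with composite $j\bullet i$, the algebra $w_g(j\bullet i)$ is the composite of the algebra $w_g(j)$ with the algebra $\mathcal C^{\mathbf 2}(Uj,g)\to\mathcal C^{\mathbf 2}(U(j\bullet i),g)$, $(h,k)\mapsto(h\cdot Ui,k)$, obtained by pulling back $w_g(i)$ along $(h,k)\mapsto (h,k\cdot Uj)$,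 where $\mathcal C^{\mathbf 2}(Uj,1_{\mathrm{dom}\,g})$ is identified with $\mathcal C^{\mathbf 2}(U(j\bullet i),1_{\mathrm{dom}\,g})$. Objects over $f\colon X\to Y$ and $g\colon Y\to Z$ compose: the algebra $w_{gf}(j)$ is the composite of the algebra $w_f(j)$ with the pullback $\mathcal C^{\mathbf 2}(Uj,f)\to\mathcal C^{\mathbf 2}(Uj,gf)$ of the algebra $w_g(j)$ along composition with $(f,1)\colon gf\to g$. This makes $\mathbb J^{{\pitchfork\hspace{-4.9pt}\pitchfork}_{\mathsf M}}$ an internal category over $\mathbb S\mathrm q(\mathcal C)$ with object of objects $\mathcal C$. An AWFS $(\mathsf L,\mathsf R)$ on $\mathcal C$ is \emph{cofibrantly generated} (with respect to $(\mathsf E,\mathsf M)$) if for some such small $\mathbb J$ and $U$ there is an isomorphism of internal categories $\mathsf R\text-\mathbb A\mathrm{lg}\cong\mathbb J^{{\pitchfork\hspace{-4.9pt}\pitchfork}_{\mathsf M}}$ over $\mathbb S\mathrm q(\mathcal C)$. An orthogonal factorisation system $(\mathcal E,\mathcal M)$ is a weak factorisation system with unique diagonal fillers; it is proper if $\mathcal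 E$ consists of epimorphisms and $\mathcal M$ of monomorphisms. An object $A$ of a category $\mathcal A$ has rank at most a regular cardinal $\kappa$ if $\mathcal A(A,-)$ preserves the colimit of every small $\kappa$-filtered diagram that admits a cocone with all components in $\mathcal M$. The category $\mathcal A$ is locally ranked with respect to $(\mathcal E,\mathcal M)$ if it is cocomplete, every object has, up to isomorphism, only a small set of morphisms in $\mathcal E$ with that domain, and every object has rank at most some regular cardinal. A forgetful $\mathcal V$-functor $\mathcal S\to\mathcal C^{\mathbf 2}$ \emph{creates $\kappa$-filtered colimits of $\mathcal M$-subobjects} if, for every small $\kappa$-filtered diagram $D$ in $\mathcal S$ whose image in $\mathcal C^{\mathbf 2}$ admits a cocone with all components in $\mathcal M$ (on domains and on codomains), each ($\mathcal V$-enriched, conical) colimit cocone of the image of $D$ is the image of exactly one cocone of $D$, and this cocone is a ($\mathcal V$-enriched, conical) colimit. \textbf{Statement.} Suppose that $\mathcal V$ is equipped with a cocontinuous AWFS $(\mathsf E,\mathsf M)$, and that $\mathcal C$ is a cocomplete $\mathcal V$-category whose underlying category is locally ranked with respect to some proper orthogonal factorisation system $(\mathcal E,\mathcal M)$. Then for every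 AWFS $(\mathsf L,\mathsf R)$ on $\mathcal C$ that is cofibrantly generated with respect to $(\mathsf E,\mathsf M)$, there is a regular cardinal $\kappa$ such that the forgetful $\mathcal V$-functor $\mathsf R\text-\mathrm{Alg}\to\mathcal C^{\mathbf 2}$ creates $\kappa$-filtered colimits of $\mathcal M$-subobjects. -/

import Mathlib

open CategoryTheory Limits Opposite

universe w u u₁ u₂ u₃ u₄

namespace TwoDim

/-! ### Strict 2-categories -/

/-- A strict 2-category structure on a category `C`.  The 2-cells between the parallel morphisms
from `X` to `Y` are collected in one type `Cell X Y`, with source and target in `X ⟶ Y`; there are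
identity 2-cells, vertical composites (of 2-cells that match) and horizontal composites. -/
class TwoCat (C : Type u) [Category.{w} C] where
  Cell : C → C → Type w
  src {X Y : C} : Cell X Y → (X ⟶ Y)
  tgt {X Y : C} : Cell X Y → (X ⟶ Y)
  one {X Y : C} : (X ⟶ Y) → Cell X Y
  vcomp {X Y : C} (α β : Cell X Y) (h : tgt α = src β) : Cell X Y
  hcomp {X Y Z : C} : Cell X Y → Cell Y Z → Cell X Z
  src_one {X Y : C} (f : X ⟶ Y) : src (one f) = f
  tgt_one {X Y : C} (f : X ⟶ Y) : tgt (one f) = f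
  src_vcomp {X Y : C} (α β : Cell X Y) (h : tgt α = src β) : src (vcomp α β h) = src α
  tgt_vcomp {X Y : C} (α β : Cell X Y) (h : tgt α = src β) : tgt (vcomp α β h) = tgt β
  src_hcomp {X Y Z : C} (α : Cell X Y) (β : Cell Y Z) : src (hcomp α β) = src α ≫ src β
  tgt_hcomp {X Y Z : C} (α : Cell X Y) (β : Cell Y Z) : tgt (hcomp α β) = tgt α ≫ tgt β
  one_vcomp {X Y : C} (α : Cell X Y) : vcomp (one (src α)) α (tgt_one _) = α
  vcomp_one {X Y : C} (α : Cell X Y) : vcomp α (one (tgt α)) (src_one _).symm = α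
  vcomp_assoc {X Y : C} (α β γ : Cell X Y) (h : tgt α = src β) (h' : tgt β = src γ) :
    vcomp (vcomp α β h) γ ((tgt_vcomp α β h).trans h') =
      vcomp α (vcomp β γ h') (h.trans (src_vcomp β γ h').symm)
  one_hcomp {X Y : C} (α : Cell X Y) : hcomp (one (𝟙 X)) α = α
  hcomp_one {X Y : C} (α : Cell X Y) : hcomp α (one (𝟙 Y)) = α
  hcomp_assoc {X Y Z T : C} (α : Cell X Y) (β : Cell Y Z) (γ : Cell Z T) :
    hcomp (hcomp α β) γ = hcomp α (hcomp β γ)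
  one_comp {X Y Z : C} (f : X ⟶ Y) (g : Y ⟶ Z) : one (f ≫ g) = hcomp (one f) (one g)
  interchange {X Y Z : C} (α β : Cell X Y) (γ δ : Cell Y Z) (h : tgt α = src β)
    (h' : tgt γ = src δ) :
    hcomp (vcomp α β h) (vcomp γ δ h') =
      vcomp (hcomp α γ) (hcomp β δ) (by rw [tgt_hcomp, src_hcomp, h, h'])


open TwoCat

attribute [simp] TwoCat.src_one TwoCat.tgt_one TwoCat.src_vcomp TwoCat.tgt_vcomp
  TwoCat.src_hcomp TwoCat.tgt_hcomp TwoCat.one_vcomp TwoCat.vcomp_one TwoCat.one_hcomp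
  TwoCat.hcomp_one TwoCat.hcomp_assoc

section basic

variable {C : Type u} [Category.{w} C] [TwoCat C]

theorem vcomp_congr {X Y : C} {α α' β β' : Cell X Y} (hα : α = α') (hβ : β = β')
    (h : tgt α = src β) (h' : tgt α' = src β') : vcomp α β h = vcomp α' β' h' := by
  subst hα; subst hβ; rfl

theorem one_vcomp_one {X Y : C} (f : X ⟶ Y) (h : tgt (one f) = src (one f)) :
    vcomp (one f) (one f) h = one f := by
  have := one_vcomp (one f)
  simpa using this

theorem vcomp_hcomp_one {X Y Z : C} (α β : Cell X Y) (h : tgt α = src β) (g : Y ⟶ Z) :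
    hcomp (vcomp α β h) (one g) =
      vcomp (hcomp α (one g)) (hcomp β (one g)) (by simp [h]) := by
  have := interchange α β (one g) (one g) h (by simp)
  rwa [one_vcomp_one] at this

theorem one_hcomp_vcomp {X Y Z : C} (f : X ⟶ Y) (α β : Cell Y Z) (h : tgt α = src β) :
    hcomp (one f) (vcomp α β h) =
      vcomp (hcomp (one f) α) (hcomp (one f) β) (by simp [h]) := by
  have := interchange (one f) (one f) α β (by simp) h
  rwa [one_vcomp_one] at this

/-- The hom-category `C(X, Y)`: its objects are the morphisms `X ⟶ Y`, its morphisms are the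
2-cells between them. -/
def HomCat (X Y : C) : Type w := X ⟶ Y

instance (X Y : C) : Category.{w} (HomCat X Y) where
  Hom f g := {α : Cell X Y // src α = f ∧ tgt α = g}
  id f := ⟨one f, src_one f, tgt_one f⟩
  comp α β := ⟨vcomp α.1 β.1 (α.2.2.trans β.2.1.symm),
    (src_vcomp _ _ _).trans α.2.1, (tgt_vcomp _ _ _).trans β.2.2⟩
  id_comp := by
    rintro f g ⟨α, rfl, rfl⟩
    exact Subtype.ext (one_vcomp α)
  comp_id := by
    rintro f g ⟨α, rfl, rfl⟩
    exact Subtype.ext (vcomp_one α)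
  assoc := by
    rintro f g h k ⟨α, _⟩ ⟨β, _⟩ ⟨γ, _⟩
    exact Subtype.ext (vcomp_assoc α β γ _ _)

/-- The 2-cell underlying a morphism of a hom-category. -/
def HomCat.cell {X Y : C} {f g : HomCat X Y} (α : f ⟶ g) : Cell X Y := α.1

theorem HomCat.hom_ext {X Y : C} {f g : HomCat X Y} {α β : f ⟶ g} (h : cell α = cell β) : α = β :=
  Subtype.ext h

theorem HomCat.functor_ext {A : Type u₁} [Category.{u₂} A] {X Y : C} {F G : A ⥤ HomCat X Y}
    (hobj : ∀ a, F.obj a = G.obj a) (hmap : ∀ {a b : A} (f : a ⟶ b),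
      cell (F.map f) = cell (G.map f)) : F = G := by
  refine Functor.hext hobj fun a b f => ?_
  have key : ∀ {p q p' q' : HomCat X Y} (_ : p = p') (_ : q = q') (α : p ⟶ q) (β : p' ⟶ q'),
      cell α = cell β → HEq α β := by
    rintro p q _ _ rfl rfl α β h
    exact heq_of_eq (HomCat.hom_ext h)
  exact key (hobj a) (hobj b) _ _ (hmap f)

end basic

/-! ### The base of enrichment -/

/-- The arrow category `𝟐`, as an object of `Cat`. -/
abbrev catTwo : Cat.{w, w} := Cat.of (ULift.{w} (Fin 2))

/-- A full sub-2-category of `Cat`, given by the property `P` of its objects, which is the domain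
of a bundled type. -/
structure VObj (P : ObjectProperty Cat.{w, w}) where
  carrier : Type w
  [cat : Category.{w} carrier]
  prop : P (Cat.of carrier)

attribute [instance] VObj.cat

instance (P : ObjectProperty Cat.{w, w}) : Category.{w} (VObj P) where
  Hom X Y := X.carrier ⥤ Y.carrier
  id X := 𝟭 X.carrier
  comp F G := F ⋙ G

/-- The natural transformations between functors `A ⥤ B`, with their source and target. -/
structure NatCell (A B : Type w) [Category.{w} A] [Category.{w} B] where
  dom : A ⥤ B
  cod : A ⥤ B
  hom : dom ⟶ cod

theorem NatCell.ext' {A B : Type w} [Category.{w} A] [Category.{w} B] {α β : NatCell A B}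
    (h : α.dom = β.dom) (h' : α.cod = β.cod)
    (hh : ∀ a, α.hom.app a = eqToHom (by rw [h]) ≫ β.hom.app a ≫ eqToHom (by rw [h'])) :
    α = β := by
  obtain ⟨F, G, α⟩ := α
  obtain ⟨F', G', β⟩ := β
  dsimp at h h'
  subst h; subst h'
  congr 1
  ext a
  simpa using hh a

instance (P : ObjectProperty Cat.{w, w}) : TwoCat (VObj P) where
  Cell X Y := NatCell X.carrier Y.carrier
  src α := α.dom
  tgt α := α.cod
  one F := ⟨F, F, NatTrans.id F⟩
  vcomp α β h := ⟨α.dom, β.cod, α.hom ≫ eqToHom h ≫ β.hom⟩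
  hcomp α β := ⟨α.dom ⋙ β.dom, α.cod ⋙ β.cod, NatTrans.hcomp α.hom β.hom⟩
  src_one _ := rfl
  tgt_one _ := rfl
  src_vcomp _ _ _ := rfl
  tgt_vcomp _ _ _ := rfl
  src_hcomp _ _ := rfl
  tgt_hcomp _ _ := rfl
  one_vcomp α := NatCell.ext' rfl rfl (fun a => by simp)
  vcomp_one α := NatCell.ext' rfl rfl (fun a => by simp)
  vcomp_assoc α β γ h h' := NatCell.ext' rfl rfl (fun a => by simp)
  one_hcomp α := NatCell.ext' rfl rfl (fun a => by simp; rfl)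
  hcomp_one α := NatCell.ext' rfl rfl (fun a => by simp; rfl)
  hcomp_assoc α β γ := NatCell.ext' rfl rfl (fun a => by simp)
  one_comp F G := NatCell.ext' rfl rfl (fun a => by simp)
  interchange α β γ δ h h' := by
    obtain ⟨F, G, α⟩ := α
    obtain ⟨F', G', β⟩ := β
    obtain ⟨H, K, γ⟩ := γ
    obtain ⟨H', K', δ⟩ := δ
    dsimp at h h'
    subst h; subst h'
    exact NatCell.ext' rfl rfl (fun a => by simp)

/-- The standing assumptions on the base `𝒱 ⊆ Cat` of enrichment, a full sub-2-category given by
the property `P`: it is closed under small limits and exponentials in `Cat`, it has small colimits,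
and it contains the arrow category `𝟐`. -/
class IsBase (P : ObjectProperty Cat.{w, w}) : Prop where
  closedUnderLimits (J : Type w) [SmallCategory J] : P.IsClosedUnderLimitsOfShape J
  exponential (A B : Type w) [SmallCategory A] [SmallCategory B] :
    P (Cat.of A) → P (Cat.of B) → P (Cat.of (A ⥤ B))
  hasColimits : HasColimitsOfSize.{w, w} (VObj P)
  two : P catTwo

/-- A strict 2-category is a `𝒱`-category when its hom-categories belong to `𝒱`. -/
class HomsIn (P : ObjectProperty Cat.{w, w}) (C : Type u) [Category.{w} C] [TwoCat C] : Prop where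
  prop (X Y : C) : P (Cat.of (HomCat X Y))

section closure

variable (P : ObjectProperty Cat.{w, w}) [IsBase P]

theorem IsBase.of_shape (J : Type) [SmallCategory J] {X : Cat.{w, w}}
    (h : P.LimitOfShape J X) : P X := by
  have := IsBase.closedUnderLimits (P := P) (ULiftHom.{w} (ULift.{w} J))
  exact ObjectProperty.IsClosedUnderLimitsOfShape.limitsOfShape_le P _ X
    ⟨h.reindex (ULiftHomULiftCategory.equiv.{w, w} J).inverse⟩

theorem IsBase.of_iso {X Y : Cat.{w, w}} (e : X ≅ Y) (h : P X) : P Y := by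
  refine IsBase.of_shape P (Discrete PUnit.{1}) (ObjectProperty.LimitOfShape.ofIso (X := X) ?_ e)
  exact
    { diag := (Functor.const _).obj X
      π := 𝟙 _
      isLimit :=
        { lift := fun s => s.π.app ⟨⟨⟩⟩
          fac := by rintro s ⟨⟨⟩⟩; simp
          uniq := by intro s m hm; simpa using hm ⟨⟨⟩⟩ }
      prop_diag_obj := fun _ => h }

end closure

/-- The hom-categories of `𝒱` are functor categories. -/
def VObj.toHomCat {P : ObjectProperty Cat.{w, w}} (X Y : VObj P) :
    (X.carrier ⥤ Y.carrier) ⥤ HomCat X Y where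
  obj F := F
  map {F G} α := ⟨⟨F, G, α⟩, rfl, rfl⟩
  map_id _ := rfl
  map_comp {F G H} α β := Subtype.ext (congrArg (fun h => NatCell.mk F H h)
    (show α ≫ β = α ≫ eqToHom rfl ≫ β by simp))

/-- The inverse of `VObj.toHomCat`. -/
def VObj.ofHomCat {P : ObjectProperty Cat.{w, w}} (X Y : VObj P) :
    HomCat X Y ⥤ (X.carrier ⥤ Y.carrier) where
  obj F := F
  map {F G} α := eqToHom α.2.1.symm ≫ NatCell.hom α.1 ≫ eqToHom α.2.2
  map_id F := by
    have key : ∀ {E : Type w} [Category.{w} E] (x : E) (h h' : x = x),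
        eqToHom h ≫ 𝟙 x ≫ eqToHom h' = 𝟙 x := by
      intro E _ x h h'
      simp
    exact key (E := X.carrier ⥤ Y.carrier) F _ _
  map_comp := by
    rintro F G H ⟨⟨F, G, α⟩, rfl, rfl⟩ ⟨⟨G', H, β⟩, h, rfl⟩
    obtain rfl : G' = G := h
    change eqToHom _ ≫ (α ≫ eqToHom _ ≫ β) ≫ eqToHom _ =
      (eqToHom _ ≫ α ≫ eqToHom _) ≫ (eqToHom _ ≫ β ≫ eqToHom _)
    simp

instance (P : ObjectProperty Cat.{w, w}) [IsBase P] : HomsIn P (VObj P) where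
  prop X Y := by
    have h := IsBase.exponential (P := P) X.carrier Y.carrier X.prop Y.prop
    refine IsBase.of_iso P ⟨(VObj.toHomCat X Y).toCatHom, (VObj.ofHomCat X Y).toCatHom,
      ?_, ?_⟩ h
    · apply Cat.Hom.ext
      exact CategoryTheory.Functor.ext (fun _ => rfl) (fun F G α => rfl)
    · apply Cat.Hom.ext
      refine HomCat.functor_ext (fun _ => rfl) ?_
      rintro _ _ ⟨⟨F, G, α⟩, rfl, rfl⟩
      change NatCell.mk F G (eqToHom _ ≫ α ≫ eqToHom _) = NatCell.mk F G α
      simp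

/-! ### 2-functors and 2-natural transformations -/

section functors

variable {A : Type u₁} [Category.{w} A] [TwoCat A] {B : Type u₂} [Category.{w} B] [TwoCat B]
  {C : Type u₃} [Category.{w} C] [TwoCat C] {D : Type u₄} [Category.{w} D] [TwoCat D]

variable (A B) in
/-- Strict 2-functors.  Since `𝒱` is a full sub-2-category of `Cat`, these are the `𝒱`-functors
between `𝒱`-categories. -/
structure TwoFunctor extends A ⥤ B where
  mapCell {X Y : A} : Cell X Y → Cell (obj X) (obj Y)
  src_mapCell {X Y : A} (α : Cell X Y) : src (mapCell α) = map (src α)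
  tgt_mapCell {X Y : A} (α : Cell X Y) : tgt (mapCell α) = map (tgt α)
  mapCell_one {X Y : A} (f : X ⟶ Y) : mapCell (one f) = one (map f)
  mapCell_vcomp {X Y : A} (α β : Cell X Y) (h : tgt α = src β) :
    mapCell (vcomp α β h) =
      vcomp (mapCell α) (mapCell β) (by rw [tgt_mapCell, src_mapCell, h])
  mapCell_hcomp {X Y Z : A} (α : Cell X Y) (β : Cell Y Z) :
    mapCell (hcomp α β) = hcomp (mapCell α) (mapCell β)

attribute [simp] TwoFunctor.src_mapCell TwoFunctor.tgt_mapCell TwoFunctor.mapCell_one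
  TwoFunctor.mapCell_hcomp

/-- The identity 2-functor. -/
abbrev TwoFunctor.id (A : Type u₁) [Category.{w} A] [TwoCat A] : TwoFunctor A A where
  toFunctor := 𝟭 A
  mapCell α := α
  src_mapCell _ := rfl
  tgt_mapCell _ := rfl
  mapCell_one _ := rfl
  mapCell_vcomp _ _ _ := rfl
  mapCell_hcomp _ _ := rfl

/-- The composite of 2-functors. -/
abbrev TwoFunctor.comp (F : TwoFunctor A B) (G : TwoFunctor B C) : TwoFunctor A C where
  toFunctor := F.toFunctor ⋙ G.toFunctor
  mapCell α := G.mapCell (F.mapCell α)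
  src_mapCell α := by simp
  tgt_mapCell α := by simp
  mapCell_one f := by simp
  mapCell_vcomp α β h := by
    simp only [F.mapCell_vcomp, G.mapCell_vcomp]
  mapCell_hcomp α β := by simp

theorem TwoFunctor.cell_congr {F G : TwoFunctor A B} (h : F = G) {X Y : A} (α : Cell X Y) :
    hcomp (F.mapCell α) (one (eqToHom (by rw [h]))) =
      hcomp (one (eqToHom (by rw [h]))) (G.mapCell α) := by
  subst h
  simp

theorem TwoFunctor.hom_congr {F G : TwoFunctor A B} (h : F = G) {X Y : A} (f : X ⟶ Y) :
    F.map f ≫ eqToHom (by rw [h]) = eqToHom (by rw [h]) ≫ G.map f := by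
  subst h
  simp

theorem TwoFunctor.ext' {F G : TwoFunctor A B} (hobj : ∀ X, F.obj X = G.obj X)
    (hmap : ∀ {X Y : A} (f : X ⟶ Y),
      F.map f ≫ eqToHom (hobj Y) = eqToHom (hobj X) ≫ G.map f)
    (hcell : ∀ {X Y : A} (α : Cell X Y),
      hcomp (F.mapCell α) (one (eqToHom (hobj Y))) =
        hcomp (one (eqToHom (hobj X))) (G.mapCell α)) : F = G := by
  obtain ⟨F, Fc, _, _, _, _, _⟩ := F
  obtain ⟨G, Gc, _, _, _, _, _⟩ := G
  obtain rfl : F = G := by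
    refine CategoryTheory.Functor.ext hobj (fun X Y f => ?_)
    have := hmap f
    dsimp at this
    rw [← Category.assoc, ← this]
    simp
  congr 1
  funext X Y α
  simpa using hcell α

/-- The 2-natural transformations.  Since `𝒱` is a full sub-2-category of `Cat`, these are the
`𝒱`-natural transformations. -/
structure TwoNat (F G : TwoFunctor A B) where
  app (X : A) : F.obj X ⟶ G.obj X
  naturality {X Y : A} (f : X ⟶ Y) : F.map f ≫ app Y = app X ≫ G.map f
  naturality_cell {X Y : A} (α : Cell X Y) :
    hcomp (F.mapCell α) (one (app Y)) = hcomp (one (app X)) (G.mapCell α)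

/-- The vertical composite of 2-natural transformations. -/
abbrev TwoNat.comp {F G H : TwoFunctor A B} (s : TwoNat F G) (t : TwoNat G H) : TwoNat F H where
  app X := s.app X ≫ t.app X
  naturality f := by
    rw [← Category.assoc, s.naturality, Category.assoc, t.naturality, Category.assoc]
  naturality_cell α := by
    rw [one_comp, one_comp, ← hcomp_assoc, s.naturality_cell, hcomp_assoc, t.naturality_cell,
      hcomp_assoc]

/-- Precomposition of a 2-natural transformation with a 2-functor. -/
abbrev TwoNat.whiskerLeft (E : TwoFunctor A B) {F G : TwoFunctor B C} (s : TwoNat F G) :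
    TwoNat (E.comp F) (E.comp G) where
  app X := s.app (E.obj X)
  naturality f := s.naturality (E.map f)
  naturality_cell α := s.naturality_cell (E.mapCell α)

/-- Modifications between 2-natural transformations. -/
structure Modif {F G : TwoFunctor A B} (s t : TwoNat F G) where
  app (X : A) : Cell (F.obj X) (G.obj X)
  src_app (X : A) : src (app X) = s.app X
  tgt_app (X : A) : tgt (app X) = t.app X
  naturality {X Y : A} (f : X ⟶ Y) :
    hcomp (one (F.map f)) (app Y) = hcomp (app X) (one (G.map f))

/-- The opposite of a 2-category, in which the direction of the morphisms is reversed but that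
of the 2-cells is not. -/
instance : TwoCat Aᵒᵖ where
  Cell X Y := Cell Y.unop X.unop
  src α := (src α).op
  tgt α := (tgt α).op
  one f := one f.unop
  vcomp α β h := vcomp α β (Quiver.Hom.op_inj h)
  hcomp α β := hcomp β α
  src_one _ := by simp
  tgt_one _ := by simp
  src_vcomp _ _ _ := by simp
  tgt_vcomp _ _ _ := by simp
  src_hcomp _ _ := by simp
  tgt_hcomp _ _ := by simp
  one_vcomp α := TwoCat.one_vcomp α
  vcomp_one α := TwoCat.vcomp_one α
  vcomp_assoc α β γ h h' := TwoCat.vcomp_assoc α β γ _ _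
  one_hcomp α := TwoCat.hcomp_one α
  hcomp_one α := TwoCat.one_hcomp α
  hcomp_assoc α β γ := (TwoCat.hcomp_assoc γ β α).symm
  one_comp f g := TwoCat.one_comp g.unop f.unop
  interchange α β γ δ h h' := TwoCat.interchange γ δ α β _ _

/-- The 2-functor between opposites induced by a 2-functor. -/
abbrev TwoFunctor.op (F : TwoFunctor A B) : TwoFunctor Aᵒᵖ Bᵒᵖ where
  toFunctor := F.toFunctor.op
  mapCell α := F.mapCell (X := _) (Y := _) α
  src_mapCell α := congrArg Quiver.Hom.op (F.src_mapCell (X := _) (Y := _) α)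
  tgt_mapCell α := congrArg Quiver.Hom.op (F.tgt_mapCell (X := _) (Y := _) α)
  mapCell_one f := F.mapCell_one f.unop
  mapCell_vcomp α β h := F.mapCell_vcomp (X := _) (Y := _) α β (Quiver.Hom.op_inj h)
  mapCell_hcomp α β := F.mapCell_hcomp (X := _) (Y := _) (Z := _) β α

/-! ### Arrow 2-categories -/

/-- The 2-cells of the arrow 2-category `C^𝟐`: compatible pairs of 2-cells of `C`. -/
@[ext]
structure ArrowCell (f g : Arrow A) where
  left : Cell f.left g.left
  right : Cell f.right g.right
  w : hcomp left (one g.hom) = hcomp (one f.hom) right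

instance : TwoCat (Arrow A) where
  Cell f g := ArrowCell f g
  src {f g} α := Arrow.homMk (src α.left) (src α.right)
    (by simpa using congrArg src α.w)
  tgt {f g} α := Arrow.homMk (tgt α.left) (tgt α.right)
    (by simpa using congrArg tgt α.w)
  one {f g} s := ⟨one s.left, one s.right, by rw [← one_comp, ← one_comp, Arrow.w]⟩
  vcomp {f g} α β h :=
    have hl : tgt α.left = src β.left := congrArg Arrow.Hom.left h
    have hr : tgt α.right = src β.right := congrArg Arrow.Hom.right h
    ⟨vcomp α.left β.left hl, vcomp α.right β.right hr, by
      rw [vcomp_hcomp_one, one_hcomp_vcomp]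
      exact vcomp_congr α.w β.w _ _⟩
  hcomp {f g k} α β := ⟨hcomp α.left β.left, hcomp α.right β.right, by
    rw [hcomp_assoc, β.w, ← hcomp_assoc, α.w, hcomp_assoc]⟩
  src_one s := by ext <;> simp
  tgt_one s := by ext <;> simp
  src_vcomp α β h := by
    ext
    · exact TwoCat.src_vcomp _ _ _
    · exact TwoCat.src_vcomp _ _ _
  tgt_vcomp α β h := by
    ext
    · exact TwoCat.tgt_vcomp _ _ _
    · exact TwoCat.tgt_vcomp _ _ _
  src_hcomp α β := by ext <;> simp
  tgt_hcomp α β := by ext <;> simp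
  one_vcomp α := ArrowCell.ext (by simp) (by simp)
  vcomp_one α := ArrowCell.ext (by simp) (by simp)
  vcomp_assoc α β γ h h' := ArrowCell.ext (TwoCat.vcomp_assoc _ _ _ _ _)
    (TwoCat.vcomp_assoc _ _ _ _ _)
  one_hcomp α := ArrowCell.ext (TwoCat.one_hcomp _) (TwoCat.one_hcomp _)
  hcomp_one α := ArrowCell.ext (TwoCat.hcomp_one _) (TwoCat.hcomp_one _)
  hcomp_assoc α β γ := ArrowCell.ext (TwoCat.hcomp_assoc _ _ _) (TwoCat.hcomp_assoc _ _ _)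
  one_comp s t := ArrowCell.ext (TwoCat.one_comp _ _) (TwoCat.one_comp _ _)
  interchange α β γ δ h h' := ArrowCell.ext (TwoCat.interchange _ _ _ _ _ _)
    (TwoCat.interchange _ _ _ _ _ _)

end functors

section arrows

variable {A : Type u₁} [Category.{w} A] [TwoCat A] {B : Type u₂} [Category.{w} B] [TwoCat B]
  {C : Type u₃} [Category.{w} C] [TwoCat C]

/-- The 2-functor `dom : C^𝟐 ⟶ C`. -/
abbrev domF (C : Type u) [Category.{w} C] [TwoCat C] : TwoFunctor (Arrow C) C where
  obj f := f.left
  map s := s.left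
  mapCell α := ArrowCell.left α
  src_mapCell _ := rfl
  tgt_mapCell _ := rfl
  mapCell_one _ := rfl
  mapCell_vcomp _ _ _ := rfl
  mapCell_hcomp _ _ := rfl

/-- The 2-functor `cod : C^𝟐 ⟶ C`. -/
abbrev codF (C : Type u) [Category.{w} C] [TwoCat C] : TwoFunctor (Arrow C) C where
  obj f := f.right
  map s := s.right
  mapCell α := ArrowCell.right α
  src_mapCell _ := rfl
  tgt_mapCell _ := rfl
  mapCell_one _ := rfl
  mapCell_vcomp _ _ _ := rfl
  mapCell_hcomp _ _ := rfl

/-- The 2-functor `id : C ⟶ C^𝟐` that sends an object to its identity morphism. -/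
abbrev idF (C : Type u) [Category.{w} C] [TwoCat C] : TwoFunctor C (Arrow C) where
  obj X := Arrow.mk (𝟙 X)
  map f := Arrow.homMk f f (by simp)
  map_id _ := rfl
  map_comp _ _ := rfl
  mapCell α := ArrowCell.mk α α (by simp)
  src_mapCell _ := rfl
  tgt_mapCell _ := rfl
  mapCell_one _ := rfl
  mapCell_vcomp _ _ _ := rfl
  mapCell_hcomp _ _ := rfl

/-- A 2-natural transformation between 2-functors `A ⟶ B`, seen as a 2-functor `A ⟶ B^𝟐`. -/
abbrev TwoNat.toArrow {F G : TwoFunctor A B} (t : TwoNat F G) : TwoFunctor A (Arrow B) where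
  obj X := Arrow.mk (t.app X)
  map f := Arrow.homMk (F.map f) (G.map f) (t.naturality f)
  map_id X := Arrow.hom_ext _ _ (F.map_id X) (G.map_id X)
  map_comp f g := Arrow.hom_ext _ _ (F.map_comp f g) (G.map_comp f g)
  mapCell α := ArrowCell.mk (F.mapCell α) (G.mapCell α) (t.naturality_cell α)
  src_mapCell α := Arrow.hom_ext _ _ (F.src_mapCell α) (G.src_mapCell α)
  tgt_mapCell α := Arrow.hom_ext _ _ (F.tgt_mapCell α) (G.tgt_mapCell α)
  mapCell_one f := ArrowCell.ext (F.mapCell_one f) (G.mapCell_one f)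
  mapCell_vcomp α β h := ArrowCell.ext (F.mapCell_vcomp α β h) (G.mapCell_vcomp α β h)
  mapCell_hcomp α β := ArrowCell.ext (F.mapCell_hcomp α β) (G.mapCell_hcomp α β)

/-- The 2-functor `F^𝟐 : A^𝟐 ⟶ B^𝟐` induced by a 2-functor `F`. -/
abbrev TwoFunctor.mapArrow (F : TwoFunctor A B) : TwoFunctor (Arrow A) (Arrow B) where
  obj f := Arrow.mk (F.map f.hom)
  map s := Arrow.homMk (F.map s.left) (F.map s.right)
    (by dsimp; rw [← F.map_comp, ← F.map_comp, Arrow.w])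
  map_id X := Arrow.hom_ext _ _ (F.map_id _) (F.map_id _)
  map_comp f g := Arrow.hom_ext _ _ (F.map_comp _ _) (F.map_comp _ _)
  mapCell α := ArrowCell.mk (F.mapCell (ArrowCell.left α)) (F.mapCell (ArrowCell.right α)) (by
    have := congrArg F.mapCell (ArrowCell.w α)
    simpa using this)
  src_mapCell α := Arrow.hom_ext _ _ (F.src_mapCell _) (F.src_mapCell _)
  tgt_mapCell α := Arrow.hom_ext _ _ (F.tgt_mapCell _) (F.tgt_mapCell _)
  mapCell_one f := ArrowCell.ext (F.mapCell_one _) (F.mapCell_one _)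
  mapCell_vcomp α β h := ArrowCell.ext (F.mapCell_vcomp _ _ _) (F.mapCell_vcomp _ _ _)
  mapCell_hcomp α β := ArrowCell.ext (F.mapCell_hcomp _ _) (F.mapCell_hcomp _ _)

/-- The 2-natural transformation with components the squares `(1, g) : 1_{dom g} ⟶ g`. -/
def unitSq (C : Type u) [Category.{w} C] [TwoCat C] :
    TwoNat ((domF C).comp (idF C)) (TwoFunctor.id (Arrow C)) where
  app g := Arrow.homMk (𝟙 g.left) g.hom rfl
  naturality s := by
    apply Arrow.hom_ext
    · exact (Category.comp_id _).trans (Category.id_comp _).symm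
    · exact Arrow.w s
  naturality_cell α := by
    apply ArrowCell.ext
    · exact (hcomp_one _).trans (one_hcomp _).symm
    · exact ArrowCell.w α

end arrows

/-- The hom-categories of `C^𝟐` are pullbacks of hom-categories of `C`. -/
theorem arrow_homsIn (P : ObjectProperty Cat.{w, w}) [IsBase P] (C : Type u) [Category.{w} C]
    [TwoCat C] [HomsIn P C] (f g : Arrow C) : P (Cat.of (HomCat f g)) := by
  let p : HomCat f g ⥤ HomCat f.left g.left :=
    { obj := fun s => Arrow.Hom.left s
      map := fun {s t} α => ⟨ArrowCell.left α.1, congrArg Arrow.Hom.left α.2.1,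
        congrArg Arrow.Hom.left α.2.2⟩
      map_id := fun _ => rfl
      map_comp := fun _ _ => rfl }
  let q : HomCat f g ⥤ HomCat f.right g.right :=
    { obj := fun s => Arrow.Hom.right s
      map := fun {s t} α => ⟨ArrowCell.right α.1, congrArg Arrow.Hom.right α.2.1,
        congrArg Arrow.Hom.right α.2.2⟩
      map_id := fun _ => rfl
      map_comp := fun _ _ => rfl }
  let a : HomCat f.left g.left ⥤ HomCat f.left g.right :=
    { obj := fun s => CategoryStruct.comp (obj := C) s g.hom
      map := fun {s t} α => ⟨hcomp α.1 (one g.hom), by simp [α.2.1], by simp [α.2.2]⟩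
      map_id := fun s => HomCat.hom_ext (one_comp (C := C) s g.hom).symm
      map_comp := fun α β => HomCat.hom_ext (vcomp_hcomp_one _ _ _ _) }
  let b : HomCat f.right g.right ⥤ HomCat f.left g.right :=
    { obj := fun s => CategoryStruct.comp (obj := C) f.hom s
      map := fun {s t} α => ⟨hcomp (one f.hom) α.1, by simp [α.2.1], by simp [α.2.2]⟩
      map_id := fun s => HomCat.hom_ext (one_comp (C := C) f.hom s).symm
      map_comp := fun α β => HomCat.hom_ext (one_hcomp_vcomp _ _ _ _) }
  have hw : p.toCatHom ≫ a.toCatHom = q.toCatHom ≫ b.toCatHom :=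
    Cat.Hom.ext (HomCat.functor_ext (fun s => Arrow.w (f := f) (g := g) s)
      (fun α => ArrowCell.w α.1))
  let lift (S : Cat.{w, w}) (x : S ⥤ HomCat f.left g.left) (y : S ⥤ HomCat f.right g.right)
      (h : x ⋙ a = y ⋙ b) : S ⥤ HomCat f g :=
    { obj := fun s => Arrow.homMk (f := f) (g := g) (x.obj s) (y.obj s) (Functor.congr_obj h s)
      map := fun {s t} k => ⟨ArrowCell.mk (f := f) (g := g) (HomCat.cell (x.map k))
          (HomCat.cell (y.map k)) (by
            have key : ∀ {F G : S ⥤ HomCat f.left g.right}, F = G →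
                HomCat.cell (F.map k) = HomCat.cell (G.map k) := by
              rintro F _ rfl; rfl
            exact key h),
        Arrow.hom_ext _ _ (x.map k).2.1 (y.map k).2.1,
        Arrow.hom_ext _ _ (x.map k).2.2 (y.map k).2.2⟩
      map_id := fun s => Subtype.ext (ArrowCell.ext
        (congrArg HomCat.cell (x.map_id s)) (congrArg HomCat.cell (y.map_id s)))
      map_comp := fun k l => Subtype.ext (ArrowCell.ext
        (congrArg HomCat.cell (x.map_comp k l)) (congrArg HomCat.cell (y.map_comp k l))) }
  have hlim : IsLimit (PullbackCone.mk (W := Cat.of (HomCat f g)) p.toCatHom q.toCatHom hw) := by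
    refine PullbackCone.IsLimit.mk hw
      (fun s => (lift s.pt s.fst.toFunctor s.snd.toFunctor
        (congrArg Cat.Hom.toFunctor s.condition)).toCatHom) ?_ ?_ ?_
    · intro s; rfl
    · intro s; rfl
    · intro s m h₁ h₂
      have key : ∀ {T : Type w} [Category.{w} T] {E : Type w} [Category.{w} E] {F G : T ⥤ E}
          (_ : F = G) (t : T), F.obj t = G.obj t := by
        rintro T _ E _ F _ rfl t; rfl
      have key' : ∀ {T : Type w} [Category.{w} T] {X Y : C} {F G : T ⥤ HomCat X Y} (_ : F = G)
          {t u : T} (k : t ⟶ u), HomCat.cell (F.map k) = HomCat.cell (G.map k) := by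
        rintro T _ X Y F _ rfl t u k; rfl
      have h₁' := congrArg Cat.Hom.toFunctor h₁
      have h₂' := congrArg Cat.Hom.toFunctor h₂
      exact Cat.Hom.ext (HomCat.functor_ext
        (fun t => Arrow.hom_ext _ _ (key h₁' t) (key h₂' t))
        (fun k => ArrowCell.ext (key' h₁' k) (key' h₂' k)))
  refine IsBase.of_shape P WalkingCospan
    { diag := cospan (Functor.toCatHom a) (Functor.toCatHom b)
      π := _
      isLimit := hlim
      prop_diag_obj := ?_ }
  rintro (_ | _ | _)
  · exact HomsIn.prop f.left g.right
  · exact HomsIn.prop f.left g.left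
  · exact HomsIn.prop f.right g.right

instance (P : ObjectProperty Cat.{w, w}) [IsBase P] (C : Type u) [Category.{w} C]
    [TwoCat C] [HomsIn P C] : HomsIn P (Arrow C) where
  prop f g := arrow_homsIn P C f g

/-! ### Hom 2-functors and colimits -/

section homs

variable (P : ObjectProperty Cat.{w, w})
  {C : Type u₁} [Category.{w} C] [TwoCat C] [HomsIn P C]
  {D : Type u₂} [Category.{w} D] [TwoCat D] [HomsIn P D]

/-- The hom-category `C(a, b)`, as an object of `𝒱`. -/
abbrev homObj (a b : C) : VObj P := ⟨HomCat a b, HomsIn.prop a b⟩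

theorem HomCat.natCell_ext {E : Type w} [Category.{w} E] {a b : C} {α β : NatCell E (HomCat a b)}
    (h : α.dom = β.dom) (h' : α.cod = β.cod)
    (hh : ∀ e, HomCat.cell (α.hom.app e) = HomCat.cell (β.hom.app e)) : α = β := by
  obtain ⟨F, G, α⟩ := α
  obtain ⟨F', G', β⟩ := β
  dsimp at h h'
  subst h; subst h'
  congr 1
  ext e
  exact HomCat.hom_ext (hh e)

theorem HomCat.cell_vcomp_app {E : Type w} [Category.{w} E] {a b : C}
    (α β : NatCell E (HomCat a b)) (h : α.cod = β.dom) (e : E) :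
    HomCat.cell ((α.hom ≫ eqToHom h ≫ β.hom).app e) =
      vcomp (HomCat.cell (α.hom.app e)) (HomCat.cell (β.hom.app e))
        ((α.hom.app e).2.2.trans ((Functor.congr_obj h e).trans (β.hom.app e).2.1.symm)) := by
  obtain ⟨F, G, α⟩ := α
  obtain ⟨G', H, β⟩ := β
  dsimp at h
  subst h
  rw [eqToHom_refl, Category.id_comp]
  rfl

/-- Composition with `g`, as a functor `C(a, b) ⥤ C(a, b')`. -/
def postComp (a : C) {b b' : C} (g : b ⟶ b') : HomCat a b ⥤ HomCat a b' where
  obj f := CategoryStruct.comp (obj := C) f g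
  map α := ⟨hcomp α.1 (one g), by simp [α.2.1], by simp [α.2.2]⟩
  map_id f := HomCat.hom_ext (one_comp (C := C) f g).symm
  map_comp _ _ := HomCat.hom_ext (vcomp_hcomp_one _ _ _ _)

/-- Composition with `g`, as a functor `C(a', b) ⥤ C(a, b)`. -/
def preComp {a a' : C} (g : a ⟶ a') (b : C) : HomCat a' b ⥤ HomCat a b where
  obj f := CategoryStruct.comp (obj := C) g f
  map α := ⟨hcomp (one g) α.1, by simp [α.2.1], by simp [α.2.2]⟩
  map_id f := HomCat.hom_ext (one_comp (C := C) g f).symm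
  map_comp _ _ := HomCat.hom_ext (one_hcomp_vcomp _ _ _ _)

theorem hcomp_exchange {X Y Z : C} (α : Cell X Y) (β : Cell Y Z) :
    vcomp (hcomp α (one (src β))) (hcomp (one (tgt α)) β) (by simp) = hcomp α β := by
  have := interchange α (one (tgt α)) (one (src β)) β (by simp) (by simp)
  rw [← this, one_vcomp, vcomp_one]

theorem hcomp_exchange' {X Y Z : C} (α : Cell X Y) (β : Cell Y Z) :
    vcomp (hcomp (one (src α)) β) (hcomp α (one (tgt β))) (by simp) = hcomp α β := by
  have := interchange (one (src α)) α β (one (tgt β)) (by simp) (by simp)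
  rw [← this, one_vcomp, vcomp_one]

/-- Whiskering with a 2-cell `θ`, as a natural transformation between functors
`C(a, b) ⥤ C(a, b')`. -/
def postCell (a : C) {b b' : C} (θ : Cell b b') : NatCell (HomCat a b) (HomCat a b') where
  dom := postComp a (src θ)
  cod := postComp a (tgt θ)
  hom :=
    { app := fun f => ⟨hcomp (one (C := C) f) θ,
          (src_hcomp _ _).trans (congrArg (· ≫ src θ) (src_one (C := C) f)),
          (tgt_hcomp _ _).trans (congrArg (· ≫ tgt θ) (tgt_one (C := C) f))⟩
      naturality := by
        rintro f g ⟨α, rfl, rfl⟩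
        exact HomCat.hom_ext ((hcomp_exchange α θ).trans (hcomp_exchange' α θ).symm) }

/-- Whiskering with a 2-cell `θ`, as a natural transformation between functors
`C(a', b) ⥤ C(a, b)`. -/
def preCell {a a' : C} (θ : Cell a a') (b : C) : NatCell (HomCat a' b) (HomCat a b) where
  dom := preComp (src θ) b
  cod := preComp (tgt θ) b
  hom :=
    { app := fun f => ⟨hcomp θ (one (C := C) f),
          (src_hcomp _ _).trans (congrArg (src θ ≫ ·) (src_one (C := C) f)),
          (tgt_hcomp _ _).trans (congrArg (tgt θ ≫ ·) (tgt_one (C := C) f))⟩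
      naturality := by
        rintro f g ⟨α, rfl, rfl⟩
        exact HomCat.hom_ext ((hcomp_exchange' θ α).trans (hcomp_exchange θ α).symm) }

/-- The covariant hom 2-functor `C(a, -) : C ⟶ 𝒱`. -/
abbrev homFrom (a : C) : TwoFunctor C (VObj P) where
  obj b := homObj P a b
  map g := postComp a g
  map_id b := HomCat.functor_ext (fun f => Category.comp_id (obj := C) (X := a) f)
    (fun α => hcomp_one α.1)
  map_comp g g' := HomCat.functor_ext
    (fun f => (Category.assoc (obj := C) (W := a) f g g').symm)
    (fun α => (congrArg (hcomp α.1) (one_comp g g')).trans (hcomp_assoc α.1 (one g) (one g')).symm)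
  mapCell θ := postCell a θ
  src_mapCell _ := rfl
  tgt_mapCell _ := rfl
  mapCell_one g := HomCat.natCell_ext
    (congrArg (postComp a) (src_one g)) (congrArg (postComp a) (tgt_one g))
    (fun f => (one_comp (C := C) (X := a) f g).symm)
  mapCell_vcomp α β h := HomCat.natCell_ext
    (congrArg (postComp a) (src_vcomp α β h)) (congrArg (postComp a) (tgt_vcomp α β h))
    (fun f => by
      refine (one_hcomp_vcomp (C := C) (X := a) f α β h).trans ?_
      exact (HomCat.cell_vcomp_app (postCell a α) (postCell a β) (congrArg (postComp a) h) f).symm)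
  mapCell_hcomp α β := HomCat.natCell_ext
    ((congrArg (postComp a) (src_hcomp α β)).trans (HomCat.functor_ext
      (fun f => (Category.assoc (obj := C) (W := a) f _ _).symm)
      (fun γ => (congrArg (hcomp γ.1) (one_comp _ _)).trans (hcomp_assoc γ.1 _ _).symm)))
    ((congrArg (postComp a) (tgt_hcomp α β)).trans (HomCat.functor_ext
      (fun f => (Category.assoc (obj := C) (W := a) f _ _).symm)
      (fun γ => (congrArg (hcomp γ.1) (one_comp _ _)).trans (hcomp_assoc γ.1 _ _).symm)))
    (fun f => by
      refine (hcomp_assoc (one (C := C) (X := a) f) α β).symm.trans ?_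
      refine (hcomp_exchange' _ _).symm.trans ?_
      refine vcomp_congr (congrArg (fun k => hcomp (one k) β) ?_) rfl _ _
      exact (src_hcomp _ _).trans (congrArg (· ≫ src α) (src_one (C := C) (X := a) f)))

/-- The contravariant hom 2-functor `C(-, b) : Cᵒᵖ ⟶ 𝒱`. -/
abbrev homTo (b : C) : TwoFunctor Cᵒᵖ (VObj P) where
  obj a := homObj P a.unop b
  map g := preComp g.unop b
  map_id a := HomCat.functor_ext (fun f => Category.id_comp (obj := C) (Y := b) f)
    (fun α => one_hcomp α.1)
  map_comp g g' := HomCat.functor_ext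
    (fun f => Category.assoc (obj := C) (Z := b) g'.unop g.unop f)
    (fun α => (congrArg (fun k => hcomp k α.1) (one_comp g'.unop g.unop)).trans
      (hcomp_assoc (one g'.unop) (one g.unop) α.1))
  mapCell {a a'} θ := preCell (a := a'.unop) (a' := a.unop) θ b
  src_mapCell _ := rfl
  tgt_mapCell _ := rfl
  mapCell_one g := HomCat.natCell_ext
    (congrArg (fun k => preComp k b) (src_one (C := C) g.unop))
    (congrArg (fun k => preComp k b) (tgt_one (C := C) g.unop))
    (fun f => (one_comp (C := C) (Z := b) g.unop f).symm)
  mapCell_vcomp {a a'} α β h := HomCat.natCell_ext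
    (congrArg (fun k => preComp k b) (src_vcomp (C := C) (X := a'.unop) (Y := a.unop) α β
      (Quiver.Hom.op_inj h)))
    (congrArg (fun k => preComp k b) (tgt_vcomp (C := C) (X := a'.unop) (Y := a.unop) α β
      (Quiver.Hom.op_inj h)))
    (fun f => by
      refine (vcomp_hcomp_one (C := C) (X := a'.unop) (Y := a.unop) (Z := b) α β
        (Quiver.Hom.op_inj h) f).trans ?_
      exact (HomCat.cell_vcomp_app (preCell (a := a'.unop) (a' := a.unop) α b)
        (preCell (a := a'.unop) (a' := a.unop) β b) (congrArg (fun k => preComp k b) (Quiver.Hom.op_inj h)) f).symm)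
  mapCell_hcomp {a a' a''} α β := HomCat.natCell_ext
    ((congrArg (fun k => preComp k b) (src_hcomp (C := C) (X := a''.unop) (Y := a'.unop)
      (Z := a.unop) β α)).trans (HomCat.functor_ext
      (fun f => Category.assoc (obj := C) (Z := b) _ _ f)
      (fun γ => (congrArg (fun k => hcomp k γ.1) (one_comp _ _)).trans (hcomp_assoc _ _ γ.1))))
    ((congrArg (fun k => preComp k b) (tgt_hcomp (C := C) (X := a''.unop) (Y := a'.unop)
      (Z := a.unop) β α)).trans (HomCat.functor_ext
      (fun f => Category.assoc (obj := C) (Z := b) _ _ f)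
      (fun γ => (congrArg (fun k => hcomp k γ.1) (one_comp _ _)).trans (hcomp_assoc _ _ γ.1))))
    (fun f => by
      refine (hcomp_assoc (C := C) (X := a''.unop) (Y := a'.unop)
      (Z := a.unop) β α (one (C := C) (Y := b) f)).trans ?_
      refine (hcomp_exchange (C := C) (X := a''.unop) (Y := a'.unop) β
        (hcomp (C := C) (X := a'.unop) (Y := a.unop) α (one (C := C) (Y := b) f))).symm.trans ?_
      have e : src (hcomp (C := C) (X := a'.unop) (Y := a.unop) α (one (C := C) (Y := b) f)) =
          src (C := C) (X := a'.unop) (Y := a.unop) α ≫ f :=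
        (src_hcomp _ _).trans (congrArg (src (C := C) (X := a'.unop) (Y := a.unop) α ≫ ·)
          (src_one (C := C) (Y := b) f))
      exact vcomp_congr (congrArg (fun k => hcomp (C := C) (X := a''.unop) (Y := a'.unop) β
        (one k)) e) rfl _ _)

/-- The 2-natural transformation `C(-, b) ⟶ C(-, b')` induced by a morphism `b ⟶ b'`. -/
def homToMap {b b' : C} (g : b ⟶ b') : TwoNat (homTo P b) (homTo P b') where
  app a := postComp a.unop g
  naturality s := HomCat.functor_ext
    (fun f => Category.assoc (obj := C) s.unop f g)
    (fun α => hcomp_assoc (one s.unop) α.1 (one g))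
  naturality_cell {a a'} θ := HomCat.natCell_ext
    (HomCat.functor_ext (fun f => Category.assoc (obj := C) (X := a.unop) _ f g)
      (fun α => hcomp_assoc (one _) α.1 (one g)))
    (HomCat.functor_ext (fun f => Category.assoc (obj := C) (X := a.unop) _ f g)
      (fun α => hcomp_assoc (one _) α.1 (one g)))
    (fun f => by
      refine (congrArg HomCat.cell (NatTrans.hcomp_id_app
        (H := postComp a'.unop g) (preCell (a := a'.unop) (a' := a.unop) θ b).hom f)).trans ?_
      refine Eq.trans ?_ (congrArg HomCat.cell (NatTrans.id_hcomp_app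
        (H := postComp a.unop g) (preCell (a := a'.unop) (a' := a.unop) θ b').hom f)).symm
      exact (hcomp_assoc (C := C) (X := a'.unop) (Y := a.unop) θ _ _).trans
        (congrArg (fun k => hcomp (C := C) (X := a'.unop) (Y := a.unop) θ k)
          (one_comp (C := C) (X := a.unop) f g).symm))

/-- The action of a 2-functor on hom-categories. -/
def homAct (F : TwoFunctor C D) (a b : C) : homObj P a b ⟶ homObj P (F.obj a) (F.obj b) where
  obj f := F.map f
  map α := ⟨F.mapCell α.1, by rw [F.src_mapCell, α.2.1], by rw [F.tgt_mapCell, α.2.2]⟩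
  map_id f := HomCat.hom_ext (F.mapCell_one f)
  map_comp α β := HomCat.hom_ext (F.mapCell_vcomp _ _ _)

/-- The 2-natural transformation `C(-, L) ⟶ D(F-, FL)` given by the action of a 2-functor `F` on
hom-categories. -/
def homActNat (F : TwoFunctor C D) (L : C) :
    TwoNat (homTo P L) (F.op.comp (homTo P (F.obj L))) where
  app a := homAct P F a.unop L
  naturality {a a'} g := HomCat.functor_ext (fun f => F.map_comp g.unop f)
    (fun α => (F.mapCell_hcomp _ _).trans
      (congrArg (fun k => hcomp k (F.mapCell α.1)) (F.mapCell_one g.unop)))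
  naturality_cell {a a'} θ := HomCat.natCell_ext
    (HomCat.functor_ext (fun f => (F.map_comp _ f).trans (congrArg (· ≫ F.map f)
        (F.src_mapCell (X := a'.unop) (Y := a.unop) θ).symm))
      (fun α => (F.mapCell_hcomp _ _).trans (congrArg (fun k => hcomp k (F.mapCell α.1))
        ((F.mapCell_one _).trans (congrArg one
          (F.src_mapCell (X := a'.unop) (Y := a.unop) θ).symm)))))
    (HomCat.functor_ext (fun f => (F.map_comp _ f).trans (congrArg (· ≫ F.map f)
        (F.tgt_mapCell (X := a'.unop) (Y := a.unop) θ).symm))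
      (fun α => (F.mapCell_hcomp _ _).trans (congrArg (fun k => hcomp k (F.mapCell α.1))
        ((F.mapCell_one _).trans (congrArg one
          (F.tgt_mapCell (X := a'.unop) (Y := a.unop) θ).symm)))))
    (fun f => by
      refine (congrArg HomCat.cell (NatTrans.hcomp_id_app
        (H := homAct P F a'.unop L) (preCell (a := a'.unop) (a' := a.unop) θ L).hom f)).trans ?_
      refine Eq.trans ?_ (congrArg HomCat.cell (NatTrans.id_hcomp_app
        (H := homAct P F a.unop L) (preCell (a := F.obj a'.unop) (a' := F.obj a.unop)
          (F.mapCell (X := a'.unop) (Y := a.unop) θ) (F.obj L)).hom f)).symm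
      exact (F.mapCell_hcomp (X := a'.unop) (Y := a.unop) θ _).trans
        (congrArg (fun k => hcomp (F.mapCell (X := a'.unop) (Y := a.unop) θ) k)
          (F.mapCell_one (X := a.unop) f)))

end homs

section colimits

variable (P : ObjectProperty Cat.{w, w})
  {C : Type u₁} [Category.{w} C] [TwoCat C] [HomsIn P C]
  {D : Type u₂} [Category.{w} D] [TwoCat D] [HomsIn P D]

/-- `L`, with the unit `ν : φ ⟶ C(G-, L)`, is the colimit of the `𝒱`-functor `G : J ⟶ C` weighted by
the `𝒱`-functor `φ : Jᵒᵖ ⟶ 𝒱`: for every `X`, composition with `ν` is an isomorphism of categories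
from `C(L, X)` to `[Jᵒᵖ, 𝒱](φ, C(G-, X))`. -/
def IsWeightedColimit {J : Type w} [Category.{w} J] [TwoCat J] {φ : TwoFunctor Jᵒᵖ (VObj P)}
    {G : TwoFunctor J C} {L : C} (ν : TwoNat φ (G.op.comp (homTo P L))) : Prop :=
  ∀ X : C,
    (∀ s : TwoNat φ (G.op.comp (homTo P X)),
      ∃! f : L ⟶ X, ∀ j : Jᵒᵖ, ν.app j ≫ (homFrom P (G.obj j.unop)).map f = s.app j) ∧
    (∀ (s t : TwoNat φ (G.op.comp (homTo P X))) (Γ : Modif s t),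
      ∃! θ : Cell L X, ∀ j : Jᵒᵖ,
        hcomp (one (ν.app j)) ((homFrom P (G.obj j.unop)).mapCell θ) = Γ.app j)

variable (C) in
/-- A `𝒱`-category is cocomplete when it has all small weighted colimits. -/
def IsCocomplete : Prop :=
  ∀ (J : Type w) [Category.{w} J] [TwoCat J] [HomsIn P J] (φ : TwoFunctor Jᵒᵖ (VObj P))
    (G : TwoFunctor J C), ∃ (L : C) (ν : TwoNat φ (G.op.comp (homTo P L))), IsWeightedColimit P ν

/-- The effect of a `𝒱`-functor `F` on the unit `φ ⟶ C(G-, L)` of a weighted colimit. -/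
def mapUnit (F : TwoFunctor C D) {J : Type w} [Category.{w} J] [TwoCat J]
    {φ : TwoFunctor Jᵒᵖ (VObj P)} {G : TwoFunctor J C} {L : C}
    (ν : TwoNat φ (G.op.comp (homTo P L))) :
    TwoNat φ ((G.comp F).op.comp (homTo P (F.obj L))) :=
  ν.comp ((homActNat P F L).whiskerLeft G.op)

/-- A `𝒱`-functor is cocontinuous when it preserves all small weighted colimits. -/
def IsCocontinuous (F : TwoFunctor C D) : Prop :=
  ∀ (J : Type w) [Category.{w} J] [TwoCat J] [HomsIn P J] (φ : TwoFunctor Jᵒᵖ (VObj P))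
    (G : TwoFunctor J C) (L : C) (ν : TwoNat φ (G.op.comp (homTo P L))),
    IsWeightedColimit P ν → IsWeightedColimit P (mapUnit P F ν)

end colimits

/-- A colimit of an ordinary diagram in a 2-category (a conical colimit): its universal property
holds for morphisms and for 2-cells. -/
structure IsConicalColimit {C : Type u₁} [Category.{w} C] [TwoCat C] {I : Type w} [SmallCategory I]
    {D : I ⥤ C} (c : Cocone D) : Prop where
  isColimit : Nonempty (IsColimit c)
  cell (X : C) (Γ : ∀ i, Cell (D.obj i) X)
    (hΓ : ∀ {i j : I} (k : i ⟶ j), hcomp (one (D.map k)) (Γ j) = Γ i) :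
    ∃! θ : Cell c.pt X, ∀ i, hcomp (one (c.ι.app i)) θ = Γ i

/-! ### Algebraic weak factorisation systems -/

/-- A functorial factorisation on a 2-category, compatible with the 2-cells: every morphism `f` is
factorised as `λ_f : dom f ⟶ K f` followed by `ρ_f : K f ⟶ cod f`. -/
structure FunctorialFactorisation (C : Type u₁) [Category.{w} C] [TwoCat C] where
  K : TwoFunctor (Arrow C) C
  lam : TwoNat (domF C) K
  rho : TwoNat K (codF C)
  fac (f : Arrow C) : lam.app f ≫ rho.app f = f.hom

namespace FunctorialFactorisation

variable {C : Type u₁} [Category.{w} C] [TwoCat C] (S : FunctorialFactorisation C)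

/-- The endo-2-functor `L` of `C^𝟐`, with `L f = λ_f`. -/
abbrev L : TwoFunctor (Arrow C) (Arrow C) := S.lam.toArrow

/-- The endo-2-functor `R` of `C^𝟐`, with `R f = ρ_f`. -/
abbrev R : TwoFunctor (Arrow C) (Arrow C) := S.rho.toArrow

/-- The counit `Φ_f = (1, ρ_f) : L f ⟶ f`. -/
abbrev counit (f : Arrow C) : S.L.obj f ⟶ f :=
  Arrow.homMk (𝟙 f.left) (S.rho.app f) ((Category.id_comp _).trans (S.fac f).symm)

/-- The unit `Λ_f = (λ_f, 1) : f ⟶ R f`. -/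
abbrev unit (f : Arrow C) : f ⟶ S.R.obj f :=
  Arrow.homMk (S.lam.app f) (𝟙 f.right) ((S.fac f).trans (Category.comp_id _).symm)

end FunctorialFactorisation

/-- An enriched algebraic weak factorisation system: a functorial factorisation with a
comultiplication `Σ_f = (1, σ_f) : L f ⟶ L L f` making `L` a comonad, a multiplication
`Π_f = (π_f, 1) : R R f ⟶ R f` making `R` a monad, such that the `(σ_f, π_f) : L R f ⟶ R L f`
form a mixed distributive law.  (Given the comonad and the monad axioms, all the axioms of a mixed
distributive law follow from the equality `distrib`.) -/
structure AWFS (C : Type u₁) [Category.{w} C] [TwoCat C] extends FunctorialFactorisation C where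
  sigma : TwoNat K (toFunctorialFactorisation.L.comp K)
  pi : TwoNat (toFunctorialFactorisation.R.comp K) K
  lam_sigma (f : Arrow C) :
    lam.app f ≫ sigma.app f = lam.app (toFunctorialFactorisation.L.obj f)
  pi_rho (f : Arrow C) :
    pi.app f ≫ rho.app f = rho.app (toFunctorialFactorisation.R.obj f)
  sigma_counit (f : Arrow C) :
    sigma.app f ≫ K.map (toFunctorialFactorisation.counit f) = 𝟙 (K.obj f)
  sigma_counit' (f : Arrow C) :
    sigma.app f ≫ rho.app (toFunctorialFactorisation.L.obj f) = 𝟙 (K.obj f)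
  coassoc (f : Arrow C) :
    sigma.app f ≫ sigma.app (toFunctorialFactorisation.L.obj f) =
      sigma.app f ≫ K.map (Arrow.homMk (f := toFunctorialFactorisation.L.obj f)
        (g := toFunctorialFactorisation.L.obj (toFunctorialFactorisation.L.obj f))
        (𝟙 f.left) (sigma.app f) ((Category.id_comp _).trans (lam_sigma f).symm))
  unit_pi (f : Arrow C) :
    K.map (toFunctorialFactorisation.unit f) ≫ pi.app f = 𝟙 (K.obj f)
  unit_pi' (f : Arrow C) :
    lam.app (toFunctorialFactorisation.R.obj f) ≫ pi.app f = 𝟙 (K.obj f)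
  assoc (f : Arrow C) :
    pi.app (toFunctorialFactorisation.R.obj f) ≫ pi.app f =
      K.map (Arrow.homMk
        (f := toFunctorialFactorisation.R.obj (toFunctorialFactorisation.R.obj f))
        (g := toFunctorialFactorisation.R.obj f)
        (pi.app f) (𝟙 f.right) ((pi_rho f).trans (Category.comp_id _).symm)) ≫ pi.app f
  distrib (f : Arrow C) :
    pi.app f ≫ sigma.app f =
      sigma.app (toFunctorialFactorisation.R.obj f) ≫
        K.map (Arrow.homMk
          (f := toFunctorialFactorisation.L.obj (toFunctorialFactorisation.R.obj f))
          (g := toFunctorialFactorisation.R.obj (toFunctorialFactorisation.L.obj f))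
          (sigma.app f) (pi.app f) ((sigma_counit' f).trans (unit_pi' f).symm)) ≫
        pi.app (toFunctorialFactorisation.L.obj f)

/-! ### Algebras -/

/-- A 2-category over a 2-category `D` whose forgetful 2-functor to `D` is injective on the
morphisms and the 2-cells between fixed objects: it is given by its objects, by their images in `D`,
and by the morphisms and the 2-cells of `D` that belong to it. -/
structure ConcreteTwoCat (D : Type u) [Category.{w} D] [TwoCat D] where
  Obj : Type (max u w)
  ob : Obj → D
  IsHom {a b : Obj} : (ob a ⟶ ob b) → Prop
  IsCell {a b : Obj} : Cell (ob a) (ob b) → Prop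
  id_hom (a : Obj) : IsHom (a := a) (b := a) (𝟙 (ob a))
  comp_hom {a b c : Obj} {f : ob a ⟶ ob b} {g : ob b ⟶ ob c} :
    IsHom f → IsHom g → IsHom (a := a) (b := c) (f ≫ g)
  src_cell {a b : Obj} {α : Cell (ob a) (ob b)} : IsCell α → IsHom (src α)
  tgt_cell {a b : Obj} {α : Cell (ob a) (ob b)} : IsCell α → IsHom (tgt α)
  one_cell {a b : Obj} {f : ob a ⟶ ob b} : IsHom f → IsCell (one f)
  vcomp_cell {a b : Obj} {α β : Cell (ob a) (ob b)} (h : tgt α = src β) :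
    IsCell α → IsCell β → IsCell (vcomp α β h)
  hcomp_cell {a b c : Obj} {α : Cell (ob a) (ob b)} {β : Cell (ob b) (ob c)} :
    IsCell α → IsCell β → IsCell (a := a) (b := c) (hcomp α β)

namespace ConcreteTwoCat

variable {D : Type u} [Category.{w} D] [TwoCat D] (S : ConcreteTwoCat D)

instance : Category.{w} S.Obj where
  Hom a b := {f : S.ob a ⟶ S.ob b // S.IsHom f}
  id a := ⟨𝟙 _, S.id_hom a⟩
  comp f g := ⟨f.1 ≫ g.1, S.comp_hom f.2 g.2⟩

instance : TwoCat S.Obj where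
  Cell a b := {α : Cell (S.ob a) (S.ob b) // S.IsCell α}
  src α := ⟨src α.1, S.src_cell α.2⟩
  tgt α := ⟨tgt α.1, S.tgt_cell α.2⟩
  one f := ⟨one f.1, S.one_cell f.2⟩
  vcomp α β h := ⟨vcomp α.1 β.1 (congrArg Subtype.val h), S.vcomp_cell _ α.2 β.2⟩
  hcomp α β := ⟨hcomp α.1 β.1, S.hcomp_cell α.2 β.2⟩
  src_one _ := Subtype.ext (TwoCat.src_one _)
  tgt_one _ := Subtype.ext (TwoCat.tgt_one _)
  src_vcomp _ _ _ := Subtype.ext (TwoCat.src_vcomp _ _ _)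
  tgt_vcomp _ _ _ := Subtype.ext (TwoCat.tgt_vcomp _ _ _)
  src_hcomp _ _ := Subtype.ext (TwoCat.src_hcomp _ _)
  tgt_hcomp _ _ := Subtype.ext (TwoCat.tgt_hcomp _ _)
  one_vcomp _ := Subtype.ext (TwoCat.one_vcomp _)
  vcomp_one _ := Subtype.ext (TwoCat.vcomp_one _)
  vcomp_assoc _ _ _ _ _ := Subtype.ext (TwoCat.vcomp_assoc _ _ _ _ _)
  one_hcomp _ := Subtype.ext (TwoCat.one_hcomp _)
  hcomp_one _ := Subtype.ext (TwoCat.hcomp_one _)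
  hcomp_assoc _ _ _ := Subtype.ext (TwoCat.hcomp_assoc _ _ _)
  one_comp _ _ := Subtype.ext (TwoCat.one_comp _ _)
  interchange _ _ _ _ _ _ := Subtype.ext (TwoCat.interchange _ _ _ _ _ _)

/-- The forgetful 2-functor. -/
abbrev forget : TwoFunctor S.Obj D where
  obj := S.ob
  map f := f.1
  map_id _ := rfl
  map_comp _ _ := rfl
  mapCell α := α.1
  src_mapCell _ := rfl
  tgt_mapCell _ := rfl
  mapCell_one _ := rfl
  mapCell_vcomp _ _ _ := rfl
  mapCell_hcomp _ _ := rfl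

/-- The full sub-2-category on the objects that satisfy `p`. -/
def restrict (p : S.Obj → Prop) : ConcreteTwoCat D where
  Obj := {a : S.Obj // p a}
  ob a := S.ob a.1
  IsHom {a b} f := S.IsHom (a := a.1) (b := b.1) f
  IsCell {a b} α := S.IsCell (a := a.1) (b := b.1) α
  id_hom a := S.id_hom a.1
  comp_hom hf hg := S.comp_hom hf hg
  src_cell h := S.src_cell h
  tgt_cell h := S.tgt_cell h
  one_cell h := S.one_cell h
  vcomp_cell h hα hβ := S.vcomp_cell h hα hβ
  hcomp_cell hα hβ := S.hcomp_cell hα hβ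

end ConcreteTwoCat

namespace AWFS

variable {C : Type u₁} [Category.{w} C] [TwoCat C] (S : AWFS C)

/-- `p : K f ⟶ dom f` is an `R`-algebra structure on `f`, meaning that `(p, 1) : R f ⟶ f` is an
action of the monad `R`. -/
structure IsAlg (f : Arrow C) (p : S.K.obj f ⟶ f.left) : Prop where
  w : p ≫ f.hom = S.rho.app f
  unit : S.lam.app f ≫ p = 𝟙 f.left
  assoc : S.pi.app f ≫ p =
    S.K.map (Arrow.homMk (f := S.R.obj f) (g := f) p (𝟙 f.right)
      (w.trans (Category.comp_id _).symm)) ≫ p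

/-- The square `s : f ⟶ g` is a morphism from the algebra `(f, p)` to the algebra `(g, q)`. -/
def IsAlgHom {f g : Arrow C} (p : S.K.obj f ⟶ f.left) (q : S.K.obj g ⟶ g.left) (s : f ⟶ g) :
    Prop :=
  S.K.map s ≫ q = p ≫ s.left

/-- The 2-cell `α` of `C^𝟐` is a 2-cell from the algebra `(f, p)` to the algebra `(g, q)`. -/
def IsAlgCell {f g : Arrow C} (p : S.K.obj f ⟶ f.left) (q : S.K.obj g ⟶ g.left) (α : Cell f g) :
    Prop :=
  hcomp (S.K.mapCell α) (one q) = hcomp (one p) (ArrowCell.left α)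

section

variable {S}

theorem isAlgHom_id {f : Arrow C} (p : S.K.obj f ⟶ f.left) : S.IsAlgHom p p (𝟙 f) := by
  change S.K.map (𝟙 f) ≫ p = p ≫ 𝟙 _
  rw [S.K.map_id, Category.id_comp, Category.comp_id]

theorem IsAlgHom.comp {f g h : Arrow C} {p : S.K.obj f ⟶ f.left} {q : S.K.obj g ⟶ g.left}
    {r : S.K.obj h ⟶ h.left} {s : f ⟶ g} {t : g ⟶ h} (hs : S.IsAlgHom p q s)
    (ht : S.IsAlgHom q r t) : S.IsAlgHom p r (s ≫ t) := by
  change S.K.map (s ≫ t) ≫ r = p ≫ s.left ≫ t.left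
  rw [S.K.map_comp, Category.assoc, ht, ← Category.assoc, hs, Category.assoc]

theorem IsAlgCell.src {f g : Arrow C} {p : S.K.obj f ⟶ f.left} {q : S.K.obj g ⟶ g.left}
    {α : Cell f g} (h : S.IsAlgCell p q α) : S.IsAlgHom p q (TwoCat.src α) := by
  have := congrArg TwoCat.src h
  rw [src_hcomp, src_hcomp, src_one, src_one, S.K.src_mapCell] at this
  exact this

theorem IsAlgCell.tgt {f g : Arrow C} {p : S.K.obj f ⟶ f.left} {q : S.K.obj g ⟶ g.left}
    {α : Cell f g} (h : S.IsAlgCell p q α) : S.IsAlgHom p q (TwoCat.tgt α) := by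
  have := congrArg TwoCat.tgt h
  rw [tgt_hcomp, tgt_hcomp, tgt_one, tgt_one, S.K.tgt_mapCell] at this
  exact this

theorem IsAlgHom.one {f g : Arrow C} {p : S.K.obj f ⟶ f.left} {q : S.K.obj g ⟶ g.left}
    {s : f ⟶ g} (h : S.IsAlgHom p q s) : S.IsAlgCell p q (TwoCat.one s) := by
  change hcomp (S.K.mapCell (TwoCat.one s)) (TwoCat.one q) =
    hcomp (TwoCat.one p) (TwoCat.one s.left)
  rw [S.K.mapCell_one, ← one_comp, ← one_comp, h]

theorem IsAlgCell.vcomp {f g : Arrow C} {p : S.K.obj f ⟶ f.left} {q : S.K.obj g ⟶ g.left}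
    {α β : Cell f g} (e : TwoCat.tgt α = TwoCat.src β) (hα : S.IsAlgCell p q α)
    (hβ : S.IsAlgCell p q β) : S.IsAlgCell p q (TwoCat.vcomp α β e) := by
  have e' : TwoCat.tgt (ArrowCell.left α) = TwoCat.src (ArrowCell.left β) :=
    congrArg Arrow.Hom.left e
  change hcomp (S.K.mapCell (TwoCat.vcomp α β e)) (TwoCat.one q) =
    hcomp (TwoCat.one p) (TwoCat.vcomp (ArrowCell.left α) (ArrowCell.left β) e')
  rw [S.K.mapCell_vcomp, vcomp_hcomp_one, one_hcomp_vcomp]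
  exact vcomp_congr hα hβ _ _

theorem IsAlgCell.hcomp {f g h : Arrow C} {p : S.K.obj f ⟶ f.left} {q : S.K.obj g ⟶ g.left}
    {r : S.K.obj h ⟶ h.left} {α : Cell f g} {β : Cell g h} (hα : S.IsAlgCell p q α)
    (hβ : S.IsAlgCell q r β) : S.IsAlgCell p r (TwoCat.hcomp α β) := by
  change TwoCat.hcomp (S.K.mapCell (TwoCat.hcomp α β)) (TwoCat.one r) =
    TwoCat.hcomp (TwoCat.one p) (TwoCat.hcomp (ArrowCell.left α) (ArrowCell.left β))
  rw [S.K.mapCell_hcomp, hcomp_assoc, hβ, ← hcomp_assoc, hα, hcomp_assoc]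

end

/-- An `R`-algebra. -/
structure Algebra where
  arrow : Arrow C
  str : S.K.obj arrow ⟶ arrow.left
  isAlg : S.IsAlg arrow str

/-- The `𝒱`-category `R-Alg` over `C^𝟐`. -/
def alg : ConcreteTwoCat (Arrow C) where
  Obj := S.Algebra
  ob a := a.arrow
  IsHom {a b} s := S.IsAlgHom a.str b.str s
  IsCell {a b} α := S.IsAlgCell a.str b.str α
  id_hom a := isAlgHom_id a.str
  comp_hom h h' := h.comp h'
  src_cell h := h.src
  tgt_cell h := h.tgt
  one_cell h := h.one
  vcomp_cell e h h' := h.vcomp e h'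
  hcomp_cell h h' := h.hcomp h'

section comp

variable {X Y Z : C} {f : X ⟶ Y} {g : Y ⟶ Z}

/-- The square `(f, 1) : f ≫ g ⟶ g`. -/
def sqSnd (f : X ⟶ Y) (g : Y ⟶ Z) : Arrow.mk (f ≫ g) ⟶ Arrow.mk g :=
  Arrow.homMk (f := Arrow.mk (f ≫ g)) (g := Arrow.mk g) f (𝟙 Z) (Category.comp_id _).symm

/-- The square `(1, g) : f ⟶ f ≫ g`. -/
def sqFst (f : X ⟶ Y) (g : Y ⟶ Z) : Arrow.mk f ⟶ Arrow.mk (f ≫ g) :=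
  Arrow.homMk (f := Arrow.mk f) (g := Arrow.mk (f ≫ g)) (𝟙 X) g (Category.id_comp _)

/-- The square `(1, q . K (f, 1)) : L (f ≫ g) ⟶ f` given by the algebra `(g, q)`. -/
def compSquare (f : X ⟶ Y) {q : S.K.obj (Arrow.mk g) ⟶ Y} (hq : S.IsAlg (Arrow.mk g) q) :
    S.L.obj (Arrow.mk (f ≫ g)) ⟶ Arrow.mk f :=
  Arrow.homMk (f := S.L.obj (Arrow.mk (f ≫ g))) (g := Arrow.mk f) (𝟙 X)
    (S.K.map (sqSnd f g) ≫ q) (by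
      have h := S.lam.naturality (sqSnd f g)
      have h' : S.lam.app (Arrow.mk g) ≫ q = 𝟙 Y := hq.unit
      change 𝟙 X ≫ f = S.lam.app (Arrow.mk (f ≫ g)) ≫ S.K.map (sqSnd f g) ≫ q
      rw [← Category.assoc, ← h, Category.assoc, h']
      exact (Category.id_comp _).trans (Category.comp_id _).symm)

/-- The composite of the algebra `(f, p)` with the algebra `(g, q)`, an algebra structure on
`f ≫ g`. -/
def compStr (p : S.K.obj (Arrow.mk f) ⟶ X) {q : S.K.obj (Arrow.mk g) ⟶ Y}
    (hq : S.IsAlg (Arrow.mk g) q) : S.K.obj (Arrow.mk (f ≫ g)) ⟶ X :=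
  S.sigma.app (Arrow.mk (f ≫ g)) ≫ S.K.map (S.compSquare f hq) ≫ p

variable {S}

theorem compStr_comp {p : S.K.obj (Arrow.mk f) ⟶ X} {q : S.K.obj (Arrow.mk g) ⟶ Y}
    (hp : S.IsAlg (Arrow.mk f) p) (hq : S.IsAlg (Arrow.mk g) q) :
    S.compStr p hq ≫ f = S.K.map (sqSnd f g) ≫ q := by
  have h₁ : p ≫ f = S.rho.app (Arrow.mk f) := hp.w
  have h₂ : S.K.map (S.compSquare f hq) ≫ S.rho.app (Arrow.mk f) =
    S.rho.app (S.L.obj (Arrow.mk (f ≫ g))) ≫ S.K.map (sqSnd f g) ≫ q :=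
    S.rho.naturality (S.compSquare f hq)
  rw [compStr, Category.assoc, Category.assoc, h₁, h₂, ← Category.assoc, S.sigma_counit',
    Category.id_comp]

theorem isAlg_compStr {p : S.K.obj (Arrow.mk f) ⟶ X} {q : S.K.obj (Arrow.mk g) ⟶ Y}
    (hp : S.IsAlg (Arrow.mk f) p) (hq : S.IsAlg (Arrow.mk g) q) :
    S.IsAlg (Arrow.mk (f ≫ g)) (S.compStr p hq) := by
  have hw : S.compStr p hq ≫ f ≫ g = S.rho.app (Arrow.mk (f ≫ g)) := by
    have h₁ : q ≫ g = S.rho.app (Arrow.mk g) := hq.w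
    have h₂ := S.rho.naturality (sqSnd f g)
    rw [← Category.assoc, compStr_comp hp hq, Category.assoc, h₁, h₂]
    exact Category.comp_id _
  refine ⟨hw, ?_, ?_⟩
  · have h₁ : 𝟙 X ≫ S.lam.app (Arrow.mk f) =
        S.lam.app (S.L.obj (Arrow.mk (f ≫ g))) ≫ S.K.map (S.compSquare f hq) :=
      S.lam.naturality (S.compSquare f hq)
    have h₂ : S.lam.app (Arrow.mk f) ≫ p = 𝟙 X := hp.unit
    have h₃ := S.lam_sigma (Arrow.mk (f ≫ g))
    calc S.lam.app (Arrow.mk (f ≫ g)) ≫ S.sigma.app (Arrow.mk (f ≫ g)) ≫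
          S.K.map (S.compSquare f hq) ≫ p
        = (S.lam.app (Arrow.mk (f ≫ g)) ≫ S.sigma.app (Arrow.mk (f ≫ g))) ≫
          S.K.map (S.compSquare f hq) ≫ p := (Category.assoc _ _ _).symm
      _ = (S.lam.app (S.L.obj (Arrow.mk (f ≫ g))) ≫ S.K.map (S.compSquare f hq)) ≫ p := by
          rw [h₃]; exact (Category.assoc _ _ _).symm
      _ = 𝟙 X := by rw [← h₁, Category.id_comp, h₂]
  · have hr : S.compStr p hq ≫ f = S.K.map (sqSnd f g) ≫ q := compStr_comp hp hq
    -- the two squares to compare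
    let u : S.R.obj (Arrow.mk (f ≫ g)) ⟶ Arrow.mk (f ≫ g) :=
      Arrow.homMk (f := S.R.obj (Arrow.mk (f ≫ g))) (g := Arrow.mk (f ≫ g)) (S.compStr p hq) (𝟙 Z)
        (hw.trans (Category.comp_id _).symm)
    let δ : S.L.obj (S.R.obj (Arrow.mk (f ≫ g))) ⟶ S.R.obj (S.L.obj (Arrow.mk (f ≫ g))) :=
      Arrow.homMk (S.sigma.app (Arrow.mk (f ≫ g))) (S.pi.app (Arrow.mk (f ≫ g)))
        ((S.sigma_counit' _).trans (S.unit_pi' _).symm)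
    let vp : S.R.obj (Arrow.mk f) ⟶ Arrow.mk f :=
      Arrow.homMk (f := S.R.obj (Arrow.mk f)) (g := Arrow.mk f) p (𝟙 Y)
        (hp.w.trans (Category.comp_id _).symm)
    let vq : S.R.obj (Arrow.mk g) ⟶ Arrow.mk g :=
      Arrow.homMk (f := S.R.obj (Arrow.mk g)) (g := Arrow.mk g) q (𝟙 Z)
        (hq.w.trans (Category.comp_id _).symm)
    have pa : S.pi.app (Arrow.mk f) ≫ p = S.K.map vp ≫ p := hp.assoc
    have qa : S.pi.app (Arrow.mk g) ≫ q = S.K.map vq ≫ q := hq.assoc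
    have hd : S.pi.app (Arrow.mk (f ≫ g)) ≫ S.sigma.app (Arrow.mk (f ≫ g)) =
        S.sigma.app (S.R.obj (Arrow.mk (f ≫ g))) ≫ S.K.map δ ≫
          S.pi.app (S.L.obj (Arrow.mk (f ≫ g))) := S.distrib _
    have hπ : S.K.map (S.R.map (S.compSquare f hq)) ≫ S.pi.app (Arrow.mk f) =
        S.pi.app (S.L.obj (Arrow.mk (f ≫ g))) ≫ S.K.map (S.compSquare f hq) :=
      S.pi.naturality (S.compSquare f hq)
    have hπ' : S.K.map (S.R.map (sqSnd f g)) ≫ S.pi.app (Arrow.mk g) =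
        S.pi.app (Arrow.mk (f ≫ g)) ≫ S.K.map (sqSnd f g) := S.pi.naturality (sqSnd f g)
    have hσ : S.K.map u ≫ S.sigma.app (Arrow.mk (f ≫ g)) =
        S.sigma.app (S.R.obj (Arrow.mk (f ≫ g))) ≫ S.K.map (S.L.map u) := S.sigma.naturality u
    have hsq : u ≫ sqSnd f g = S.R.map (sqSnd f g) ≫ vq := by
      apply Arrow.hom_ext
      · exact hr
      · rfl
    have key : δ ≫ S.R.map (S.compSquare f hq) ≫ vp = S.L.map u ≫ S.compSquare f hq := by
      apply Arrow.hom_ext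
      · exact (Category.comp_id (S.compStr p hq)).symm
      · change S.pi.app (Arrow.mk (f ≫ g)) ≫ (S.K.map (sqSnd f g) ≫ q) ≫ 𝟙 Y =
          S.K.map u ≫ S.K.map (sqSnd f g) ≫ q
        rw [Category.comp_id, ← Category.assoc, ← hπ', Category.assoc, qa, ← Category.assoc,
          ← Category.assoc, ← S.K.map_comp, ← S.K.map_comp, hsq]
    change S.pi.app (Arrow.mk (f ≫ g)) ≫ S.sigma.app (Arrow.mk (f ≫ g)) ≫
      S.K.map (S.compSquare f hq) ≫ p = S.K.map u ≫ S.sigma.app (Arrow.mk (f ≫ g)) ≫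
      S.K.map (S.compSquare f hq) ≫ p
    have e₁ : S.pi.app (Arrow.mk (f ≫ g)) ≫ S.sigma.app (Arrow.mk (f ≫ g)) ≫
        S.K.map (S.compSquare f hq) ≫ p = S.sigma.app (S.R.obj (Arrow.mk (f ≫ g))) ≫
          S.K.map (δ ≫ S.R.map (S.compSquare f hq) ≫ vp) ≫ p := by
      rw [S.K.map_comp, S.K.map_comp, Category.assoc, Category.assoc, ← pa,
        ← Category.assoc (S.K.map (S.R.map _)), hπ]
      have := congrArg (· ≫ S.K.map (S.compSquare f hq) ≫ p) hd
      simp only [Category.assoc] at this ⊢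
      exact this
    have e₂ : S.K.map u ≫ S.sigma.app (Arrow.mk (f ≫ g)) ≫
        S.K.map (S.compSquare f hq) ≫ p = S.sigma.app (S.R.obj (Arrow.mk (f ≫ g))) ≫
          S.K.map (S.L.map u ≫ S.compSquare f hq) ≫ p := by
      rw [S.K.map_comp]
      have := congrArg (· ≫ S.K.map (S.compSquare f hq) ≫ p) hσ
      simp only [Category.assoc] at this ⊢
      exact this
    rw [e₁, e₂, key]

/-- The composite in `R-Alg`. -/
def compAlg {p : S.K.obj (Arrow.mk f) ⟶ X} {q : S.K.obj (Arrow.mk g) ⟶ Y}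
    (hp : S.IsAlg (Arrow.mk f) p) (hq : S.IsAlg (Arrow.mk g) q) : S.Algebra where
  arrow := Arrow.mk (f ≫ g)
  str := S.compStr p hq
  isAlg := isAlg_compStr hp hq

end comp

end AWFS

/-! ### Internal categories -/

section pullback

variable {A : Type u₁} [Category.{w} A] [TwoCat A] {B : Type u₂} [Category.{w} B] [TwoCat B]
  {C : Type u₃} [Category.{w} C] [TwoCat C] {D : Type u₄} [Category.{w} D] [TwoCat D]

/-- The objects of the (strict) pullback of 2-categories `A ×_C B`. -/
structure Pb (F : TwoFunctor A C) (G : TwoFunctor B C) where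
  fst : A
  snd : B
  eq : F.obj fst = G.obj snd

namespace Pb

variable (F : TwoFunctor A C) (G : TwoFunctor B C)

/-- The morphisms of `A ×_C B`. -/
@[ext]
structure Hom (x y : Pb F G) where
  fst : x.fst ⟶ y.fst
  snd : x.snd ⟶ y.snd
  w : F.map fst ≫ eqToHom y.eq = eqToHom x.eq ≫ G.map snd

/-- The 2-cells of `A ×_C B`. -/
@[ext]
structure PbCell (x y : Pb F G) where
  fst : Cell x.fst y.fst
  snd : Cell x.snd y.snd
  w : hcomp (F.mapCell fst) (one (eqToHom y.eq)) = hcomp (one (eqToHom x.eq)) (G.mapCell snd)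

instance : Category.{w} (Pb F G) where
  Hom x y := Hom F G x y
  id x := ⟨𝟙 _, 𝟙 _, by simp⟩
  comp f g := ⟨f.fst ≫ g.fst, f.snd ≫ g.snd, by
    rw [F.map_comp, Category.assoc, g.w, ← Category.assoc, f.w, Category.assoc, G.map_comp]⟩
  id_comp f := Hom.ext (Category.id_comp _) (Category.id_comp _)
  comp_id f := Hom.ext (Category.comp_id _) (Category.comp_id _)
  assoc f g h := Hom.ext (Category.assoc _ _ _) (Category.assoc _ _ _)

variable {F G} in
theorem hom_ext {x y : Pb F G} {f g : x ⟶ y} (h : Hom.fst f = Hom.fst g)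
    (h' : Hom.snd f = Hom.snd g) : f = g := Hom.ext h h'

instance : TwoCat (Pb F G) where
  Cell x y := PbCell F G x y
  src {x y} α := ⟨src α.fst, src α.snd, by simpa using congrArg src α.w⟩
  tgt {x y} α := ⟨tgt α.fst, tgt α.snd, by simpa using congrArg tgt α.w⟩
  one {x y} f := ⟨one (Hom.fst f), one (Hom.snd f), by
    rw [F.mapCell_one, G.mapCell_one, ← one_comp, ← one_comp, Hom.w]⟩
  vcomp {x y} α β h :=
    have h₁ : tgt α.fst = src β.fst := congrArg Hom.fst h
    have h₂ : tgt α.snd = src β.snd := congrArg Hom.snd h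
    ⟨vcomp α.fst β.fst h₁, vcomp α.snd β.snd h₂, by
      rw [F.mapCell_vcomp, G.mapCell_vcomp, vcomp_hcomp_one, one_hcomp_vcomp]
      exact vcomp_congr α.w β.w _ _⟩
  hcomp {x y z} α β := ⟨hcomp α.fst β.fst, hcomp α.snd β.snd, by
    rw [F.mapCell_hcomp, G.mapCell_hcomp, hcomp_assoc, β.w, ← hcomp_assoc, α.w, hcomp_assoc]⟩
  src_one f := Hom.ext (TwoCat.src_one _) (TwoCat.src_one _)
  tgt_one f := Hom.ext (TwoCat.tgt_one _) (TwoCat.tgt_one _)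
  src_vcomp α β h := Hom.ext (TwoCat.src_vcomp _ _ _) (TwoCat.src_vcomp _ _ _)
  tgt_vcomp α β h := Hom.ext (TwoCat.tgt_vcomp _ _ _) (TwoCat.tgt_vcomp _ _ _)
  src_hcomp α β := Hom.ext (TwoCat.src_hcomp _ _) (TwoCat.src_hcomp _ _)
  tgt_hcomp α β := Hom.ext (TwoCat.tgt_hcomp _ _) (TwoCat.tgt_hcomp _ _)
  one_vcomp α := PbCell.ext (TwoCat.one_vcomp _) (TwoCat.one_vcomp _)
  vcomp_one α := PbCell.ext (TwoCat.vcomp_one _) (TwoCat.vcomp_one _)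
  vcomp_assoc α β γ h h' := PbCell.ext (TwoCat.vcomp_assoc _ _ _ _ _)
    (TwoCat.vcomp_assoc _ _ _ _ _)
  one_hcomp α := PbCell.ext (TwoCat.one_hcomp _) (TwoCat.one_hcomp _)
  hcomp_one α := PbCell.ext (TwoCat.hcomp_one _) (TwoCat.hcomp_one _)
  hcomp_assoc α β γ := PbCell.ext (TwoCat.hcomp_assoc _ _ _) (TwoCat.hcomp_assoc _ _ _)
  one_comp s t := PbCell.ext (TwoCat.one_comp _ _) (TwoCat.one_comp _ _)
  interchange α β γ δ h h' := PbCell.ext (TwoCat.interchange _ _ _ _ _ _)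
    (TwoCat.interchange _ _ _ _ _ _)

/-- The first projection. -/
abbrev π₁ : TwoFunctor (Pb F G) A where
  obj x := x.fst
  map f := Hom.fst f
  map_id _ := rfl
  map_comp _ _ := rfl
  mapCell α := PbCell.fst α
  src_mapCell _ := rfl
  tgt_mapCell _ := rfl
  mapCell_one _ := rfl
  mapCell_vcomp _ _ _ := rfl
  mapCell_hcomp _ _ := rfl

/-- The second projection. -/
abbrev π₂ : TwoFunctor (Pb F G) B where
  obj x := x.snd
  map f := Hom.snd f
  map_id _ := rfl
  map_comp _ _ := rfl
  mapCell α := PbCell.snd α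
  src_mapCell _ := rfl
  tgt_mapCell _ := rfl
  mapCell_one _ := rfl
  mapCell_vcomp _ _ _ := rfl
  mapCell_hcomp _ _ := rfl

theorem condition : (π₁ F G).comp F = (π₂ F G).comp G :=
  TwoFunctor.ext' (fun x => x.eq) (fun f => Hom.w f) (fun α => PbCell.w α)

variable {F G}

/-- The universal property of the pullback. -/
abbrev lift (X : TwoFunctor D A) (Y : TwoFunctor D B) (h : X.comp F = Y.comp G) :
    TwoFunctor D (Pb F G) where
  obj d := ⟨X.obj d, Y.obj d, congrArg (fun E : TwoFunctor D C => E.obj d) h⟩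
  map f := ⟨X.map f, Y.map f, TwoFunctor.hom_congr h f⟩
  map_id _ := Hom.ext (X.map_id _) (Y.map_id _)
  map_comp _ _ := Hom.ext (X.map_comp _ _) (Y.map_comp _ _)
  mapCell α := ⟨X.mapCell α, Y.mapCell α, TwoFunctor.cell_congr h α⟩
  src_mapCell _ := Hom.ext (X.src_mapCell _) (Y.src_mapCell _)
  tgt_mapCell _ := Hom.ext (X.tgt_mapCell _) (Y.tgt_mapCell _)
  mapCell_one _ := PbCell.ext (X.mapCell_one _) (Y.mapCell_one _)
  mapCell_vcomp _ _ _ := PbCell.ext (X.mapCell_vcomp _ _ _) (Y.mapCell_vcomp _ _ _)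
  mapCell_hcomp _ _ := PbCell.ext (X.mapCell_hcomp _ _) (Y.mapCell_hcomp _ _)

end Pb

end pullback

/-- An internal category `J₁ ⇉ J₀` in the category of 2-categories and 2-functors. -/
structure InternalCat (J₀ : Type u₁) [Category.{w} J₀] [TwoCat J₀]
    (J₁ : Type u₂) [Category.{w} J₁] [TwoCat J₁] where
  dom : TwoFunctor J₁ J₀
  cod : TwoFunctor J₁ J₀
  ident : TwoFunctor J₀ J₁
  comp : TwoFunctor (Pb cod dom) J₁
  ident_dom : ident.comp dom = TwoFunctor.id J₀
  ident_cod : ident.comp cod = TwoFunctor.id J₀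
  comp_dom : comp.comp dom = (Pb.π₁ cod dom).comp dom
  comp_cod : comp.comp cod = (Pb.π₂ cod dom).comp cod
  ident_comp : (Pb.lift (dom.comp ident) (TwoFunctor.id J₁)
    (congrArg (fun E => dom.comp E) ident_cod)).comp comp = TwoFunctor.id J₁
  comp_ident : (Pb.lift (TwoFunctor.id J₁) (cod.comp ident)
    (congrArg (fun E => cod.comp E) ident_dom).symm).comp comp = TwoFunctor.id J₁
  assoc : (Pb.lift ((Pb.π₁ ((Pb.π₂ cod dom).comp cod) dom).comp comp)
      (Pb.π₂ ((Pb.π₂ cod dom).comp cod) dom)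
      ((congrArg (fun E => (Pb.π₁ ((Pb.π₂ cod dom).comp cod) dom).comp E) comp_cod).trans
        (Pb.condition ((Pb.π₂ cod dom).comp cod) dom))).comp comp =
    (Pb.lift ((Pb.π₁ ((Pb.π₂ cod dom).comp cod) dom).comp (Pb.π₁ cod dom))
      ((Pb.lift ((Pb.π₁ ((Pb.π₂ cod dom).comp cod) dom).comp (Pb.π₂ cod dom))
        (Pb.π₂ ((Pb.π₂ cod dom).comp cod) dom)
        (Pb.condition ((Pb.π₂ cod dom).comp cod) dom)).comp comp)
      ((congrArg (fun E => (Pb.π₁ ((Pb.π₂ cod dom).comp cod) dom).comp E)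
          (Pb.condition cod dom)).trans
        (congrArg (fun E => (Pb.lift ((Pb.π₁ ((Pb.π₂ cod dom).comp cod) dom).comp (Pb.π₂ cod dom))
          (Pb.π₂ ((Pb.π₂ cod dom).comp cod) dom)
          (Pb.condition ((Pb.π₂ cod dom).comp cod) dom)).comp E) comp_dom).symm)).comp comp

/-- The composition `C^𝟐 ×_C C^𝟐 ⟶ C^𝟐` of the internal category of squares `Sq(C)`. -/
def compSq (C : Type u₁) [Category.{w} C] [TwoCat C] :
    TwoFunctor (Pb (codF C) (domF C)) (Arrow C) where
  obj x := Arrow.mk (x.fst.hom ≫ eqToHom x.eq ≫ x.snd.hom)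
  map {x y} s := Arrow.homMk (Pb.Hom.fst s).left (Pb.Hom.snd s).right (by
    have h := Pb.Hom.w s
    have h₁ := Arrow.w (Pb.Hom.fst s)
    have h₂ := Arrow.w (Pb.Hom.snd s)
    dsimp at h h₁ h₂ ⊢
    rw [← Category.assoc, h₁, Category.assoc, ← Category.assoc (Pb.Hom.fst s).right, h]
    simp only [Category.assoc]
    rw [h₂])
  map_id _ := rfl
  map_comp _ _ := rfl
  mapCell {x y} α := ArrowCell.mk (ArrowCell.left (f := x.fst) (g := y.fst) (Pb.PbCell.fst α))
    (ArrowCell.right (f := x.snd) (g := y.snd) (Pb.PbCell.snd α)) (by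
      have h := Pb.PbCell.w α
      have h₁ := ArrowCell.w (f := x.fst) (g := y.fst) (Pb.PbCell.fst α)
      have h₂ := ArrowCell.w (f := x.snd) (g := y.snd) (Pb.PbCell.snd α)
      dsimp at h h₁ h₂ ⊢
      rw [one_comp, one_comp, one_comp, one_comp, ← hcomp_assoc, h₁, hcomp_assoc, ← hcomp_assoc _ (one (eqToHom _)), h]
      simp only [hcomp_assoc]
      rw [h₂])
  src_mapCell _ := rfl
  tgt_mapCell _ := rfl
  mapCell_one _ := rfl
  mapCell_vcomp _ _ _ := rfl
  mapCell_hcomp _ _ := rfl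

/-- An internal functor from `J` to the internal category of squares `Sq(C) = (C^𝟐 ⇉ C)`. -/
structure InternalCat.ToSq {J₀ : Type u₁} [Category.{w} J₀] [TwoCat J₀]
    {J₁ : Type u₂} [Category.{w} J₁] [TwoCat J₁] (J : InternalCat J₀ J₁)
    (C : Type u₃) [Category.{w} C] [TwoCat C] where
  U₀ : TwoFunctor J₀ C
  U₁ : TwoFunctor J₁ (Arrow C)
  dom_eq : U₁.comp (domF C) = J.dom.comp U₀
  cod_eq : U₁.comp (codF C) = J.cod.comp U₀
  ident_eq : J.ident.comp U₁ = U₀.comp (idF C)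
  comp_eq : J.comp.comp U₁ =
    (Pb.lift (F := codF C) (G := domF C) ((Pb.π₁ J.cod J.dom).comp U₁) ((Pb.π₂ J.cod J.dom).comp U₁)
      ((congrArg (fun E => (Pb.π₁ J.cod J.dom).comp E) cod_eq).trans
        ((congrArg (fun E : TwoFunctor (Pb J.cod J.dom) J₀ => E.comp U₀)
          (Pb.condition J.cod J.dom)).trans
        (congrArg (fun E => (Pb.π₂ J.cod J.dom).comp E) dom_eq).symm))).comp (compSq C)

/-! ### Lifting structures -/

section lifting

variable (P : ObjectProperty Cat.{w, w}) [IsBase P] {C : Type u} [Category.{w} C] [TwoCat C]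
  [HomsIn P C]

/-- The 2-functor that sends `g` to the morphism `C^𝟐(a, 1_{dom g}) ⟶ C^𝟐(a, g)` of `𝒱` given by
composition with the square `(1, g)`. -/
abbrev W (a : Arrow C) : TwoFunctor (Arrow C) (Arrow (VObj P)) :=
  (unitSq C).toArrow.comp (homFrom P a).mapArrow

variable {J : Type w} [Category.{w} J] [TwoCat J] (U : TwoFunctor J (Arrow C))

/-- The presheaf `C^𝟐(U-, b) : Jᵒᵖ ⟶ 𝒱`. -/
abbrev presheaf (b : Arrow C) : TwoFunctor Jᵒᵖ (VObj P) := U.op.comp (homTo P b)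

/-- The morphism `C^𝟐(U-, 1_{dom g}) ⟶ C^𝟐(U-, g)` of presheaves; its component at `j` is
`(W P (U.obj j)).obj g`. -/
abbrev wNat (g : Arrow C) :
    TwoNat (presheaf P U (Arrow.mk (𝟙 g.left))) (presheaf P U g) :=
  (homToMap P ((unitSq C).app g)).whiskerLeft U.op

variable {P}

/-- An object of `J^⋔`: a morphism `g` of `C` with an `M`-algebra structure, in the presheaf category
`[Jᵒᵖ, 𝒱]` where the monad `M` acts pointwise, on `C^𝟐(U-, 1_{dom g}) ⟶ C^𝟐(U-, g)`. -/
structure LiftAlg (EM : AWFS (VObj P)) where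
  arrow : Arrow C
  str : TwoNat ((wNat P U arrow).toArrow.comp EM.K) (presheaf P U (Arrow.mk (𝟙 arrow.left)))
  isAlg (j : J) : EM.IsAlg ((W P (U.obj j)).obj arrow) (str.app (op j))

/-- The `𝒱`-category `J^⋔` over `C^𝟐`. -/
def lift (EM : AWFS (VObj P)) : ConcreteTwoCat (Arrow C) where
  Obj := LiftAlg U EM
  ob a := a.arrow
  IsHom {a b} s := ∀ j, EM.IsAlgHom (a.str.app (op j)) (b.str.app (op j)) ((W P (U.obj j)).map s)
  IsCell {a b} α :=
    ∀ j, EM.IsAlgCell (a.str.app (op j)) (b.str.app (op j)) ((W P (U.obj j)).mapCell α)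
  id_hom a j := by
    rw [(W P (U.obj j)).map_id]
    exact AWFS.isAlgHom_id _
  comp_hom h h' j := by
    rw [(W P (U.obj j)).map_comp]
    exact (h j).comp (h' j)
  src_cell h j := by
    rw [← (W P (U.obj j)).src_mapCell]
    exact (h j).src
  tgt_cell h j := by
    rw [← (W P (U.obj j)).tgt_mapCell]
    exact (h j).tgt
  one_cell h j := by
    rw [(W P (U.obj j)).mapCell_one]
    exact (h j).one
  vcomp_cell e h h' j := by
    rw [(W P (U.obj j)).mapCell_vcomp]
    exact (h j).vcomp _ (h' j)
  hcomp_cell h h' j := by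
    rw [(W P (U.obj j)).mapCell_hcomp]
    exact (h j).hcomp (h' j)

end lifting

section composites

variable {P : ObjectProperty Cat.{w, w}} [IsBase P] {C : Type u} [Category.{w} C] [TwoCat C]
  [HomsIn P C] {J₀ : Type w} [Category.{w} J₀] [TwoCat J₀] {J₁ : Type w} [Category.{w} J₁]
  [TwoCat J₁] {J : InternalCat J₀ J₁} (U : J.ToSq C) (x : Pb J.cod J.dom)

namespace InternalCat.ToSq

/-- For a composable pair `(i, j)` of `J`, the codomain of `U i` is the domain of `U j`. -/
theorem mid : (U.U₁.obj x.fst).right = (U.U₁.obj x.snd).left := by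
  have h₁ := congrArg (fun E : TwoFunctor J₁ C => E.obj x.fst) U.cod_eq
  have h₂ := congrArg (fun E : TwoFunctor J₁ C => E.obj x.snd) U.dom_eq
  have h₃ := congrArg U.U₀.obj x.eq
  exact h₁.trans (h₃.trans h₂.symm)

/-- The morphism `U i`, with codomain `dom (U j)`. -/
def fstHom : (U.U₁.obj x.fst).left ⟶ (U.U₁.obj x.snd).left :=
  (U.U₁.obj x.fst).hom ≫ eqToHom (U.mid x)

/-- For a composable pair `(i, j)` of `J`, the functor `U` sends `j • i` to `U j · U i`. -/
theorem comp_obj : U.U₁.obj (J.comp.obj x) = Arrow.mk (U.fstHom x ≫ (U.U₁.obj x.snd).hom) := by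
  have h := congrArg (fun E : TwoFunctor (Pb J.cod J.dom) (Arrow C) => E.obj x) U.comp_eq
  refine h.trans (congrArg Arrow.mk ?_)
  exact (Category.assoc _ _ _).symm

/-- The square `(U i, 1) : U (j • i) ⟶ U j`. -/
def down : U.U₁.obj (J.comp.obj x) ⟶ U.U₁.obj x.snd :=
  eqToHom (U.comp_obj x) ≫ AWFS.sqSnd (U.fstHom x) (U.U₁.obj x.snd).hom

/-- The square `(1, U j) : U i ⟶ U (j • i)`. -/
def up : U.U₁.obj x.fst ⟶ U.U₁.obj (J.comp.obj x) :=
  Arrow.homMk (f := U.U₁.obj x.fst) (g := Arrow.mk (U.fstHom x)) (𝟙 _) (eqToHom (U.mid x))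
      (Category.id_comp _) ≫
    AWFS.sqFst (U.fstHom x) (U.U₁.obj x.snd).hom ≫ eqToHom (U.comp_obj x).symm

/-- The square `(U i, 1) : U i ⟶ 1_{dom (U j)}`. -/
def toId : U.U₁.obj x.fst ⟶ Arrow.mk (𝟙 (U.U₁.obj x.snd).left) :=
  Arrow.homMk (U.fstHom x) (eqToHom (U.mid x)) (Category.comp_id _)

theorem up_down : U.up x ≫ U.down x =
    U.toId x ≫ (unitSq C).app (U.U₁.obj x.snd) := by
  have h : U.up x ≫ U.down x = Arrow.homMk (f := U.U₁.obj x.fst)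
      (g := Arrow.mk (U.fstHom x)) (𝟙 _) (eqToHom (U.mid x)) (Category.id_comp _) ≫
      AWFS.sqFst (U.fstHom x) (U.U₁.obj x.snd).hom ≫
        AWFS.sqSnd (U.fstHom x) (U.U₁.obj x.snd).hom := by
    have key : ∀ {a b c d e : Arrow C} (h : a = b) (l : e ⟶ d) (m : d ⟶ b) (n : b ⟶ c),
        (l ≫ m ≫ eqToHom h.symm) ≫ eqToHom h ≫ n = l ≫ m ≫ n := by
      rintro a _ c d e rfl l m n
      simp
    exact key (U.comp_obj x) _ _ _
  rw [h]
  apply Arrow.hom_ext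
  · change 𝟙 _ ≫ 𝟙 _ ≫ U.fstHom x = U.fstHom x ≫ 𝟙 _
    simp
  · change eqToHom (U.mid x) ≫ (U.U₁.obj x.snd).hom ≫ 𝟙 _ = eqToHom (U.mid x) ≫ (U.U₁.obj x.snd).hom
    simp

variable (P) (g : Arrow C)

/-- The morphism `(h, k) ↦ (h · U i, k) : C^𝟐(U j, g) ⟶ C^𝟐(U (j • i), g)` of `𝒱`. -/
abbrev restr : homObj P (U.U₁.obj x.snd) g ⟶ homObj P (U.U₁.obj (J.comp.obj x)) g :=
  (homTo P g).map (U.down x).op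

/-- The morphism `(h, k) ↦ (h · U i, h) : C^𝟐(U j, g) ⟶ C^𝟐(U i, 1_{dom g})` of `𝒱`. -/
abbrev corner : homObj P (U.U₁.obj x.snd) g ⟶ homObj P (U.U₁.obj x.fst) (Arrow.mk (𝟙 g.left)) :=
  homAct P ((domF C).comp (idF C)) (U.U₁.obj x.snd) g ≫
    (homTo P (Arrow.mk (𝟙 g.left))).map (U.toId x).op

/-- The square of `𝒱` with the left side `restr` and the right side
`C^𝟐(U i, 1_{dom g}) ⟶ C^𝟐(U i, g)`, the top side `corner`, and the bottom side
`(h, k) ↦ (h, k · U j)`.  It is a pullback. -/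
def pbSquare : Arrow.mk (U.restr P x g) ⟶ (W P (U.U₁.obj x.fst)).obj g :=
  Arrow.homMk (f := Arrow.mk (U.restr P x g)) (g := (W P (U.U₁.obj x.fst)).obj g)
    (U.corner P x g) ((homTo P g).map (U.up x).op) (by
      refine HomCat.functor_ext (fun f => ?_) (fun {f f'} α => ?_)
      · have h := (unitSq C).naturality (X := U.U₁.obj x.snd) (Y := g) f
        change (U.toId x ≫ ((domF C).comp (idF C)).map f) ≫ (unitSq C).app g =
          U.up x ≫ U.down x ≫ (TwoFunctor.id (Arrow C)).map f
        rw [← Category.assoc (U.up x), U.up_down, Category.assoc, h, Category.assoc]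
      · have h := (unitSq C).naturality_cell (X := U.U₁.obj x.snd) (Y := g) α.1
        change hcomp (hcomp (one (U.toId x)) (((domF C).comp (idF C)).mapCell α.1))
            (one ((unitSq C).app g)) =
          hcomp (one (U.up x)) (hcomp (one (U.down x)) ((TwoFunctor.id (Arrow C)).mapCell α.1))
        rw [← hcomp_assoc (one (U.up x)), ← one_comp, U.up_down, hcomp_assoc, h, one_comp,
          hcomp_assoc])

/-- The square of `𝒱` from the composite of `C^𝟐(U j, 1_{dom g}) ⟶ C^𝟐(U j, g)` and `restr` to
`C^𝟐(U (j • i), 1_{dom g}) ⟶ C^𝟐(U (j • i), g)`, given by the isomorphism between their domains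
and the identity of their codomain. -/
def compIso : Arrow.mk (((W P (U.U₁.obj x.snd)).obj g).hom ≫ U.restr P x g) ⟶
    (W P (U.U₁.obj (J.comp.obj x))).obj g :=
  Arrow.homMk (f := Arrow.mk (((W P (U.U₁.obj x.snd)).obj g).hom ≫ U.restr P x g))
    (g := (W P (U.U₁.obj (J.comp.obj x))).obj g)
    ((homTo P (Arrow.mk (𝟙 g.left))).map (U.down x).op) (𝟙 _) (by
      refine HomCat.functor_ext (fun f => ?_) (fun {f f'} α => ?_)
      · exact Category.assoc (obj := Arrow C) (U.down x) f ((unitSq C).app g)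
      · exact hcomp_assoc (C := Arrow C) (one (U.down x)) α.1 (one ((unitSq C).app g)))

end InternalCat.ToSq

/-- The condition on an object `(g, p)` of `J^⋔` at a composable pair `x = (i, j)`: the composite of
the algebra `C^𝟐(U j, 1_{dom g}) ⟶ C^𝟐(U j, g)`, given by `p`, and of the algebra
`C^𝟐(U j, g) ⟶ C^𝟐(U (j • i), g)`, given by pulling back the algebra
`C^𝟐(U i, 1_{dom g}) ⟶ C^𝟐(U i, g)`, is the algebra that `p` gives at `j • i`.  (The structure `s`
obtained by pulling back is the unique one for which the pullback square is a morphism of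
algebras.) -/
def RespectsComp {EM : AWFS (VObj P)} (a : LiftAlg U.U₁ EM) : Prop :=
  ∃ (s : EM.K.obj (Arrow.mk (U.restr P x a.arrow)) ⟶ homObj P (U.U₁.obj x.snd) a.arrow)
    (hs : EM.IsAlg (Arrow.mk (U.restr P x a.arrow)) s),
    EM.IsAlgHom s (a.str.app (op x.fst)) (U.pbSquare P x a.arrow) ∧
    EM.IsAlgHom (EM.compStr (f := ((W P (U.U₁.obj x.snd)).obj a.arrow).hom)
      (g := U.restr P x a.arrow) (a.str.app (op x.snd)) hs)
      (a.str.app (op (J.comp.obj x))) (U.compIso P x a.arrow)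

/-- The `𝒱`-category of arrows of the internal category `J^⫛` over `Sq(C)`, a full sub-`𝒱`-category
of `J₁^⋔`. -/
def dblLift (EM : AWFS (VObj P)) : ConcreteTwoCat (Arrow C) :=
  (lift U.U₁ EM).restrict fun a => ∀ x : Pb J.cod J.dom, RespectsComp U x a

end composites

section vertical

variable {P : ObjectProperty Cat.{w, w}} [IsBase P] {C : Type u} [Category.{w} C] [TwoCat C]
  [HomsIn P C]

/-- For `f : X ⟶ Y` and `g : Y ⟶ Z`, the square of `𝒱` with the left side
`C^𝟐(a, f) ⟶ C^𝟐(a, f ≫ g)` and the right side `C^𝟐(a, 1_Y) ⟶ C^𝟐(a, g)`, whose top and bottom sides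
are given by composition with the squares `(f, 1)`.  It is a pullback. -/
def vertSquare (P : ObjectProperty Cat.{w, w}) [IsBase P] [HomsIn P C] (a : Arrow C) {X Y Z : C}
    (f : X ⟶ Y) (g : Y ⟶ Z) :
    Arrow.mk ((homFrom P a).map (AWFS.sqFst f g)) ⟶ (W P a).obj (Arrow.mk g) :=
  Arrow.homMk (f := Arrow.mk ((homFrom P a).map (AWFS.sqFst f g))) (g := (W P a).obj (Arrow.mk g))
    ((homFrom P a).map (Arrow.homMk (f := Arrow.mk f) (g := Arrow.mk (𝟙 Y)) f (𝟙 Y) rfl))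
    ((homFrom P a).map (AWFS.sqSnd f g)) (by
      refine ((homFrom P a).map_comp _ _).symm.trans
        (Eq.trans (congrArg (homFrom P a).map ?_) ((homFrom P a).map_comp _ _))
      apply Arrow.hom_ext
      · exact (Category.comp_id f).trans (Category.id_comp f).symm
      · exact (Category.id_comp g).trans (Category.comp_id g).symm)

/-- For `f : X ⟶ Y` and `g : Y ⟶ Z`, the identity square of `𝒱` from the composite
`C^𝟐(a, 1_X) ⟶ C^𝟐(a, f) ⟶ C^𝟐(a, f ≫ g)` to `C^𝟐(a, 1_X) ⟶ C^𝟐(a, f ≫ g)`. -/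
def vertId (P : ObjectProperty Cat.{w, w}) [IsBase P] [HomsIn P C] (a : Arrow C) {X Y Z : C}
    (f : X ⟶ Y) (g : Y ⟶ Z) :
    Arrow.mk (((W P a).obj (Arrow.mk f)).hom ≫ (homFrom P a).map (AWFS.sqFst f g)) ⟶
      (W P a).obj (Arrow.mk (f ≫ g)) :=
  Arrow.homMk
    (f := Arrow.mk (((W P a).obj (Arrow.mk f)).hom ≫ (homFrom P a).map (AWFS.sqFst f g)))
    (g := (W P a).obj (Arrow.mk (f ≫ g))) (𝟙 _) (𝟙 _) (by
      refine (Category.id_comp _).trans (Eq.trans (Eq.trans ?_ ((homFrom P a).map_comp _ _))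
        (Category.comp_id _).symm)
      refine congrArg (homFrom P a).map ?_
      apply Arrow.hom_ext
      · exact (Category.comp_id (𝟙 X)).symm
      · rfl)

/-- The object `c` of `J^⋔` is the vertical composite of the objects `a` and `b`: the underlying
morphism of `c` is the composite of the morphism `f` of `a` and the morphism `g` of `b`, and for each
`j` the algebra `C^𝟐(U j, 1_{dom f}) ⟶ C^𝟐(U j, f ≫ g)` given by `c` is the composite of the algebra
`C^𝟐(U j, 1_{dom f}) ⟶ C^𝟐(U j, f)` given by `a` and of the algebra
`C^𝟐(U j, f) ⟶ C^𝟐(U j, f ≫ g)` obtained by pulling back the algebra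
`C^𝟐(U j, 1_{dom g}) ⟶ C^𝟐(U j, g)` given by `b`. -/
def IsVertComp {J : Type w} [Category.{w} J] [TwoCat J] {U : TwoFunctor J (Arrow C)}
    {EM : AWFS (VObj P)} (a b c : LiftAlg U EM) : Prop :=
  ∃ (X Y Z : C) (f : X ⟶ Y) (g : Y ⟶ Z)
    (p : TwoNat ((wNat P U (Arrow.mk f)).toArrow.comp EM.K) (presheaf P U (Arrow.mk (𝟙 X))))
    (q : TwoNat ((wNat P U (Arrow.mk g)).toArrow.comp EM.K) (presheaf P U (Arrow.mk (𝟙 Y))))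
    (r : TwoNat ((wNat P U (Arrow.mk (f ≫ g))).toArrow.comp EM.K)
      (presheaf P U (Arrow.mk (𝟙 X))))
    (hp : ∀ j, EM.IsAlg ((W P (U.obj j)).obj (Arrow.mk f)) (p.app (op j)))
    (hq : ∀ j, EM.IsAlg ((W P (U.obj j)).obj (Arrow.mk g)) (q.app (op j)))
    (hr : ∀ j, EM.IsAlg ((W P (U.obj j)).obj (Arrow.mk (f ≫ g))) (r.app (op j))),
    a = ⟨Arrow.mk f, p, hp⟩ ∧ b = ⟨Arrow.mk g, q, hq⟩ ∧ c = ⟨Arrow.mk (f ≫ g), r, hr⟩ ∧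
    ∀ j, ∃ (s : EM.K.obj (Arrow.mk ((homFrom P (U.obj j)).map (AWFS.sqFst f g))) ⟶
        homObj P (U.obj j) (Arrow.mk f))
      (hs : EM.IsAlg (Arrow.mk ((homFrom P (U.obj j)).map (AWFS.sqFst f g))) s),
      EM.IsAlgHom s (q.app (op j)) (vertSquare P (U.obj j) f g) ∧
      EM.IsAlgHom (EM.compStr (f := ((W P (U.obj j)).obj (Arrow.mk f)).hom)
        (g := (homFrom P (U.obj j)).map (AWFS.sqFst f g)) (p.app (op j)) hs)
        (r.app (op j)) (vertId P (U.obj j) f g)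

/-- The AWFS `LR` is cofibrantly generated by `U : J ⟶ Sq(C)` with respect to the AWFS `EM` of `𝒱`:
the internal categories `R-Alg` and `J^⫛` are isomorphic over `Sq(C)`.  Since both have `C` as
object of objects, such an isomorphism is an isomorphism between their objects of arrows, over
`C^𝟐`, that preserves the composition.  As the 2-functors to `C^𝟐` are injective on the morphisms and
the 2-cells between fixed objects, the composition needs to be preserved only at the level of
objects; and the identities are preserved because an identity morphism carries only one structure
on either side. -/
def AWFS.IsGeneratedBy (LR : AWFS C) (EM : AWFS (VObj P)) {J₀ : Type w} [Category.{w} J₀]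
    [TwoCat J₀] {J₁ : Type w} [Category.{w} J₁] [TwoCat J₁] {J : InternalCat J₀ J₁}
    (U : J.ToSq C) : Prop :=
  ∃ (F : TwoFunctor LR.alg.Obj (dblLift U EM).Obj) (G : TwoFunctor (dblLift U EM).Obj LR.alg.Obj),
    F.comp G = TwoFunctor.id _ ∧ G.comp F = TwoFunctor.id _ ∧
    F.comp (dblLift U EM).forget = LR.alg.forget ∧
    ∀ {X Y Z : C} {f : X ⟶ Y} {g : Y ⟶ Z} {p : LR.K.obj (Arrow.mk f) ⟶ X}
      {q : LR.K.obj (Arrow.mk g) ⟶ Y} (hp : LR.IsAlg (Arrow.mk f) p)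
      (hq : LR.IsAlg (Arrow.mk g) q),
      IsVertComp (F.obj ⟨Arrow.mk f, p, hp⟩).1 (F.obj ⟨Arrow.mk g, q, hq⟩).1
        (F.obj (AWFS.compAlg hp hq)).1

/-- The AWFS `LR` is cofibrantly generated, with respect to the AWFS `EM` of `𝒱`: it is generated by
a small internal category in `𝒱`-categories. -/
def AWFS.IsCofibrantlyGenerated (LR : AWFS C) (EM : AWFS (VObj P)) : Prop :=
  ∃ (J₀ : Type w) (_ : Category.{w} J₀) (_ : TwoCat J₀) (_ : HomsIn P J₀)
    (J₁ : Type w) (_ : Category.{w} J₁) (_ : TwoCat J₁) (_ : HomsIn P J₁)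
    (J : InternalCat J₀ J₁) (U : J.ToSq C), LR.IsGeneratedBy EM U

end vertical

/-! ### Locally ranked categories -/

section ranked

variable {C : Type u} [Category.{w} C]

/-- Orthogonal factorisation systems: weak factorisation systems with unique diagonal fillers. -/
structure IsOFS (E M : MorphismProperty C) : Prop where
  wfs : E.IsWeakFactorizationSystem M
  unique {A B X Y : C} {e : A ⟶ B} {m : X ⟶ Y} (he : E e) (hm : M m) {s : A ⟶ X} {t : B ⟶ Y}
    (sq : CommSq s e m t) : Subsingleton sq.LiftStruct

/-- The object `A` has rank at most `κ` with respect to the class `M`: the functor `C(A, -)` preserves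
the colimit of each small `κ`-filtered diagram that admits a cocone with components in `M`. -/
def HasRankLE (M : MorphismProperty C) (κ : Cardinal.{w}) [Fact κ.IsRegular] (A : C) : Prop :=
  ∀ (I : Type w) [SmallCategory I] [IsCardinalFiltered I κ] (D : I ⥤ C) (s : Cocone D),
    (∀ i, M (s.ι.app i)) → PreservesColimit D (coyoneda.obj (op A))

/-- The category `C` is locally ranked with respect to `(E, M)`: it is cocomplete, `(E, M)` is a
proper orthogonal factorisation system on `C`, each object has, up to isomorphism, only a small
family of morphisms in `E` out of it, and each object has a rank. -/
structure IsLocallyRanked (E M : MorphismProperty C) : Prop where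
  hasColimits : HasColimitsOfSize.{w, w} C
  ofs : IsOFS E M
  epi {X Y : C} (e : X ⟶ Y) : E e → Epi e
  mono {X Y : C} (m : X ⟶ Y) : M m → Mono m
  cowellpowered (X : C) : ∃ (T : Type w) (Q : T → C) (q : ∀ t, X ⟶ Q t),
    ∀ (Y : C) (e : X ⟶ Y), E e → ∃ (t : T) (i : Q t ≅ Y), q t ≫ i.hom = e
  rank (A : C) : ∃ (κ : Cardinal.{w}) (_ : Fact κ.IsRegular), HasRankLE M κ A

end ranked

/-- The forgetful 2-functor of `S` over `C^𝟐` creates (strictly, and in the enriched sense) the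
colimits of `κ`-filtered diagrams of `M`-subobjects: if a small `κ`-filtered diagram `D` in `S` is
such that its image in `C^𝟐` admits a cocone whose components belong to `M`, both on domains and on
codomains, then each colimit cocone of the image of `D` is the image of exactly one cocone of `D`,
which is a colimit cocone. -/
def CreatesFilteredColimitsOfSubobjects {C : Type u} [Category.{w} C] [TwoCat C]
    (S : ConcreteTwoCat (Arrow C)) (M : MorphismProperty C) (κ : Cardinal.{w})
    [Fact κ.IsRegular] : Prop :=
  ∀ (I : Type w) [SmallCategory I] [IsCardinalFiltered I κ] (D : I ⥤ S.Obj)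
    (s : Cocone (D ⋙ S.forget.toFunctor)),
    (∀ i, M (s.ι.app i).left ∧ M (s.ι.app i).right) →
    ∀ c : Cocone (D ⋙ S.forget.toFunctor), IsConicalColimit c →
      (∃! c' : Cocone D, S.forget.toFunctor.mapCocone c' = c) ∧
      ∀ c' : Cocone D, S.forget.toFunctor.mapCocone c' = c → IsConicalColimit c'

end TwoDim

open TwoDim

/-! Creation of colimits is invariant under isomorphism over `C^𝟐`
(`CreatesFilteredColimitsOfSubobjects.of_iso`), so it suffices to treat the lifting structures
`dblLift U EM`. There an object is a morphism `g` with `M`-algebra structures on the functors `C^𝟐(U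
j, 1_{dom g}) ⟶ C^𝟐(U j, g)`, natural in `j` and compatible with composition in `J`. Two facts are
needed: algebra structures in `𝒱` pass uniquely to colimits, and `C^𝟐(U j, -)` preserves the
colimits in question.

For the first, an algebra structure on `f` is a map out of `K f`. Since `K` preserves conical
colimits, compatible structures along a diagram induce exactly one map out of `K` of the colimit,
and the algebra axioms are equations between maps out of `dom f`, `K f` and `K (R f)`, all of which
are colimits (`AWFS.exists_isAlg`, `AWFS.str_ext`). Cocontinuity speaks of weighted colimits indexed
by `𝒱`-categories. It applies to conical colimits because every small category is a locally discrete
`𝒱`-category, which in turn holds because discrete categories are equalizers of functors between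
powers of `𝟐` and so lie in `𝒱` (`IsBase.discrete`, `IsCocontinuous.preservesConical`).

For the second, 2-cells out of `A` are morphisms out of the tensor of `A` with `𝟐`. Since `J` is
small, some `κ` bounds the ranks of these tensors for all domains and codomains of the `U j`. The
2-cells from `U j` into a `κ`-filtered colimit of `M`-subobjects are then the filtered colimit of
the sets of 2-cells (`IsTensorTwo.cellsLift`, `CellsLift.arrow`). A cocone in `𝒱` that is a filtered
colimit on sets of arrows is a conical colimit in `𝒱` (`IsArrowUnion.isConical`), whatever other
colimits in `𝒱` look like.

Naturality in `j` is an equation between maps and 2-cells out of a colimit, hence is checked on the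
legs (`exists_colimit_str`). For the composition condition, the pulled-back structures on `restr`
form a compatible family because the projections of the pullback are jointly monic
(`isAlgHom_restr`), so they have a colimit too. As the composition of algebras is natural
(`AWFS.IsAlgHom.compStr`), the condition survives (`RespectsComp.of_colimit`). -/

namespace TwoDim
open TwoCat

/-! ### Conical colimits -/

section conical

variable {A : Type u₁} [Category.{w} A] [TwoCat A] {B : Type u₂} [Category.{w} B] [TwoCat B]
  {I : Type w} [SmallCategory I]

theorem IsConicalColimit.cell_ext {D : I ⥤ B} {c : Cocone D} (hc : IsConicalColimit c) {X : B}
    {θ θ' : Cell c.pt X}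
    (h : ∀ i, hcomp (one (c.ι.app i)) θ = hcomp (one (c.ι.app i)) θ') : θ = θ' := by
  refine (hc.cell X (fun i => hcomp (one (c.ι.app i)) θ') fun k => ?_).unique h fun _ => rfl
  rw [← hcomp_assoc, ← one_comp, c.w]

theorem IsConicalColimit.hom_ext {D : I ⥤ B} {c : Cocone D} (hc : IsConicalColimit c) {X : B}
    {f g : c.pt ⟶ X} (h : ∀ i, c.ι.app i ≫ f = c.ι.app i ≫ g) : f = g :=
  hc.isColimit.some.hom_ext h

/-- A cocone in the arrow 2-category is a conical colimit when it is one on domains and on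
codomains. -/
theorem IsConicalColimit.arrow {D : I ⥤ Arrow B} {c : Cocone D}
    (hl : IsConicalColimit ((domF B).toFunctor.mapCocone c))
    (hr : IsConicalColimit ((codF B).toFunctor.mapCocone c)) : IsConicalColimit c where
  isColimit := by
    obtain ⟨kl⟩ := hl.isColimit
    obtain ⟨kr⟩ := hr.isColimit
    refine ⟨{ desc := fun s => Arrow.homMk (kl.desc ((domF B).toFunctor.mapCocone s))
                (kr.desc ((codF B).toFunctor.mapCocone s)) ?_, fac := ?_, uniq := ?_ }⟩
    · refine kl.hom_ext fun i => ?_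
      have h₁ := kl.fac ((domF B).toFunctor.mapCocone s) i
      have h₂ := kr.fac ((codF B).toFunctor.mapCocone s) i
      have h₃ := Arrow.w (c.ι.app i)
      have h₄ := Arrow.w (s.ι.app i)
      dsimp at h₁ h₂ h₃ h₄ ⊢
      rw [← Category.assoc, h₁, h₄, ← Category.assoc, h₃, Category.assoc, h₂]
    · intro s i
      exact Arrow.hom_ext _ _ (kl.fac ((domF B).toFunctor.mapCocone s) i)
        (kr.fac ((codF B).toFunctor.mapCocone s) i)
    · intro s m hm
      exact Arrow.hom_ext _ _
        (kl.uniq ((domF B).toFunctor.mapCocone s) m.left fun i => congrArg Arrow.Hom.left (hm i))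
        (kr.uniq ((codF B).toFunctor.mapCocone s) m.right fun i => congrArg Arrow.Hom.right (hm i))
  cell X Γ hΓ := by
    obtain ⟨θ, hθ, -⟩ := hl.cell X.left (fun i => ArrowCell.left (Γ i))
      fun k => congrArg ArrowCell.left (hΓ k)
    obtain ⟨η, hη, -⟩ := hr.cell X.right (fun i => ArrowCell.right (Γ i))
      fun k => congrArg ArrowCell.right (hΓ k)
    refine ⟨ArrowCell.mk θ η (hl.cell_ext fun i => ?_), fun i => ArrowCell.ext (hθ i) (hη i),
      fun ζ hζ => ArrowCell.ext (hl.cell_ext fun i => ?_) (hr.cell_ext fun i => ?_)⟩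
    -- Compatibility of `θ` and `η` is an equation between 2-cells out of the domain colimit, so it
    -- is tested on its legs, where it is the compatibility of `Γ i`.
    · have h₁ := hθ i
      have h₂ := hη i
      have h₃ := ArrowCell.w (Γ i)
      have h₄ := Arrow.w (c.ι.app i)
      dsimp at h₁ h₂ h₃ h₄ ⊢
      rw [← hcomp_assoc, h₁, h₃, ← h₂, ← hcomp_assoc, ← hcomp_assoc, ← one_comp, ← one_comp, h₄]
    · exact (congrArg ArrowCell.left (hζ i)).trans (hθ i).symm
    · exact (congrArg ArrowCell.right (hζ i)).trans (hη i).symm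

variable (I) in
/-- A 2-functor preserves the conical colimits of shape `I`. -/
def PreservesConical (F : TwoFunctor A B) : Prop :=
  ∀ (D : I ⥤ A) (c : Cocone D), IsConicalColimit c → IsConicalColimit (F.toFunctor.mapCocone c)

end conical

/-! ### Colimits of algebras -/

namespace AWFS

variable {B : Type u₁} [Category.{w} B] [TwoCat B] {S : AWFS B} {I : Type w} [SmallCategory I]

/-- The composition of algebras is natural with respect to morphisms of algebras. -/
theorem IsAlgHom.compStr {X Y Z X' Y' Z' : B} {f : X ⟶ Y} {g : Y ⟶ Z} {f' : X' ⟶ Y'}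
    {g' : Y' ⟶ Z'} {p : S.K.obj (Arrow.mk f) ⟶ X} {q : S.K.obj (Arrow.mk g) ⟶ Y}
    {p' : S.K.obj (Arrow.mk f') ⟶ X'} {q' : S.K.obj (Arrow.mk g') ⟶ Y'}
    (hq : S.IsAlg (Arrow.mk g) q) (hq' : S.IsAlg (Arrow.mk g') q') {a : X ⟶ X'} {b : Y ⟶ Y'}
    {c : Z ⟶ Z'} (hab : a ≫ f' = f ≫ b) (hbc : b ≫ g' = g ≫ c) (hac : a ≫ f' ≫ g' = (f ≫ g) ≫ c)
    (h : S.IsAlgHom p p' (Arrow.homMk (f := Arrow.mk f) (g := Arrow.mk f') a b hab))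
    (h' : S.IsAlgHom q q' (Arrow.homMk (f := Arrow.mk g) (g := Arrow.mk g') b c hbc)) :
    S.IsAlgHom (S.compStr p hq) (S.compStr p' hq')
      (Arrow.homMk (f := Arrow.mk (f ≫ g)) (g := Arrow.mk (f' ≫ g')) a c hac) := by
  let s := Arrow.homMk (f := Arrow.mk (f ≫ g)) (g := Arrow.mk (f' ≫ g')) a c hac
  let t := Arrow.homMk (f := Arrow.mk f) (g := Arrow.mk f') a b hab
  let r := Arrow.homMk (f := Arrow.mk g) (g := Arrow.mk g') b c hbc
  have h₁ : S.K.map t ≫ p' = p ≫ a := h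
  have h₂ : S.K.map r ≫ q' = q ≫ b := h'
  have h₃ : S.K.map s ≫ S.sigma.app (Arrow.mk (f' ≫ g')) =
      S.sigma.app (Arrow.mk (f ≫ g)) ≫ S.K.map (S.L.map s) := S.sigma.naturality s
  have h₄ : s ≫ sqSnd f' g' = sqSnd f g ≫ r :=
    Arrow.hom_ext _ _ hab ((Category.comp_id c).trans (Category.id_comp c).symm)
  -- The structure of a composite is built from `sigma`, which is natural, and `compSquare`; so the
  -- point is that `compSquare` is natural too, and this uses only that `(b, c)` is a morphism of
  -- algebras.
  have h₅ : S.L.map s ≫ S.compSquare f' hq' = S.compSquare f hq ≫ t := by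
    apply Arrow.hom_ext
    · exact (Category.comp_id a).trans (Category.id_comp a).symm
    · change S.K.map s ≫ S.K.map (sqSnd f' g') ≫ q' = (S.K.map (sqSnd f g) ≫ q) ≫ b
      rw [← Category.assoc, ← S.K.map_comp, h₄, S.K.map_comp, Category.assoc, h₂, Category.assoc]
  change S.K.map s ≫ S.sigma.app _ ≫ S.K.map (S.compSquare f' hq') ≫ p' =
    (S.sigma.app _ ≫ S.K.map (S.compSquare f hq) ≫ p) ≫ a
  have h₆ := congrArg (· ≫ S.K.map (S.compSquare f' hq') ≫ p') h₃
  have h₇ := congrArg (fun k => S.K.map k ≫ p') h₅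
  simp only [S.K.map_comp, Category.assoc, h₁] at h₆ h₇ ⊢
  rw [h₆, h₇]

/-- When `K` preserves conical colimits, a pointwise colimit of algebras is an algebra. -/
theorem exists_isAlg (hK : PreservesConical I S.K) {D : I ⥤ Arrow B} {c : Cocone D}
    (hl : IsConicalColimit ((domF B).toFunctor.mapCocone c))
    (hr : IsConicalColimit ((codF B).toFunctor.mapCocone c))
    (p : ∀ i, S.K.obj (D.obj i) ⟶ (D.obj i).left) (hp : ∀ i, S.IsAlg (D.obj i) (p i))
    (hD : ∀ {i j : I} (k : i ⟶ j), S.IsAlgHom (p i) (p j) (D.map k)) :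
    ∃ q : S.K.obj c.pt ⟶ c.pt.left, S.IsAlg c.pt q ∧ ∀ i, S.IsAlgHom (p i) q (c.ι.app i) := by
  have kc := hK D c (.arrow hl hr)
  -- The associativity axiom compares maps out of `K (R f)`. The cocone `R c` is a colimit on
  -- domains, where it is `K c`, and on codomains, where it is that of `c`; so `K` can be applied
  -- once more.
  have kRc := hK (D ⋙ S.R.toFunctor) (S.R.toFunctor.mapCocone c) (.arrow kc hr)
  obtain ⟨kk⟩ := kc.isColimit
  let t : Cocone (D ⋙ S.K.toFunctor) :=
    { pt := c.pt.left
      ι :=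
        { app := fun i => p i ≫ (c.ι.app i).left
          naturality := fun i j k => by
            have h₁ : S.K.map (D.map k) ≫ p j = p i ≫ (D.map k).left := hD k
            have h₂ := congrArg Arrow.Hom.left (c.w k)
            change S.K.map (D.map k) ≫ p j ≫ (c.ι.app j).left = (p i ≫ (c.ι.app i).left) ≫ 𝟙 _
            rw [← Category.assoc, h₁, Category.comp_id, Category.assoc]
            exact congrArg (p i ≫ ·) h₂ } }
  let q : S.K.obj c.pt ⟶ c.pt.left := kk.desc t
  have hq : ∀ i, S.K.map (c.ι.app i) ≫ q = p i ≫ (c.ι.app i).left := fun i => kk.fac t i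
  have hw : q ≫ c.pt.hom = S.rho.app c.pt := by
    refine kc.hom_ext fun i => ?_
    change S.K.map (c.ι.app i) ≫ _ = S.K.map (c.ι.app i) ≫ _
    have h₁ : (c.ι.app i).left ≫ c.pt.hom = (D.obj i).hom ≫ (c.ι.app i).right :=
      Arrow.w (c.ι.app i)
    have h₂ := S.rho.naturality (c.ι.app i)
    have h₃ := (hp i).w
    dsimp at h₂
    rw [← Category.assoc, hq, Category.assoc, h₁, ← Category.assoc, h₃, ← h₂]
  refine ⟨q, ⟨hw, ?_, ?_⟩, hq⟩
  · refine hl.hom_ext fun i => ?_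
    change (c.ι.app i).left ≫ _ = (c.ι.app i).left ≫ _
    have h₁ : (c.ι.app i).left ≫ S.lam.app c.pt = S.lam.app (D.obj i) ≫ S.K.map (c.ι.app i) :=
      S.lam.naturality (c.ι.app i)
    have h₂ := (hp i).unit
    rw [← Category.assoc, h₁, Category.assoc, hq, ← Category.assoc, h₂, Category.id_comp]
    exact (Category.comp_id _).symm
  · refine kRc.hom_ext fun i => ?_
    change S.K.map (S.R.map (c.ι.app i)) ≫ _ = S.K.map (S.R.map (c.ι.app i)) ≫ _
    have h₁ : S.K.map (S.R.map (c.ι.app i)) ≫ S.pi.app c.pt =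
        S.pi.app (D.obj i) ≫ S.K.map (c.ι.app i) := S.pi.naturality (c.ι.app i)
    have h₂ := (hp i).assoc
    rw [← Category.assoc, h₁, Category.assoc, hq, ← Category.assoc, h₂, ← Category.assoc,
      ← S.K.map_comp]
    -- The action `(q, 1) : R f ⟶ f` restricts along each leg to the action at `i`.
    have h₃ : S.R.map (c.ι.app i) ≫ Arrow.homMk (f := S.R.obj c.pt) (g := c.pt) q (𝟙 c.pt.right)
          (hw.trans (Category.comp_id _).symm) =
        Arrow.homMk (f := S.R.obj (D.obj i)) (g := D.obj i) (p i) (𝟙 (D.obj i).right)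
          ((hp i).w.trans (Category.comp_id _).symm) ≫ c.ι.app i :=
      Arrow.hom_ext _ _ (hq i) ((Category.comp_id _).trans (Category.id_comp _).symm)
    rw [h₃, S.K.map_comp, Category.assoc, Category.assoc, hq]

end AWFS

/-! ### Discrete categories belong to the base -/

section discrete

variable (P : ObjectProperty Cat.{w, w}) [IsBase P]

/-- The power of a category. -/
def powCat (X : Type w) (Z : Cat.{w, w}) : Cat.{w, w} := Cat.of (X → Z)

theorem IsBase.pow (X : Type w) {Z : Cat.{w, w}} (hZ : P Z) : P (powCat X Z) := by
  have := IsBase.closedUnderLimits (P := P) (Discrete X)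
  refine ObjectProperty.IsClosedUnderLimitsOfShape.limitsOfShape_le P (Discrete X) _
    ⟨{ diag := Discrete.functor fun _ => Z
       π := Discrete.natTrans fun x => (Pi.eval (fun _ : X => (Z : Type w)) x.as).toCatHom
       isLimit :=
        { lift := fun s => (Functor.pi' fun x => (s.π.app ⟨x⟩).toFunctor).toCatHom
          fac := fun s ⟨x⟩ => rfl
          uniq := fun s m hm => ?_ }
       prop_diag_obj := fun _ => hZ }⟩
  refine Cat.Hom.ext (Functor.pi_ext _ _ fun x => ?_)
  exact congrArg Cat.Hom.toFunctor (hm ⟨x⟩)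

/-- Closure under limits with the universal property spelled out for bare functors, so that a
category described by hand can be recognised as an equalizer. -/
theorem IsBase.equalizer {A B : Cat.{w, w}} (hA : P A) (hB : P B) (F G : A ⥤ B) {T : Type w}
    [Category.{w} T] (e : T ⥤ A) (he : e ⋙ F = e ⋙ G)
    (h : ∀ (S : Cat.{w, w}) (H : S ⥤ A), H ⋙ F = H ⋙ G → ∃! H' : S ⥤ T, H' ⋙ e = H) :
    P (Cat.of T) := by
  have hw : Functor.toCatHom (C := T) e ≫ F.toCatHom = Functor.toCatHom (C := T) e ≫ G.toCatHom :=
    Cat.Hom.ext he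
  have hlim : IsLimit (Fork.ofι (P := Cat.of T) (Functor.toCatHom (C := T) e) hw) := by
    refine Fork.IsLimit.ofExistsUnique fun s => ?_
    obtain ⟨H', h₁, h₂⟩ := h s.pt s.ι.toFunctor (congrArg Cat.Hom.toFunctor s.condition)
    exact ⟨H'.toCatHom, Cat.Hom.ext h₁,
      fun m hm => Cat.Hom.ext (h₂ m.toFunctor (congrArg Cat.Hom.toFunctor hm))⟩
  refine IsBase.of_shape P WalkingParallelPair
    { diag := parallelPair F.toCatHom G.toCatHom
      π := _
      isLimit := hlim
      prop_diag_obj := ?_ }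
  rintro (_ | _)
  · exact hA
  · exact hB

namespace catTwo

/-- The truth value of an object of `𝟐`. -/
def IsTrue (s : catTwo.{w}) : Prop := ULift.down.{w} (α := Fin 2) s = 1

open Classical in
/-- The object of `𝟐` with a given truth value. -/
noncomputable def ofProp (p : Prop) : catTwo.{w} := ULift.up.{w} (α := Fin 2) (if p then 1 else 0)

theorem isTrue_ofProp (p : Prop) : IsTrue (ofProp.{w} p) ↔ p := by
  by_cases h : p <;> simp [IsTrue, ofProp, h]

theorem ext {s t : catTwo.{w}} (h : IsTrue s ↔ IsTrue t) : s = t := by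
  obtain ⟨s⟩ := s
  obtain ⟨t⟩ := t
  change s = 1 ↔ t = 1 at h
  congr 1
  revert s t
  decide

/-- The morphism given by an implication. -/
def hom {s t : catTwo.{w}} (h : IsTrue s → IsTrue t) : s ⟶ t := by
  refine homOfLE (X := ULift.{w} (Fin 2)) ?_
  obtain ⟨s⟩ := s
  obtain ⟨t⟩ := t
  change s = 1 → t = 1 at h
  change s ≤ t
  revert s t
  decide

theorem isTrue_of_hom {s t : catTwo.{w}} (f : s ⟶ t) (h : IsTrue s) : IsTrue t := by
  have hle : (show ULift.{w} (Fin 2) from s) ≤ t := leOfHom f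
  obtain ⟨s⟩ := s
  obtain ⟨t⟩ := t
  change s = 1 at h
  change t = 1
  change s ≤ t at hle
  clear f
  revert s t
  decide

theorem hom_eq {s t : catTwo.{w}} (f g : s ⟶ t) : f = g :=
  Subsingleton.elim (α := ((show ULift.{w} (Fin 2) from s) ⟶ (show ULift.{w} (Fin 2) from t))) f g

end catTwo

open catTwo

/-- Functors into a power of `𝟐` are determined by their action on objects. -/
theorem functor_pow_ext {S : Type w} [Category.{w} S] {X : Type w}
    {F G : S ⥤ powCat X catTwo.{w}} (h : ∀ s x, IsTrue (F.obj s x) ↔ IsTrue (G.obj s x)) :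
    F = G :=
  CategoryTheory.Functor.ext (fun s => funext fun x => catTwo.ext (h s x))
    (fun _ _ _ => funext fun _ => catTwo.hom_eq _ _)

/-- The functor between powers of `𝟐` given by monotone predicates. -/
noncomputable def powFunctor {X Y : Type w} (p : (X → catTwo.{w}) → Y → Prop)
    (hp : ∀ s t, (∀ x, IsTrue (s x) → IsTrue (t x)) → ∀ y, p s y → p t y) :
    powCat X catTwo.{w} ⥤ powCat Y catTwo.{w} where
  obj s := fun y => ofProp (p s y)
  map {s t} f := fun y => catTwo.hom fun h => (isTrue_ofProp _).2
    (hp s t (fun x => isTrue_of_hom (f x)) y ((isTrue_ofProp _).1 h))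
  map_id _ := funext fun _ => catTwo.hom_eq _ _
  map_comp _ _ := funext fun _ => catTwo.hom_eq _ _

/-- The set `X` sits in the poset `𝟐^X` as the singletons, and inclusions between singletons are
equalities, so the full subcategory of singletons is discrete. Being a singleton is the conjunction
of the truth of one monotone predicate and the falsity of others, so singletons are an equalizer of
two functors between powers of `𝟐`. -/
theorem IsBase.discrete (X : Type w) : P (Cat.of (Discrete X)) := by
  classical
  -- The coordinate `none` says that `s` is nonempty; the coordinate `(x, y)` says that `x` and `y`
  -- witness that `s` has two distinct elements.
  let p : (X → catTwo.{w}) → Option (X × X) → Prop := fun s z => match z with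
    | none => ∃ x, IsTrue (s x)
    | some (x, y) => x ≠ y ∧ IsTrue (s x) ∧ IsTrue (s y)
  let F := powFunctor p (by
    rintro s t h (_ | ⟨x, y⟩)
    · rintro ⟨x, hx⟩
      exact ⟨x, h x hx⟩
    · rintro ⟨h₁, h₂, h₃⟩
      exact ⟨h₁, h x h₂, h y h₃⟩)
  -- The constant functor that prescribes the wanted truth values: nonempty, and no pair of distinct
  -- elements.
  let G := powFunctor (X := X) (Y := Option (X × X)) (fun _ z => z = none) fun _ _ _ _ h => h
  have hFG {S : Type w} [Category.{w} S] (H : S ⥤ powCat X catTwo.{w}) :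
      H ⋙ F = H ⋙ G ↔ ∀ s, (∃ x, IsTrue (H.obj s x)) ∧
        ∀ x y, IsTrue (H.obj s x) → IsTrue (H.obj s y) → x = y := by
    constructor
    · intro h s
      have key : ∀ z, p (H.obj s) z ↔ z = none := fun z => by
        have := congrArg IsTrue (congrFun (Functor.congr_obj h s) z)
        have e : IsTrue (ofProp (p (H.obj s) z)) = IsTrue (ofProp (z = none)) := this
        rw [← isTrue_ofProp (p (H.obj s) z), e, isTrue_ofProp]
      refine ⟨(key none).2 rfl, fun x y hx hy => ?_⟩
      by_contra hxy
      exact Option.some_ne_none _ ((key (some (x, y))).1 ⟨hxy, hx, hy⟩)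
    · intro h
      refine functor_pow_ext fun s z => ?_
      change IsTrue (ofProp (p (H.obj s) z)) ↔ IsTrue (ofProp (z = none))
      rw [isTrue_ofProp, isTrue_ofProp]
      obtain _ | ⟨x, y⟩ := z
      · exact ⟨fun _ => rfl, fun _ => (h s).1⟩
      · exact ⟨fun h' => (h'.1 ((h s).2 x y h'.2.1 h'.2.2)).elim,
          fun h' => (Option.some_ne_none _ h').elim⟩
  let e : Discrete X ⥤ powCat X catTwo.{w} :=
    Discrete.functor (fun x => (fun y => ofProp (x = y) : X → catTwo.{w}))
  have he (x : Discrete X) (y : X) : IsTrue (e.obj x y) ↔ x.as = y := isTrue_ofProp _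
  refine IsBase.equalizer P (IsBase.pow P X (IsBase.two (P := P)))
    (IsBase.pow P (Option (X × X)) (IsBase.two (P := P))) F G e ?_ ?_
  · refine (hFG e).2 fun x => ⟨⟨x.as, (he x _).2 rfl⟩, fun y z hy hz => ?_⟩
    rw [← (he x y).1 hy, ← (he x z).1 hz]
  · intro S H hH
    have hH' := (hFG H).1 hH
    choose a ha using fun s => (hH' s).1
    -- The factorisation picks the only element `a s` of `H s`. A morphism `s ⟶ t` gives an
    -- inclusion of `H s` in `H t`, which forces `a s = a t`.
    refine ⟨{ obj := fun s => ⟨a s⟩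
              map := fun {s t} f => Discrete.eqToHom
                ((hH' t).2 _ _ (isTrue_of_hom ((H.map f) (a s)) (ha s)) (ha t))
              map_id := fun _ => Subsingleton.elim _ _
              map_comp := fun _ _ => Subsingleton.elim _ _ }, ?_, ?_⟩
    · refine functor_pow_ext fun s x => (he _ x).trans ?_
      exact ⟨fun h => h ▸ ha s, fun h => (hH' s).2 _ _ (ha s) h⟩
    · intro H' h
      refine CategoryTheory.Functor.ext (fun s => Discrete.ext ?_)
        (fun _ _ _ => Subsingleton.elim _ _)
      have h₁ : IsTrue ((H' ⋙ e).obj s (a s)) := by rw [h]; exact ha s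
      exact (he _ _).1 h₁

end discrete

/-! ### Conical colimits as weighted colimits -/

/-- A category, seen as a 2-category with only identity 2-cells. -/
def LocDisc (I : Type w) : Type w := I

namespace LocDisc

variable {I : Type w} [SmallCategory I]

instance : Category.{w} (LocDisc I) := inferInstanceAs (Category.{w} I)

instance : TwoCat (LocDisc I) where
  Cell X Y := X ⟶ Y
  src α := α
  tgt α := α
  one f := f
  vcomp α _ _ := α
  hcomp α β := α ≫ β
  src_one _ := rfl
  tgt_one _ := rfl
  src_vcomp _ _ _ := rfl
  tgt_vcomp _ _ h := h
  src_hcomp _ _ := rfl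
  tgt_hcomp _ _ := rfl
  one_vcomp _ := rfl
  vcomp_one _ := rfl
  vcomp_assoc _ _ _ _ _ := rfl
  one_hcomp _ := Category.id_comp _
  hcomp_one _ := Category.comp_id _
  hcomp_assoc _ _ _ := Category.assoc _ _ _
  one_comp _ _ := rfl
  interchange _ _ _ _ _ _ := rfl

instance (X Y : LocDisc I) (f g : HomCat X Y) : Subsingleton (f ⟶ g) :=
  ⟨fun α β => HomCat.hom_ext (α.2.1.trans β.2.1.symm)⟩

/-- The hom-categories are discrete, so this is where `IsBase.discrete` is needed. It makes any
small category an admissible index for `𝒱`-weighted colimits. -/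
instance (P : ObjectProperty Cat.{w, w}) [IsBase P] : HomsIn P (LocDisc I) where
  prop X Y := by
    let F : Discrete (X ⟶ Y) ⥤ HomCat X Y := Discrete.functor fun f => f
    let G : HomCat X Y ⥤ Discrete (X ⟶ Y) :=
      { obj := fun f => ⟨f⟩
        map := fun α => Discrete.eqToHom (α.2.1.symm.trans α.2.2)
        map_id := fun _ => Subsingleton.elim _ _
        map_comp := fun _ _ => Subsingleton.elim _ _ }
    refine IsBase.of_iso P (X := Cat.of (Discrete (X ⟶ Y))) ⟨F.toCatHom, G.toCatHom, ?_, ?_⟩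
      (IsBase.discrete P (X ⟶ Y))
    · exact Cat.Hom.ext (CategoryTheory.Functor.ext (fun _ => rfl)
        fun a b _ => Subsingleton.elim
          (α := (show Discrete (X ⟶ Y) from a) ⟶ (show Discrete (X ⟶ Y) from b)) _ _)
    · exact Cat.Hom.ext (CategoryTheory.Functor.ext (fun _ => rfl)
        fun a b _ => Subsingleton.elim
          (α := (show HomCat X Y from a) ⟶ (show HomCat X Y from b)) _ _)

end LocDisc

/-- The constant 2-functor. -/
def TwoFunctor.const (A : Type u₁) [Category.{w} A] [TwoCat A] {B : Type u₂} [Category.{w} B]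
    [TwoCat B] (b : B) : TwoFunctor A B where
  obj _ := b
  map _ := 𝟙 b
  map_id _ := rfl
  map_comp _ _ := (Category.comp_id _).symm
  mapCell _ := one (𝟙 b)
  src_mapCell _ := src_one _
  tgt_mapCell _ := tgt_one _
  mapCell_one _ := rfl
  mapCell_vcomp _ _ _ := (one_vcomp_one _ _).symm
  mapCell_hcomp _ _ := (one_hcomp _).symm

/-- The terminal object of the base. -/
def unitObj (P : ObjectProperty Cat.{w, w}) [IsBase P] : VObj P :=
  ⟨Discrete PUnit.{w + 1}, IsBase.discrete P PUnit⟩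

/-- The object of `unitObj`. -/
abbrev unitPt : Discrete PUnit.{w + 1} := ⟨⟨⟩⟩

theorem functor_unit_ext {E : Type u₁} [Category.{w} E] {F G : Discrete PUnit.{w + 1} ⥤ E}
    (h : F.obj unitPt = G.obj unitPt) : F = G := by
  refine CategoryTheory.Functor.ext (fun _ => h) fun x y f => ?_
  obtain ⟨⟨⟩⟩ := x
  obtain ⟨⟨⟩⟩ := y
  obtain rfl : f = 𝟙 unitPt := Subsingleton.elim _ _
  simp

section weighted

variable (P : ObjectProperty Cat.{w, w}) [IsBase P] {C : Type u₁} [Category.{w} C] [TwoCat C]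
  [HomsIn P C]

/-- The functor `1 ⟶ C(a, b)` that corresponds to a morphism. -/
def pickHom {a b : C} (f : a ⟶ b) : unitObj P ⟶ homObj P a b :=
  (Functor.const (Discrete PUnit.{w + 1})).obj (show HomCat a b from f)

/-- The natural transformation between functors `1 ⟶ C(a, b)` that corresponds to a 2-cell. -/
def pickCell {a b : C} (θ : Cell a b) : NatCell (Discrete PUnit.{w + 1}) (HomCat a b) where
  dom := pickHom P (src θ)
  cod := pickHom P (tgt θ)
  hom := (Functor.const (Discrete PUnit.{w + 1})).map
    (X := show HomCat a b from src θ) (Y := show HomCat a b from tgt θ) ⟨θ, rfl, rfl⟩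

variable {P}

/-- The 2-cell that corresponds to a natural transformation between functors `1 ⟶ C(a, b)`. -/
def NatCell.unitCell {a b : C} (α : NatCell (Discrete PUnit.{w + 1}) (HomCat a b)) : Cell a b :=
  HomCat.cell (α.hom.app unitPt)

theorem NatCell.src_unitCell {a b : C} (α : NatCell (Discrete PUnit.{w + 1}) (HomCat a b)) :
    src α.unitCell = α.dom.obj unitPt := (α.hom.app unitPt).2.1

theorem NatCell.tgt_unitCell {a b : C} (α : NatCell (Discrete PUnit.{w + 1}) (HomCat a b)) :
    tgt α.unitCell = α.cod.obj unitPt := (α.hom.app unitPt).2.2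

/-- A 2-cell remembers its source and target, so its value at the only object also determines the
two functors that it connects. -/
theorem NatCell.unit_ext {a b : C} {α β : NatCell (Discrete PUnit.{w + 1}) (HomCat a b)}
    (h : α.unitCell = β.unitCell) : α = β := by
  refine HomCat.natCell_ext (functor_unit_ext ?_) (functor_unit_ext ?_) fun e => h
  · exact α.src_unitCell.symm.trans ((congrArg src h).trans β.src_unitCell)
  · exact α.tgt_unitCell.symm.trans ((congrArg tgt h).trans β.tgt_unitCell)

variable {I : Type w} [SmallCategory I]

variable (P) in
/-- The unit, with the constant weight `1`, given by a cocone. -/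
def coneUnit (G : TwoFunctor (LocDisc I) C) (c : Cocone (J := LocDisc I) G.toFunctor) :
    TwoNat (TwoFunctor.const (LocDisc I)ᵒᵖ (unitObj P)) (G.op.comp (homTo P c.pt)) where
  app j := pickHom P (c.ι.app j.unop)
  naturality {i j} f := functor_unit_ext (c.w f.unop).symm
  -- A 2-cell of the index is a morphism `α`, sent by `G` to an identity 2-cell; so this is the
  -- cocone equation again, between identity 2-cells.
  naturality_cell {i j} α := NatCell.unit_ext (by
    have h₁ : one (c.ι.app j.unop) =
        hcomp (G.mapCell (X := j.unop) (Y := i.unop) α) (one (c.ι.app i.unop)) := by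
      rw [← c.w (show j.unop ⟶ i.unop from α), one_comp]
      exact congrArg (fun k => hcomp k (one (c.ι.app i.unop))) (G.mapCell_one _).symm
    refine Eq.trans ?_ (h₁.trans ?_)
    · exact congrArg HomCat.cell (NatTrans.hcomp_id_app (H := pickHom P (c.ι.app j.unop))
        (NatTrans.id (𝟭 (Discrete PUnit.{w + 1}))) unitPt)
    · exact (congrArg HomCat.cell (NatTrans.id_hcomp_app (H := pickHom P (c.ι.app i.unop))
        (preCell (G.mapCell (X := j.unop) (Y := i.unop) α) c.pt).hom unitPt)).symm)

/-- The cocone given by a unit with the constant weight `1`. -/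
def unitCone {G : TwoFunctor (LocDisc I) C} {L : C}
    (s : TwoNat (TwoFunctor.const (LocDisc I)ᵒᵖ (unitObj P)) (G.op.comp (homTo P L))) :
    Cocone (J := LocDisc I) G.toFunctor where
  pt := L
  ι :=
    { app := fun i => (s.app (op i)).obj unitPt
      naturality := fun i j f => by
        have h := Functor.congr_obj (s.naturality f.op) unitPt
        exact h.symm.trans (Category.comp_id _).symm }

theorem unitCone_cell {G : TwoFunctor (LocDisc I) C} {L : C}
    {s t : TwoNat (TwoFunctor.const (LocDisc I)ᵒᵖ (unitObj P)) (G.op.comp (homTo P L))}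
    (Γ : Modif s t) {i j : LocDisc I} (k : i ⟶ j) :
    hcomp (one (G.map k)) (NatCell.unitCell (Γ.app (op j))) =
      NatCell.unitCell (Γ.app (op i)) := by
  have h := congrArg NatCell.unitCell (Γ.naturality k.op)
  refine Eq.trans ?_ (h.symm.trans ?_)
  · exact (congrArg HomCat.cell (NatTrans.hcomp_id_app
        (H := preComp (G.map k) L) (NatCell.hom (Γ.app (op j))) unitPt)).symm
  · exact (congrArg HomCat.cell (NatTrans.id_hcomp_app (H := 𝟭 (Discrete PUnit.{w + 1}))
      (NatCell.hom (Γ.app (op i))) unitPt))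

/-- For the constant weight `1`, transformations into `C(G-, X)` are cocones and modifications are
compatible families of 2-cells; the two universal properties correspond clause by clause. -/
theorem IsConicalColimit.isWeighted (G : TwoFunctor (LocDisc I) C)
    (c : Cocone (J := LocDisc I) G.toFunctor) (hc : IsConicalColimit (I := LocDisc I) c) :
    IsWeightedColimit P (coneUnit P G c) := by
  intro X
  refine ⟨fun s => ?_, fun s t Γ => ?_⟩
  · obtain ⟨k⟩ := hc.isColimit
    refine ⟨k.desc (unitCone s), fun j => functor_unit_ext (k.fac (unitCone s) j.unop),
      fun f hf => k.uniq (unitCone s) f fun i => Functor.congr_obj (hf (op i)) unitPt⟩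
  · obtain ⟨θ, h₁, h₂⟩ := hc.cell X (fun i => NatCell.unitCell (Γ.app (op i)))
      fun k => unitCone_cell Γ k
    have key : ∀ (θ : Cell c.pt X) (j : (LocDisc I)ᵒᵖ),
        NatCell.unitCell (hcomp (one ((coneUnit P G c).app j))
          ((homFrom P (G.obj j.unop)).mapCell θ)) = hcomp (one (c.ι.app j.unop)) θ := fun θ j =>
      congrArg HomCat.cell (NatTrans.id_hcomp_app (H := pickHom P (c.ι.app j.unop))
        (postCell (G.obj j.unop) θ).hom unitPt)
    refine ⟨θ, fun j => NatCell.unit_ext ((key θ j).trans (h₁ j.unop)), fun η hη =>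
      h₂ η fun i => ?_⟩
    exact (key η (op i)).symm.trans (congrArg NatCell.unitCell (hη (op i)))

theorem IsWeightedColimit.isConical {G : TwoFunctor (LocDisc I) C} {L : C}
    {ν : TwoNat (TwoFunctor.const (LocDisc I)ᵒᵖ (unitObj P)) (G.op.comp (homTo P L))}
    (h : IsWeightedColimit P ν) : IsConicalColimit (I := LocDisc I) (unitCone ν) where
  isColimit := by
    have h' := fun t : Cocone (J := LocDisc I) G.toFunctor => (h t.pt).1 (coneUnit P G t)
    choose f hf hf' using h'
    exact ⟨{ desc := f
             fac := fun t i => Functor.congr_obj (hf t (op i)) unitPt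
             uniq := fun t m hm => hf' t m fun j => functor_unit_ext (hm j.unop) }⟩
  cell X Γ hΓ := by
    -- A modification has a source and a target. For the family `Γ` these are the cocones of the
    -- sources and of the targets of its members.
    let cs : Cocone (J := LocDisc I) G.toFunctor :=
      { pt := X
        ι := { app := fun i => src (Γ i)
               naturality := fun i j k => by
                have := congrArg src (hΓ k)
                rw [src_hcomp, src_one] at this
                exact this.trans (Category.comp_id _).symm } }
    let ct : Cocone (J := LocDisc I) G.toFunctor :=
      { pt := X
        ι := { app := fun i => tgt (Γ i)
               naturality := fun i j k => by
                have := congrArg tgt (hΓ k)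
                rw [tgt_hcomp, tgt_one] at this
                exact this.trans (Category.comp_id _).symm } }
    let Γ' : Modif (coneUnit P G cs) (coneUnit P G ct) :=
      { app := fun j => pickCell P (Γ j.unop)
        src_app := fun _ => rfl
        tgt_app := fun _ => rfl
        naturality := fun {i j} k => NatCell.unit_ext (by
          refine Eq.trans ?_ ((hΓ k.unop).symm.trans ?_)
          · exact congrArg HomCat.cell (NatTrans.id_hcomp_app (H := 𝟭 (Discrete PUnit.{w + 1}))
              (pickCell P (Γ j.unop)).hom unitPt)
          · exact (congrArg HomCat.cell (NatTrans.hcomp_id_app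
              (H := preComp (G.map k.unop) X) (pickCell P (Γ i.unop)).hom unitPt)).symm) }
    have key : ∀ (θ : Cell L X) (i : LocDisc I),
        NatCell.unitCell (hcomp (one (ν.app (op i))) ((homFrom P (G.obj i)).mapCell θ)) =
          hcomp (one ((unitCone ν).ι.app i)) θ := fun θ i =>
      congrArg HomCat.cell (NatTrans.id_hcomp_app (H := ν.app (op i))
        (postCell (G.obj i) θ).hom unitPt)
    obtain ⟨θ, h₁, h₂⟩ := (h X).2 _ _ Γ'
    refine ⟨θ, fun i => (key θ i).symm.trans (congrArg NatCell.unitCell (h₁ (op i))),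
      fun η hη => h₂ η fun j => NatCell.unit_ext ((key η j.unop).trans (hη j.unop))⟩

variable {D : Type u₂} [Category.{w} D] [TwoCat D] [HomsIn P D]

/-- A functor, seen as a 2-functor on a locally discrete 2-category. -/
def locDiscFunctor (F : I ⥤ C) : TwoFunctor (LocDisc I) C where
  obj i := F.obj i
  map f := F.map f
  map_id _ := F.map_id _
  map_comp _ _ := F.map_comp _ _
  mapCell {X Y} α := one (F.map (show X ⟶ Y from α))
  src_mapCell _ := src_one _
  tgt_mapCell _ := tgt_one _
  mapCell_one _ := rfl
  mapCell_vcomp {X Y} α β h := by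
    obtain rfl : (show X ⟶ Y from α) = β := h
    exact (one_vcomp_one _ _).symm
  mapCell_hcomp {X Y Z} α β :=
    (congrArg one (F.map_comp (show X ⟶ Y from α) (show Y ⟶ Z from β))).trans (one_comp _ _)

/-- A conical colimit is a weighted colimit over `LocDisc I`, which `F` preserves. The cocone read
off from the transported unit is definitionally the image of the original one. -/
theorem IsCocontinuous.preservesConical {F : TwoFunctor C D} (hF : IsCocontinuous P F) :
    PreservesConical I F := by
  intro E c hc
  exact (hF (LocDisc I) _ (locDiscFunctor E) c.pt _
    (IsConicalColimit.isWeighted (locDiscFunctor E) c hc)).isConical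

end weighted

/-! ### Filtered colimits of categories -/

section arrows

variable {L : Type u₁} [Category.{w} L] {E : Type u₂} [Category.{w} E]

/-- Equalities of functors are handled below as equalities in `Arrow`, which bundle the equality of
the end points; such equalities can be composed. -/
theorem arrow_mk_comp {x y z x' y' z' : L} {f : x ⟶ y} {g : y ⟶ z} {f' : x' ⟶ y'} {g' : y' ⟶ z'}
    (hf : Arrow.mk f = Arrow.mk f') (hg : Arrow.mk g = Arrow.mk g') :
    Arrow.mk (f ≫ g) = Arrow.mk (f' ≫ g') := by
  obtain rfl : x = x' := congrArg Comma.left hf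
  obtain rfl : y = y' := congrArg Comma.right hf
  obtain rfl : z = z' := congrArg Comma.right hg
  obtain rfl : f = f' := Arrow.mk_injective _ _ hf
  obtain rfl : g = g' := Arrow.mk_injective _ _ hg
  rfl

theorem functor_arrow_ext {F G : L ⥤ E} (h : ∀ a, F.mapArrow.obj a = G.mapArrow.obj a) : F = G :=
  Arrow.functor_ext fun _ _ f => h (Arrow.mk f)

/-- A map on arrows that is compatible with identities and composition comes from a functor. -/
theorem exists_functor_of_arrows (τ : Arrow L → Arrow E)
    (hid : ∀ x, ∃ e, τ (Arrow.mk (𝟙 x)) = Arrow.mk (𝟙 e))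
    (hcomp : ∀ {x y z : L} (f : x ⟶ y) (g : y ⟶ z), ∃ (a b c : E) (u : a ⟶ b) (v : b ⟶ c),
      τ (Arrow.mk f) = Arrow.mk u ∧ τ (Arrow.mk g) = Arrow.mk v ∧
        τ (Arrow.mk (f ≫ g)) = Arrow.mk (u ≫ v)) :
    ∃ H : L ⥤ E, ∀ a, H.mapArrow.obj a = τ a := by
  -- The action on objects is read off from identities. Composability of `τ (𝟙 x)` with `τ f` then
  -- forces the domain of `τ f` to be `o x`, and dually for the codomain.
  choose o ho using hid
  have hl : ∀ {x y : L} (f : x ⟶ y), (τ (Arrow.mk f)).left = o x := fun {x y} f => by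
    obtain ⟨a, b, c, u, v, h₁, h₂, -⟩ := hcomp (𝟙 x) f
    rw [h₂]
    exact (congrArg Comma.right h₁).symm.trans (congrArg Comma.right (ho x))
  have hr : ∀ {x y : L} (f : x ⟶ y), (τ (Arrow.mk f)).right = o y := fun {x y} f => by
    obtain ⟨a, b, c, u, v, h₁, h₂, -⟩ := hcomp f (𝟙 y)
    rw [h₁]
    exact (congrArg Comma.left h₂).symm.trans (congrArg Comma.left (ho y))
  have key : ∀ {a : Arrow E} {p q : E} {u : p ⟶ q} {p' q' : E} (h : a = Arrow.mk u)
      (hp : p' = a.left)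
      (hq : a.right = q'),
      eqToHom hp ≫ a.hom ≫ eqToHom hq = eqToHom (by rw [hp, h]; rfl) ≫ u ≫ eqToHom (by
        rw [← hq, h]; rfl) := by
    rintro _ p q u p' q' rfl hp hq
    rfl
  have harr : ∀ {a : Arrow E} {p' q' : E} (hp : p' = a.left) (hq : a.right = q'),
      Arrow.mk (eqToHom hp ≫ a.hom ≫ eqToHom hq) = a := by
    rintro a _ _ rfl rfl
    simp
  refine ⟨{ obj := o
            map := fun f => eqToHom (hl f).symm ≫ (τ (Arrow.mk f)).hom ≫ eqToHom (hr f)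
            map_id := fun x => ?_
            map_comp := fun {x y z} f g => ?_ }, fun a => harr _ _⟩
  · rw [key (ho x)]
    simp
  · obtain ⟨a, b, c, u, v, h₁, h₂, h₃⟩ := hcomp f g
    rw [key h₁, key h₂, key h₃]
    simp

end arrows

/-! ### Cocones of categories that are filtered colimits on sets of arrows. -/

section union

variable {P : ObjectProperty Cat.{w, w}} {I : Type w} [SmallCategory I] {D : I ⥤ VObj P}

/-- The transition functors of a diagram of categories. -/
abbrev transition (D : I ⥤ VObj P) {i j : I} (k : i ⟶ j) :
    (D.obj i).carrier ⥤ (D.obj j).carrier := D.map k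

/-- The components of a cocone of categories. -/
abbrev leg (c : Cocone D) (i : I) : (D.obj i).carrier ⥤ c.pt.carrier := c.ι.app i

theorem transition_leg (c : Cocone D) {i j : I} (k : i ⟶ j) : transition D k ⋙ leg c j = leg c i :=
  c.w k

/-- A cocone of categories that is a filtered colimit at the level of the sets of arrows. -/
structure IsArrowUnion (c : Cocone D) : Prop where
  surj (a : Arrow c.pt.carrier) :
    ∃ (i : I) (b : Arrow (D.obj i).carrier), (leg c i).mapArrow.obj b = a
  inj {i : I} {a b : Arrow (D.obj i).carrier} :
    (leg c i).mapArrow.obj a = (leg c i).mapArrow.obj b →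
      ∃ (j : I) (k : i ⟶ j), (transition D k).mapArrow.obj a = (transition D k).mapArrow.obj b

namespace IsArrowUnion

variable {c : Cocone D} {E : Type u₁} [Category.{w} E]

theorem functor_ext (hc : IsArrowUnion c) {F G : c.pt.carrier ⥤ E}
    (h : ∀ i, leg c i ⋙ F = leg c i ⋙ G) : F = G := by
  refine functor_arrow_ext fun a => ?_
  obtain ⟨i, b, rfl⟩ := hc.surj a
  exact congrArg (fun T : _ ⥤ E => T.mapArrow.obj b) (h i)

variable [IsFiltered I]

/-- Filteredness makes the induced map on arrows well defined, and lets two composable arrows of the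
vertex be lifted to composable arrows of one stage, whence functoriality. The target `E` is an
arbitrary category, not only one in the base. -/
theorem exists_desc (hc : IsArrowUnion c) (t : ∀ i, (D.obj i).carrier ⥤ E)
    (ht : ∀ {i j : I} (k : i ⟶ j), transition D k ⋙ t j = t i) :
    ∃ H : c.pt.carrier ⥤ E, ∀ i, leg c i ⋙ H = t i := by
  have tr {i j : I} (k : i ⟶ j) (b : Arrow (D.obj i).carrier) :
      (t j).mapArrow.obj ((transition D k).mapArrow.obj b) = (t i).mapArrow.obj b :=
    congrArg (fun T : _ ⥤ E => T.mapArrow.obj b) (ht k)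
  have lr {i j : I} (k : i ⟶ j) (b : Arrow (D.obj i).carrier) :
      (leg c j).mapArrow.obj ((transition D k).mapArrow.obj b) = (leg c i).mapArrow.obj b :=
    congrArg (fun T : _ ⥤ c.pt.carrier => T.mapArrow.obj b) (transition_leg c k)
  -- Independence of the lift: two lifts of the same arrow are moved to a common stage and then
  -- become equal at a later one.
  have wd {i j : I} (b : Arrow (D.obj i).carrier) (b' : Arrow (D.obj j).carrier)
      (h : (leg c i).mapArrow.obj b = (leg c j).mapArrow.obj b') :
      (t i).mapArrow.obj b = (t j).mapArrow.obj b' := by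
    rw [← lr (IsFiltered.leftToMax i j) b, ← lr (IsFiltered.rightToMax i j) b'] at h
    obtain ⟨m, k, hk⟩ := hc.inj h
    rw [← tr (IsFiltered.leftToMax i j) b, ← tr (IsFiltered.rightToMax i j) b', ← tr k, hk, tr k]
  choose σ b hb using hc.surj
  have hτ {i : I} (a : Arrow (D.obj i).carrier) :
      (t _).mapArrow.obj (b ((leg c i).mapArrow.obj a)) = (t i).mapArrow.obj a :=
    wd _ _ (hb _)
  obtain ⟨H, hH⟩ := exists_functor_of_arrows (fun a => (t (σ a)).mapArrow.obj (b a))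
    (fun x => by
      obtain ⟨i, a, ha⟩ := hc.surj (Arrow.mk (𝟙 x))
      refine ⟨(t i).obj a.left, ?_⟩
      have hx : (leg c i).obj a.left = x := congrArg Comma.left ha
      -- The chosen lift of an identity need not be an identity, but the identity of its domain is
      -- another lift.
      have hx' : (leg c i).mapArrow.obj (Arrow.mk (𝟙 a.left)) = Arrow.mk (𝟙 x) := by
        subst hx
        exact congrArg Arrow.mk ((leg c i).map_id _)
      rw [← hx', hτ]
      exact congrArg Arrow.mk ((t i).map_id _))
    (fun {x y z} f g => by
      obtain ⟨i, bf, hf⟩ := hc.surj (Arrow.mk f)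
      obtain ⟨j, bg, hg⟩ := hc.surj (Arrow.mk g)
      rw [← lr (IsFiltered.leftToMax i j)] at hf
      rw [← lr (IsFiltered.rightToMax i j)] at hg
      generalize (transition D (IsFiltered.leftToMax i j)).mapArrow.obj bf = bf at hf
      generalize (transition D (IsFiltered.rightToMax i j)).mapArrow.obj bg = bg at hg
      -- The lifts of `f` and `g` meet only in the vertex. As `inj` speaks of arrows alone, the end
      -- points are compared through their identities, and agree at a later stage.
      have hm : (leg c _).mapArrow.obj (Arrow.mk (𝟙 bf.right)) =
          (leg c _).mapArrow.obj (Arrow.mk (𝟙 bg.left)) := by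
        have h₁ : (leg c _).obj bf.right = (leg c _).obj bg.left :=
          (congrArg Comma.right hf).trans (congrArg Comma.left hg).symm
        exact (congrArg Arrow.mk ((leg c _).map_id _)).trans
          ((congrArg (fun o => Arrow.mk (𝟙 o)) h₁).trans
            (congrArg Arrow.mk ((leg c _).map_id _)).symm)
      obtain ⟨m, k, hk⟩ := hc.inj hm
      rw [← lr k] at hf hg
      have hk' : ((transition D k).mapArrow.obj bf).right =
          ((transition D k).mapArrow.obj bg).left :=
        congrArg Comma.left hk
      generalize (transition D k).mapArrow.obj bf = bf at hf hk'
      generalize (transition D k).mapArrow.obj bg = bg at hg hk'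
      obtain ⟨p, q, u⟩ := bf
      obtain ⟨q', r, v⟩ := bg
      obtain rfl : q = q' := hk'
      refine ⟨_, _, _, (t m).map u, (t m).map v, ?_, ?_, ?_⟩
      · exact (congrArg (fun a => (t (σ a)).mapArrow.obj (b a)) hf.symm).trans (hτ _)
      · exact (congrArg (fun a => (t (σ a)).mapArrow.obj (b a)) hg.symm).trans (hτ _)
      · have h : (leg c m).mapArrow.obj (Arrow.mk (u ≫ v)) = Arrow.mk (f ≫ g) :=
          Eq.trans (congrArg Arrow.mk ((leg c m).map_comp _ _)) (arrow_mk_comp hf hg)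
        rw [← h, hτ]
        exact congrArg Arrow.mk ((t m).map_comp _ _))
  refine ⟨H, fun i => functor_arrow_ext fun a => ?_⟩
  exact (hH ((leg c i).mapArrow.obj a)).trans (hτ a)

end IsArrowUnion

section natCell

variable {A B : Type w} [Category.{w} A] [Category.{w} B]

/-- A natural transformation, as a functor to the category of arrows. -/
def NatCell.toArrow (α : NatCell A B) : A ⥤ Arrow B where
  obj a := Arrow.mk (α.hom.app a)
  map f := Arrow.homMk (α.dom.map f) (α.cod.map f) (α.hom.naturality f)
  map_id a := Arrow.hom_ext _ _ (α.dom.map_id a) (α.cod.map_id a)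
  map_comp f g := Arrow.hom_ext _ _ (α.dom.map_comp f g) (α.cod.map_comp f g)

/-- The natural transformation given by a functor to the category of arrows. -/
def NatCell.ofArrow (H : A ⥤ Arrow B) : NatCell A B where
  dom := H ⋙ Arrow.leftFunc
  cod := H ⋙ Arrow.rightFunc
  hom := { app := fun a => (H.obj a).hom, naturality := fun _ _ f => Arrow.w (H.map f) }

end natCell

theorem NatCell.ofArrow_comp {X Y Z : VObj P} (F : X ⟶ Y) (H : Y.carrier ⥤ Arrow Z.carrier) :
    NatCell.ofArrow (Functor.comp (show X.carrier ⥤ Y.carrier from F) H) =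
      hcomp (C := VObj P) (X := X) (Y := Y) (Z := Z) (one F) (NatCell.ofArrow H) :=
  NatCell.ext' rfl rfl fun a => by
    have : (NatTrans.hcomp (NatTrans.id (show X.carrier ⥤ Y.carrier from F))
        (NatCell.ofArrow H).hom).app a = (NatCell.ofArrow H).hom.app (Functor.obj F a) :=
      NatTrans.id_hcomp_app _ _
    exact this.symm.trans ((Category.id_comp _).trans (Category.comp_id _)).symm

/-- A 2-cell from the vertex to `X` is a functor from the vertex to `Arrow X`, so the universal
property for 2-cells is that for functors, with `Arrow X.carrier` as target. The vertex being in `𝒱`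
already, no closure of `𝒱` under filtered colimits is involved. -/
theorem IsArrowUnion.isConical [IsFiltered I] {c : Cocone D} (hc : IsArrowUnion c) :
    IsConicalColimit c where
  isColimit := by
    have h := fun s : Cocone D => hc.exists_desc (fun i => leg s i) fun k => transition_leg s k
    choose H hH using h
    exact ⟨{ desc := fun s => H s
             fac := fun s i => hH s i
             uniq := fun s m hm => hc.functor_ext fun i => (hm i).trans (hH s i).symm }⟩
  cell X Γ hΓ := by
    obtain ⟨H, hH⟩ := hc.exists_desc (fun i => NatCell.toArrow (Γ i)) (fun {i j} k =>
      congrArg NatCell.toArrow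
        ((NatCell.ofArrow_comp (Z := X) (D.map k) (NatCell.toArrow (Γ j))).trans (hΓ k)))
    refine ⟨NatCell.ofArrow H, fun i => ?_, fun θ hθ => ?_⟩
    · exact (NatCell.ofArrow_comp (Z := X) (c.ι.app i) H).symm.trans
        (congrArg NatCell.ofArrow (hH i))
    · refine congrArg NatCell.ofArrow (hc.functor_ext (F := NatCell.toArrow θ) fun i => ?_)
      exact (congrArg NatCell.toArrow ((NatCell.ofArrow_comp (Z := X) (c.ι.app i)
        (NatCell.toArrow θ)).trans (hθ i))).trans (hH i).symm

end union

/-! ### Preservation of filtered colimits by hom 2-functors -/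

section cells

variable {P : ObjectProperty Cat.{w, w}} {C : Type u} [Category.{w} C] [TwoCat C]
  {I : Type w} [SmallCategory I]

/-- The 2-cells from `a` to the vertex of a cocone are the filtered colimit of the sets of 2-cells
from `a` to the objects of the diagram. -/
structure CellsLift (a : C) {D : I ⥤ C} (c : Cocone D) : Prop where
  surj (θ : Cell a c.pt) : ∃ (i : I) (η : Cell a (D.obj i)), hcomp η (one (c.ι.app i)) = θ
  inj {i : I} {η η' : Cell a (D.obj i)} :
    hcomp η (one (c.ι.app i)) = hcomp η' (one (c.ι.app i)) →
      ∃ (j : I) (k : i ⟶ j), hcomp η (one (D.map k)) = hcomp η' (one (D.map k))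

theorem hcomp_one_map {a : C} {D : I ⥤ C} {i j k : I} (η : Cell a (D.obj i)) (f : i ⟶ j)
    (g : j ⟶ k) :
    hcomp (hcomp η (one (D.map f))) (one (D.map g)) = hcomp η (one (D.map (f ≫ g))) := by
  rw [hcomp_assoc, ← one_comp, D.map_comp]

theorem hcomp_one_ι {a : C} {D : I ⥤ C} (c : Cocone D) {i j : I} (η : Cell a (D.obj i))
    (f : i ⟶ j) :
    hcomp (hcomp η (one (D.map f))) (one (c.ι.app j)) = hcomp η (one (c.ι.app i)) := by
  rw [hcomp_assoc, ← one_comp, c.w]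

/-- Filtered colimits of sets commute with pullbacks: the 2-cells `a ⟶ g` of `C^𝟐` are the pairs of
2-cells between domains and between codomains that agree as 2-cells `dom a ⟶ cod g`. This is why
`h₃` mixes the domain of `a` with the codomain diagram. -/
theorem CellsLift.arrow [IsFiltered I] {a : Arrow C} {D : I ⥤ Arrow C} {c : Cocone D}
    (h₁ : CellsLift a.left ((domF C).toFunctor.mapCocone c))
    (h₂ : CellsLift a.right ((codF C).toFunctor.mapCocone c))
    (h₃ : CellsLift a.left ((codF C).toFunctor.mapCocone c)) : CellsLift a c where
  surj θ := by
    obtain ⟨i, l, hl⟩ := h₁.surj (ArrowCell.left θ)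
    obtain ⟨j, r, hr⟩ := h₂.surj (ArrowCell.right θ)
    rw [← hcomp_one_ι _ l (IsFiltered.leftToMax i j)] at hl
    rw [← hcomp_one_ι _ r (IsFiltered.rightToMax i j)] at hr
    generalize hcomp l (one ((D ⋙ (domF C).toFunctor).map (IsFiltered.leftToMax i j))) = l at hl
    generalize hcomp r (one ((D ⋙ (codF C).toFunctor).map (IsFiltered.rightToMax i j))) = r at hr
    generalize IsFiltered.max i j = m at l r hl hr
    have hw : hcomp (hcomp l (one (D.obj m).hom)) (one (c.ι.app m).right) =
        hcomp (hcomp (one a.hom) r) (one (c.ι.app m).right) := by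
      have e := Arrow.w (c.ι.app m)
      have e' := ArrowCell.w θ
      dsimp at e e' hl hr
      rw [hcomp_assoc, ← one_comp, ← e, one_comp, ← hcomp_assoc, hl, e', ← hr, hcomp_assoc]
    -- The two lifts are compatible after the leg, by `hw`, hence already at some stage `n` of the
    -- diagram.
    obtain ⟨n, k, hk⟩ := h₃.inj hw
    refine ⟨n, ArrowCell.mk (hcomp l (one (D.map k).left)) (hcomp r (one (D.map k).right)) ?_,
      ArrowCell.ext ((hcomp_one_ι _ l k).trans hl) ((hcomp_one_ι _ r k).trans hr)⟩
    have e := Arrow.w (D.map k)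
    dsimp at e hk ⊢
    rw [hcomp_assoc, ← one_comp, e, one_comp, ← hcomp_assoc, hk, hcomp_assoc]
  inj {i η η'} h := by
    obtain ⟨j, k, hk⟩ := h₁.inj (congrArg ArrowCell.left h)
    obtain ⟨j', k', hk'⟩ := h₂.inj (congrArg ArrowCell.right h)
    obtain ⟨m, l, l', hl⟩ := IsFiltered.span k k'
    refine ⟨m, k ≫ l, ArrowCell.ext ?_ ?_⟩
    · exact (hcomp_one_map (D := D ⋙ (domF C).toFunctor) _ k l).symm.trans
        ((congrArg (fun x => hcomp x (one (D.map l).left)) hk).trans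
          (hcomp_one_map (D := D ⋙ (domF C).toFunctor) _ k l))
    · rw [hl]
      exact (hcomp_one_map (D := D ⋙ (codF C).toFunctor) _ k' l').symm.trans
        ((congrArg (fun x => hcomp x (one (D.map l').right)) hk').trans
          (hcomp_one_map (D := D ⋙ (codF C).toFunctor) _ k' l'))

variable [HomsIn P C]

theorem HomCat.arrow_ext {a b : C} {x y : Arrow (HomCat a b)}
    (h : HomCat.cell x.hom = HomCat.cell y.hom) : x = y := by
  obtain ⟨p, q, f⟩ := x
  obtain ⟨p', q', g⟩ := y
  obtain rfl : p = p' := f.2.1.symm.trans ((congrArg src h).trans g.2.1)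
  obtain rfl : q = q' := f.2.2.symm.trans ((congrArg tgt h).trans g.2.2)
  exact congrArg Arrow.mk (HomCat.hom_ext (f := p) (g := q) (α := f) (β := g) h)

/-- A 2-cell, as an arrow of the hom-category. -/
def HomCat.arrowOf {a b : C} (θ : Cell a b) : Arrow (HomCat a b) :=
  Arrow.mk (X := (show HomCat a b from src θ)) (Y := (show HomCat a b from tgt θ)) ⟨θ, rfl, rfl⟩

variable (P) in
-- The arrows of a hom-category are the 2-cells with their sources and targets, and morphisms are
-- covered as identity 2-cells. Hence the condition on 2-cells suffices.
theorem CellsLift.isArrowUnion {a : C} {D : I ⥤ C} {c : Cocone D} (h : CellsLift a c) :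
    IsArrowUnion ((homFrom P a).toFunctor.mapCocone c) where
  surj x := by
    obtain ⟨i, η, hη⟩ := h.surj (HomCat.cell x.hom)
    exact ⟨i, HomCat.arrowOf η, HomCat.arrow_ext hη⟩
  inj {i x y} hxy := by
    obtain ⟨j, k, hk⟩ := h.inj (i := i) (η := HomCat.cell x.hom) (η' := HomCat.cell y.hom)
      (congrArg (fun z : Arrow (HomCat a c.pt) => HomCat.cell z.hom) hxy)
    exact ⟨j, k, HomCat.arrow_ext hk⟩

end cells

/-! ### Tensors with the arrow category. -/

section tensor

variable {P : ObjectProperty Cat.{w, w}} [IsBase P] {C : Type u} [Category.{w} C] [TwoCat C]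
  [HomsIn P C]

/-- `ν` exhibits `T` as the tensor of `A` with `𝟐`. -/
def IsTensorTwo {A T : C} (ν : Cell A T) : Prop :=
  ∀ (X : C) (θ : Cell A X), ∃! f : T ⟶ X, hcomp ν (one f) = θ

/-- The tensor identifies 2-cells out of `A` with morphisms out of `T`, naturally in the target, so
the claim is the preservation of the colimit by `C(T, -)`. -/
theorem IsTensorTwo.cellsLift {A T : C} {ν : Cell A T} (h : IsTensorTwo ν) {I : Type w}
    [SmallCategory I] [IsFiltered I] {D : I ⥤ C} {c : Cocone D} (hc : IsColimit c)
    [PreservesColimit D (coyoneda.obj (op T))] : CellsLift A c where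
  surj θ := by
    obtain ⟨f, hf, -⟩ := h _ θ
    obtain ⟨i, p, rfl⟩ := exists_hom_of_preservesColimit_coyoneda hc f
    exact ⟨i, hcomp ν (one p), by rw [← hf, one_comp, hcomp_assoc]⟩
  inj {i η η'} e := by
    obtain ⟨f, rfl, -⟩ := h _ η
    obtain ⟨g, rfl, -⟩ := h _ η'
    rw [hcomp_assoc, hcomp_assoc, ← one_comp, ← one_comp] at e
    obtain ⟨j, k, hk⟩ := exists_eq_of_preservesColimit_coyoneda_self hc f g
      ((h _ (hcomp ν (one (f ≫ c.ι.app i)))).unique rfl e.symm)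
    exact ⟨j, k, by rw [hcomp_assoc, hcomp_assoc, ← one_comp, ← one_comp, hk]⟩

namespace catTwo

/-- The arrow of `𝟐`. -/
def arr : (ULift.up.{w} (0 : Fin 2) : catTwo.{w}) ⟶ (ULift.up.{w} (1 : Fin 2) : catTwo.{w}) :=
  catTwo.hom fun h => absurd (show (0 : Fin 2) = 1 from h) (by decide)

theorem functor_ext {E : Type u₁} [Category.{w} E] {F G : catTwo.{w} ⥤ E}
    (h : F.mapArrow.obj (Arrow.mk arr) = G.mapArrow.obj (Arrow.mk arr)) : F = G := by
  have hid : ∀ {F G : catTwo.{w} ⥤ E} (s : catTwo.{w}), F.obj s = G.obj s →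
      ∀ f : s ⟶ s, F.mapArrow.obj (Arrow.mk f) = G.mapArrow.obj (Arrow.mk f) := by
    intro F G s hs f
    obtain rfl : f = 𝟙 s := catTwo.hom_eq _ _
    exact (congrArg Arrow.mk (F.map_id s)).trans
      ((congrArg (fun o => Arrow.mk (𝟙 o)) hs).trans (congrArg Arrow.mk (G.map_id s)).symm)
  refine Arrow.functor_ext fun s t f => ?_
  have hs : ∀ s : catTwo.{w}, s = ULift.up.{w} (0 : Fin 2) ∨ s = ULift.up.{w} (1 : Fin 2) := by
    rintro ⟨s⟩
    fin_cases s
    · exact Or.inl rfl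
    · exact Or.inr rfl
  obtain rfl | rfl := hs s <;> obtain rfl | rfl := hs t
  · exact hid _ (congrArg Comma.left h) f
  · obtain rfl : f = arr := catTwo.hom_eq _ _
    exact h
  · exact absurd (show (0 : Fin 2) = 1 from catTwo.isTrue_of_hom f rfl) (by decide)
  · exact hid _ (congrArg Comma.right h) f

/-- The functor from `𝟐` given by an arrow. -/
def functorOf {E : Type u₁} [Category.{w} E] {x y : E} (f : x ⟶ y) : catTwo.{w} ⥤ E :=
  Functor.comp (D := Fin 2) (Monotone.functor (X := ULift.{w} (Fin 2)) (f := ULift.down)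
    fun _ _ h => h) (ComposableArrows.mk₁ f)

end catTwo

/-- The tensor is the colimit of `A`, as a diagram on the one-point index, weighted by `𝟐`. Its unit
is a functor `𝟐 ⥤ C(A, T)`, that is, a 2-cell. -/
theorem IsCocomplete.exists_tensorTwo (hC : IsCocomplete P C) (A : C) :
    ∃ (T : C) (ν : Cell A T), IsTensorTwo ν := by
  let two : VObj P := ⟨catTwo.{w}, IsBase.two (P := P)⟩
  obtain ⟨T, ν, hν⟩ := hC (LocDisc (Discrete PUnit.{w + 1})) (TwoFunctor.const _ two)
    (TwoFunctor.const _ A)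
  let pt : (LocDisc (Discrete PUnit.{w + 1}))ᵒᵖ := op unitPt
  refine ⟨T, HomCat.cell ((show catTwo.{w} ⥤ HomCat A T from ν.app pt).map catTwo.arr),
    fun X θ => ?_⟩
  let F : two ⟶ homObj P A X := catTwo.functorOf (HomCat.arrowOf θ).hom
  let s : TwoNat (TwoFunctor.const (LocDisc (Discrete PUnit.{w + 1}))ᵒᵖ two)
      ((TwoFunctor.const (LocDisc (Discrete PUnit.{w + 1})) A).op.comp (homTo P X)) :=
    { app := fun _ => F
      naturality := fun _ => (Category.id_comp F).trans ((Category.comp_id F).symm.trans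
        (congrArg (F ≫ ·) ((homTo P X).map_id (op A)).symm))
      naturality_cell := fun _ => (one_hcomp (one F)).trans ((hcomp_one (one F)).symm.trans
        (congrArg (hcomp (one F)) (((homTo P X).mapCell_one (𝟙 (op A))).trans
          (congrArg one ((homTo P X).map_id (op A)))).symm)) }
  obtain ⟨f, h₁, h₂⟩ := (hν X).1 s
  -- Functors out of `𝟐` are determined by the arrow of `𝟐`, so agreement with `s` is agreement of
  -- the 2-cells.
  refine ⟨f, ?_, fun g hg => h₂ g fun j => catTwo.functor_ext ?_⟩
  · exact congrArg (fun H : catTwo.{w} ⥤ HomCat A X => HomCat.cell (H.map catTwo.arr)) (h₁ pt)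
  · exact HomCat.arrow_ext hg

end tensor

/-! ### Ranks, and the hom 2-functors that preserve colimits of `M`-subobjects. -/

section rank

/-- The sets of 2-cells out of `A` are represented by an object whose rank is at most `κ`. -/
def HasCellRankLE {C : Type u} [Category.{w} C] [TwoCat C] (M : MorphismProperty C)
    (κ : Cardinal.{w}) [Fact κ.IsRegular] (A : C) : Prop :=
  ∃ (T : C) (ν : Cell A T), IsTensorTwo ν ∧ HasRankLE M κ T

theorem HasCellRankLE.cellsLift {C : Type u} [Category.{w} C] [TwoCat C] {M : MorphismProperty C}
    {κ : Cardinal.{w}} [Fact κ.IsRegular] {A : C} (h : HasCellRankLE M κ A) {I : Type w}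
    [SmallCategory I] [IsCardinalFiltered I κ] {D : I ⥤ C} (s : Cocone D)
    (hs : ∀ i, M (s.ι.app i)) {c : Cocone D} (hc : IsColimit c) : CellsLift A c := by
  obtain ⟨T, ν, hν, hT⟩ := h
  have := isFiltered_of_isCardinalFiltered I κ
  have := hT I D s hs
  exact hν.cellsLift hc

/-- The 2-functor `C^𝟐(a, -)` preserves the filtered colimits of `M`-subobjects. -/
theorem isConicalColimit_homFrom {P : ObjectProperty Cat.{w, w}} [IsBase P] {C : Type u}
    [Category.{w} C] [TwoCat C] [HomsIn P C] {M : MorphismProperty C} {κ : Cardinal.{w}}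
    [Fact κ.IsRegular] {a : Arrow C} (hl : HasCellRankLE M κ a.left)
    (hr : HasCellRankLE M κ a.right) {I : Type w} [SmallCategory I] [IsCardinalFiltered I κ]
    {D : I ⥤ Arrow C} (s : Cocone D) (hs : ∀ i, M (s.ι.app i).left ∧ M (s.ι.app i).right)
    {c : Cocone D} (hc : IsColimit ((domF C).toFunctor.mapCocone c))
    (hc' : IsColimit ((codF C).toFunctor.mapCocone c)) :
    IsConicalColimit ((homFrom P a).toFunctor.mapCocone c) := by
  have := isFiltered_of_isCardinalFiltered I κ
  refine ((CellsLift.arrow ?_ ?_ ?_).isArrowUnion P).isConical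
  · exact hl.cellsLift ((domF C).toFunctor.mapCocone s) (fun i => (hs i).1) hc
  · exact hr.cellsLift ((codF C).toFunctor.mapCocone s) (fun i => (hs i).2) hc'
  -- The domain of `a` is also tested against the codomain diagram, which is why `M` is needed on
  -- codomains for the object `a.left` as well.
  · exact hl.cellsLift ((codF C).toFunctor.mapCocone s) (fun i => (hs i).2) hc'

theorem HasRankLE.mono {C : Type u} [Category.{w} C] {M : MorphismProperty C} {κ κ' : Cardinal.{w}}
    [Fact κ.IsRegular] [Fact κ'.IsRegular] (h : κ ≤ κ') {A : C} (hA : HasRankLE M κ A) :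
    HasRankLE M κ' A := by
  intro I _ _ D s hs
  have : IsCardinalFiltered I κ := IsCardinalFiltered.of_le I h
  exact hA I D s hs

/-- A small family of objects of a locally ranked category has a common rank. -/
theorem IsLocallyRanked.exists_rank {C : Type u} [Category.{w} C] {E M : MorphismProperty C}
    (h : IsLocallyRanked E M) {T : Type w} (A : T → C) :
    ∃ (κ : Cardinal.{w}) (_ : Fact κ.IsRegular), ∀ t, HasRankLE M κ (A t) := by
  choose κ hκ hA using fun t => h.rank (A t)
  -- Successors of infinite cardinals are regular, and the sum bounds every `κ t`; the maximum with
  -- `ℵ₀` ensures infinity.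
  have hreg : (Order.succ (max Cardinal.aleph0.{w} (Cardinal.sum κ))).IsRegular :=
    Cardinal.isRegular_succ (le_max_left _ _)
  refine ⟨_, ⟨hreg⟩, fun t => ?_⟩
  have : Fact (Order.succ (max Cardinal.aleph0.{w} (Cardinal.sum κ))).IsRegular := ⟨hreg⟩
  have := hκ t
  exact (hA t).mono (((Cardinal.le_sum κ t).trans (le_max_right _ _)).trans (Order.le_succ _))

/-- The projections of a colimit in the arrow category are colimits. -/
theorem isColimit_dom_cod {C : Type u} [Category.{w} C] [TwoCat C] [HasColimitsOfSize.{w, w} C]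
    {I : Type w} [SmallCategory I] {D : I ⥤ Arrow C} {c : Cocone D} (hc : IsColimit c) :
    Nonempty (IsColimit ((domF C).toFunctor.mapCocone c)) ∧
      Nonempty (IsColimit ((codF C).toFunctor.mapCocone c)) :=
  ⟨⟨isColimitOfPreserves Arrow.leftFunc hc⟩, ⟨isColimitOfPreserves Arrow.rightFunc hc⟩⟩

end rank

/-! ### Uniqueness and universal property of colimits of algebras. -/

namespace AWFS

variable {B : Type u₁} [Category.{w} B] [TwoCat B] {S : AWFS B} {I : Type w} [SmallCategory I]
  {D : I ⥤ Arrow B} {c : Cocone D}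

/-- The condition that a leg is a morphism of algebras prescribes the structure map on that leg of
the colimit `K c.pt`. This gives the uniqueness in creation. -/
theorem str_ext (hc : IsConicalColimit (S.K.toFunctor.mapCocone c))
    {p : ∀ i, S.K.obj (D.obj i) ⟶ (D.obj i).left} {q q' : S.K.obj c.pt ⟶ c.pt.left}
    (hq : ∀ i, S.IsAlgHom (p i) q (c.ι.app i)) (hq' : ∀ i, S.IsAlgHom (p i) q' (c.ι.app i)) :
    q = q' :=
  hc.hom_ext fun i => (hq i).trans (hq' i).symm

/-- Morphisms of algebras out of a colimit are detected by the components of the cocone. -/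
theorem IsAlgHom.of_colimit (hc : IsConicalColimit (S.K.toFunctor.mapCocone c))
    {p : ∀ i, S.K.obj (D.obj i) ⟶ (D.obj i).left} {q : S.K.obj c.pt ⟶ c.pt.left}
    (hq : ∀ i, S.IsAlgHom (p i) q (c.ι.app i)) {g : Arrow B} {r : S.K.obj g ⟶ g.left}
    {t : c.pt ⟶ g} (ht : ∀ i, S.IsAlgHom (p i) r (c.ι.app i ≫ t)) : S.IsAlgHom q r t := by
  refine hc.hom_ext fun i => ?_
  have h₁ : S.K.map (c.ι.app i) ≫ q = p i ≫ (c.ι.app i).left := hq i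
  have h₂ : S.K.map (c.ι.app i ≫ t) ≫ r = p i ≫ (c.ι.app i).left ≫ t.left := ht i
  change S.K.map (c.ι.app i) ≫ S.K.map t ≫ r = S.K.map (c.ι.app i) ≫ q ≫ t.left
  rw [← Category.assoc, ← S.K.map_comp, h₂, ← Category.assoc, ← h₁, Category.assoc]

/-- The 2-cells of algebras out of a colimit are detected by the components of the cocone. -/
theorem IsAlgCell.of_colimit (hc : IsConicalColimit (S.K.toFunctor.mapCocone c))
    {p : ∀ i, S.K.obj (D.obj i) ⟶ (D.obj i).left} {q : S.K.obj c.pt ⟶ c.pt.left}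
    (hq : ∀ i, S.IsAlgHom (p i) q (c.ι.app i)) {g : Arrow B} {r : S.K.obj g ⟶ g.left}
    {α : Cell c.pt g}
    (hα : ∀ i, S.IsAlgCell (p i) r (TwoCat.hcomp (TwoCat.one (c.ι.app i)) α)) :
    S.IsAlgCell q r α := by
  refine hc.cell_ext fun i => ?_
  have h₁ : S.K.map (c.ι.app i) ≫ q = p i ≫ (c.ι.app i).left := hq i
  have h₂ : TwoCat.hcomp (S.K.mapCell (TwoCat.hcomp (TwoCat.one (c.ι.app i)) α)) (TwoCat.one r) =
      TwoCat.hcomp (TwoCat.one (p i))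
        (TwoCat.hcomp (TwoCat.one (c.ι.app i).left) (ArrowCell.left α)) := hα i
  rw [S.K.mapCell_hcomp, S.K.mapCell_one, hcomp_assoc, ← hcomp_assoc (TwoCat.one (p i)),
    ← one_comp, ← h₁, one_comp, hcomp_assoc] at h₂
  exact h₂

end AWFS

/-! ### Colimits of lifting structures -/

theorem TwoFunctor.map_square {A : Type u₁} [Category.{w} A] [TwoCat A] {B : Type u₂}
    [Category.{w} B] [TwoCat B] (F : TwoFunctor A B) {X Y Z T : A} {a : X ⟶ Y} {b : Y ⟶ T}
    {c : X ⟶ Z} {d : Z ⟶ T} (h : a ≫ b = c ≫ d) : F.map a ≫ F.map b = F.map c ≫ F.map d := by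
  rw [← F.map_comp, h, F.map_comp]

theorem TwoFunctor.mapCell_square {A : Type u₁} [Category.{w} A] [TwoCat A] {B : Type u₂}
    [Category.{w} B] [TwoCat B] (F : TwoFunctor A B) {X Y Z T : A} {a : X ⟶ Y} {β : Cell Y T}
    {γ : Cell X Z} {d : Z ⟶ T} (h : hcomp (one a) β = hcomp γ (one d)) :
    hcomp (one (F.map a)) (F.mapCell β) = hcomp (F.mapCell γ) (one (F.map d)) := by
  rw [← F.mapCell_one, ← F.mapCell_one, ← F.mapCell_hcomp, h, F.mapCell_hcomp]

/-- Five faces of a cube commute, so the sixth commutes after precomposition with the edge `a`. With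
`a` ranging over the legs of a colimit, the sixth face itself commutes. -/
theorem cube_comp {B : Type u} [Category.{w} B] {A A' E E' X X' Y Y' : B} {a : A ⟶ A'}
    {f : A ⟶ E} {f' : A' ⟶ E'} {e : E ⟶ E'} {p : A ⟶ X} {q : A' ⟶ Y} {p' : E ⟶ X'} {q' : E' ⟶ Y'}
    {x : X ⟶ Y} {r : X ⟶ X'} {r' : Y ⟶ Y'} {y : X' ⟶ Y'} (h₁ : a ≫ f' = f ≫ e)
    (h₂ : e ≫ q' = p' ≫ y) (h₃ : f ≫ p' = p ≫ r) (h₄ : r ≫ y = x ≫ r') (h₅ : a ≫ q = p ≫ x) :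
    a ≫ f' ≫ q' = a ≫ q ≫ r' := by
  rw [← Category.assoc, h₁, Category.assoc, h₂, ← Category.assoc, h₃, Category.assoc, h₄,
    ← Category.assoc, ← h₅, Category.assoc]

/-- The same cube with 2-cells in the direction of `f` and `r`; it is used for 2-naturality. -/
theorem cube_hcomp {B : Type u} [Category.{w} B] [TwoCat B] {A A' E E' X X' Y Y' : B} {a : A ⟶ A'}
    {f : Cell A E} {f' : Cell A' E'} {e : E ⟶ E'} {p : A ⟶ X} {q : A' ⟶ Y} {p' : E ⟶ X'}
    {q' : E' ⟶ Y'} {x : X ⟶ Y} {r : Cell X X'} {r' : Cell Y Y'} {y : X' ⟶ Y'}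
    (h₁ : hcomp (one a) f' = hcomp f (one e)) (h₂ : e ≫ q' = p' ≫ y)
    (h₃ : hcomp f (one p') = hcomp (one p) r) (h₄ : hcomp r (one y) = hcomp (one x) r')
    (h₅ : a ≫ q = p ≫ x) :
    hcomp (one a) (hcomp f' (one q')) = hcomp (one a) (hcomp (one q) r') := by
  rw [← hcomp_assoc, h₁, hcomp_assoc, ← one_comp, h₂, one_comp, ← hcomp_assoc, h₃, hcomp_assoc, h₄,
    ← hcomp_assoc, ← one_comp, ← h₅, one_comp, hcomp_assoc]

section lifting

variable {P : ObjectProperty Cat.{w, w}} [IsBase P] {C : Type u} [Category.{w} C] [TwoCat C]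
  [HomsIn P C] {J : Type w} [Category.{w} J] [TwoCat J] {U : TwoFunctor J (Arrow C)}
  {EM : AWFS (VObj P)} {I : Type w} [SmallCategory I]

variable (P U) in
-- Acting by `s` on targets and by `U f` on sources commute; on the two ends of the arrows this is
-- the naturality of `homToMap`.
theorem W_map_naturality {g g' : Arrow C} (s : g ⟶ g') {i j : Jᵒᵖ} (f : i ⟶ j) :
    (W P (U.obj i.unop)).map s ≫ (wNat P U g').toArrow.map f =
      (wNat P U g).toArrow.map f ≫ (W P (U.obj j.unop)).map s :=
  Arrow.hom_ext _ _
    ((homToMap P (((domF C).comp (idF C)).map s)).naturality (U.op.map f)).symm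
    ((homToMap P s).naturality (U.op.map f)).symm

variable (P U) in
theorem W_map_naturality_cell {g g' : Arrow C} (s : g ⟶ g') {i j : Jᵒᵖ} (α : Cell i j) :
    hcomp (one ((W P (U.obj i.unop)).map s)) ((wNat P U g').toArrow.mapCell α) =
      hcomp ((wNat P U g).toArrow.mapCell α) (one ((W P (U.obj j.unop)).map s)) :=
  ArrowCell.ext
    ((homToMap P (((domF C).comp (idF C)).map s)).naturality_cell (U.op.mapCell α)).symm
    ((homToMap P s).naturality_cell (U.op.mapCell α)).symm

variable (P) in
/-- For each `j`, the cocone of the morphisms `C^𝟐(U j, 1_{dom g}) ⟶ C^𝟐(U j, g)` given by a cocone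
in `C^𝟐` is a colimit, on domains and on codomains. -/
structure IsHomColimit {E : I ⥤ Arrow C} (c : Cocone E) (a : Arrow C) : Prop where
  dom : IsConicalColimit
    ((homFrom P a).toFunctor.mapCocone (((domF C).comp (idF C)).toFunctor.mapCocone c))
  cod : IsConicalColimit ((homFrom P a).toFunctor.mapCocone c)

theorem IsHomColimit.map_K (hK : PreservesConical I EM.K) {E : I ⥤ Arrow C} {c : Cocone E}
    {a : Arrow C} (h : IsHomColimit P c a) :
    IsConicalColimit (EM.K.toFunctor.mapCocone ((W P a).toFunctor.mapCocone c)) :=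
  hK _ _ (.arrow h.dom h.cod)

/-- The structures at each `j` come from `AWFS.exists_isAlg`. Their 2-naturality in `j` compares
maps and 2-cells out of a colimit `K (W c)`, and on its legs it follows from the naturality of each
`p i` by the cube lemmas. -/
theorem exists_colimit_str (hK : PreservesConical I EM.K) {E : I ⥤ Arrow C} {c : Cocone E}
    (hc : ∀ j, IsHomColimit P c (U.obj j))
    (p : ∀ i, TwoNat ((wNat P U (E.obj i)).toArrow.comp EM.K)
      (presheaf P U (Arrow.mk (𝟙 (E.obj i).left))))
    (hp : ∀ i j, EM.IsAlg ((W P (U.obj j)).obj (E.obj i)) ((p i).app (op j)))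
    (hE : ∀ {i i' : I} (k : i ⟶ i') (j : J),
      EM.IsAlgHom ((p i).app (op j)) ((p i').app (op j)) ((W P (U.obj j)).map (E.map k))) :
    ∃ q : TwoNat ((wNat P U c.pt).toArrow.comp EM.K) (presheaf P U (Arrow.mk (𝟙 c.pt.left))),
      (∀ j, EM.IsAlg ((W P (U.obj j)).obj c.pt) (q.app (op j))) ∧
      ∀ i j, EM.IsAlgHom ((p i).app (op j)) (q.app (op j)) ((W P (U.obj j)).map (c.ι.app i)) := by
  have h := fun j => AWFS.exists_isAlg hK (c := (W P (U.obj j)).toFunctor.mapCocone c)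
    (hc j).dom (hc j).cod (fun i => (p i).app (op j)) (fun i => hp i j) fun k => hE k j
  choose q hq hq' using h
  have hq'' : ∀ (j : Jᵒᵖ) (i : I), EM.K.map ((W P (U.obj j.unop)).map (c.ι.app i)) ≫ q j.unop =
      (p i).app j ≫ (homFrom P (U.obj j.unop)).map (((domF C).comp (idF C)).map (c.ι.app i)) :=
    fun j i => hq' j.unop i
  refine ⟨{ app := fun j => q j.unop, naturality := fun {j j'} f => ?_,
            naturality_cell := fun {j j'} α => ?_ }, hq, fun i j => hq' j i⟩
  · refine ((hc j.unop).map_K hK).hom_ext fun i => ?_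
    change EM.K.map ((W P (U.obj j.unop)).map (c.ι.app i)) ≫
      EM.K.map ((wNat P U c.pt).toArrow.map f) ≫ q j'.unop =
      EM.K.map ((W P (U.obj j.unop)).map (c.ι.app i)) ≫ q j.unop ≫
        (presheaf P U (Arrow.mk (𝟙 c.pt.left))).map f
    exact cube_comp (EM.K.map_square (W_map_naturality P U (c.ι.app i) f)) (hq'' j' i)
      ((p i).naturality f)
      ((homToMap P (((domF C).comp (idF C)).map (c.ι.app i))).naturality (U.op.map f)) (hq'' j i)
  · refine ((hc j.unop).map_K hK).cell_ext fun i => ?_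
    change hcomp (one (EM.K.map ((W P (U.obj j.unop)).map (c.ι.app i))))
      (hcomp (EM.K.mapCell ((wNat P U c.pt).toArrow.mapCell α)) (one (q j'.unop))) =
      hcomp (one (EM.K.map ((W P (U.obj j.unop)).map (c.ι.app i)))) (hcomp (one (q j.unop))
        ((presheaf P U (Arrow.mk (𝟙 c.pt.left))).mapCell α))
    exact cube_hcomp (EM.K.mapCell_square (W_map_naturality_cell P U (c.ι.app i) α))
      (hq'' j' i) ((p i).naturality_cell α)
      ((homToMap P (((domF C).comp (idF C)).map (c.ι.app i))).naturality_cell (U.op.mapCell α))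
      (hq'' j i)

end lifting

/-! ### Recognising morphisms of algebras. -/

namespace AWFS.IsAlgHom

variable {B : Type u₁} [Category.{w} B] [TwoCat B] {S : AWFS B}

theorem of_eq {f g : Arrow B} {p : S.K.obj f ⟶ f.left} {q : S.K.obj g ⟶ g.left} {s t : f ⟶ g}
    (h : S.IsAlgHom p q s) (e : s = t) : S.IsAlgHom p q t := e ▸ h

/-- The two maps `K f ⟶ dom g` to compare agree after `k.left` because `k` and `t ≫ k` are morphisms
of algebras, and after `g.hom` because structure maps lie over `rho`. It is meant for an algebra `g`
obtained by pullback along `k`. -/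
theorem of_jointly_monic {f g h : Arrow B} {p : S.K.obj f ⟶ f.left} {q : S.K.obj g ⟶ g.left}
    {r : S.K.obj h ⟶ h.left} (hp : S.IsAlg f p) (hq : S.IsAlg g q) {t : f ⟶ g} {k : g ⟶ h}
    (hk : ∀ {Z : B} {u v : Z ⟶ g.left}, u ≫ k.left = v ≫ k.left → u ≫ g.hom = v ≫ g.hom → u = v)
    (hqr : S.IsAlgHom q r k) (hpr : S.IsAlgHom p r (t ≫ k)) : S.IsAlgHom p q t := by
  have h₁ : S.K.map k ≫ r = q ≫ k.left := hqr
  have h₂ : S.K.map (t ≫ k) ≫ r = p ≫ t.left ≫ k.left := hpr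
  have h₃ : S.K.map t ≫ S.rho.app g = S.rho.app f ≫ t.right := S.rho.naturality t
  refine hk ?_ ?_
  · rw [Category.assoc, ← h₁, ← Category.assoc, ← S.K.map_comp, h₂, Category.assoc]
  · rw [Category.assoc, hq.w, h₃, ← hp.w, Category.assoc, Category.assoc, Arrow.w]

end AWFS.IsAlgHom

theorem AWFS.IsAlgCell.of_eq {B : Type u₁} [Category.{w} B] [TwoCat B] {S : AWFS B} {f g : Arrow B}
    {p : S.K.obj f ⟶ f.left} {q : S.K.obj g ⟶ g.left} {α β : Cell f g} (h : S.IsAlgCell p q α)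
    (e : α = β) : S.IsAlgCell p q β := e ▸ h

/-! ### The composition condition passes to colimits. -/

section composites

theorem hcomp_one_iso_cancel {C : Type u} [Category.{w} C] [TwoCat C] {X Y Z : C} (e : X ⟶ Y)
    [IsIso e] {α β : Cell Y Z} (h : hcomp (one e) α = hcomp (one e) β) : α = β := by
  have := congrArg (hcomp (one (inv e))) h
  rwa [← hcomp_assoc, ← hcomp_assoc, ← one_comp, IsIso.inv_hom_id, one_hcomp, one_hcomp] at this

theorem HomCat.cell_map_congr {C : Type u} [Category.{w} C] [TwoCat C] {E : Type w} [Category.{w} E]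
    {a b : C} {F G : E ⥤ HomCat a b} (h : F = G) {x y : E} (k : x ⟶ y) :
    HomCat.cell (F.map k) = HomCat.cell (G.map k) := by
  subst h; rfl

variable {P : ObjectProperty Cat.{w, w}} [IsBase P] {C : Type u} [Category.{w} C] [TwoCat C]
  [HomsIn P C] {J₀ : Type w} [Category.{w} J₀] [TwoCat J₀] {J₁ : Type w} [Category.{w} J₁]
  [TwoCat J₁] {J : InternalCat J₀ J₁} (U : J.ToSq C) (x : Pb J.cod J.dom)

namespace InternalCat.ToSq

theorem isIso_down_right : IsIso (U.down x).right := by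
  have : ∀ {f g : Arrow C} (h : f = g), IsIso (eqToHom h).right := by
    rintro f _ rfl
    exact inferInstanceAs (IsIso (𝟙 _))
  have h := this (U.comp_obj x)
  exact inferInstanceAs (IsIso ((eqToHom (U.comp_obj x)).right ≫ 𝟙 _))

/-- The functors `corner` and `restr` are jointly monic. -/
theorem corner_restr_ext {g : Arrow C} {Z : VObj P} {u v : Z ⟶ homObj P (U.U₁.obj x.snd) g}
    (h : u ≫ U.corner P x g = v ≫ U.corner P x g)
    (h' : u ≫ U.restr P x g = v ≫ U.restr P x g) : u = v := by
  have := U.isIso_down_right x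
  refine HomCat.functor_ext (fun z => Arrow.hom_ext _ _ ?_ ?_)
    (fun k => ArrowCell.ext ?_ ?_)
  -- For a square `(h, k)`, the codomain part of `corner` is `h` up to a transport, and the codomain
  -- part of `restr` is `k` up to an isomorphism; so both components are recovered.
  · exact (cancel_epi (eqToHom (U.mid x))).1 (congrArg Arrow.Hom.right (Functor.congr_obj h z))
  · exact (cancel_epi (U.down x).right).1 (congrArg Arrow.Hom.right (Functor.congr_obj h' z))
  · exact hcomp_one_iso_cancel (eqToHom (U.mid x))
      (congrArg ArrowCell.right (HomCat.cell_map_congr h k))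
  · exact hcomp_one_iso_cancel (U.down x).right
      (congrArg ArrowCell.right (HomCat.cell_map_congr h' k))

variable (P) in
/-- The functor that sends `g` to `restr`. -/
def restrFunctor : Arrow C ⥤ Arrow (VObj P) where
  obj g := Arrow.mk (U.restr P x g)
  map {g g'} s := Arrow.homMk (f := Arrow.mk (U.restr P x g)) (g := Arrow.mk (U.restr P x g'))
    ((homFrom P (U.U₁.obj x.snd)).map s) ((homFrom P (U.U₁.obj (J.comp.obj x))).map s)
    ((homToMap P s).naturality (U.down x).op).symm
  map_id g := Arrow.hom_ext _ _ ((homFrom P (U.U₁.obj x.snd)).map_id g)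
    ((homFrom P (U.U₁.obj (J.comp.obj x))).map_id g)
  map_comp s t := Arrow.hom_ext _ _ ((homFrom P (U.U₁.obj x.snd)).map_comp s t)
    ((homFrom P (U.U₁.obj (J.comp.obj x))).map_comp s t)

variable (P) in
/-- The functor that sends `g` to the composite of
`C^𝟐(U j, 1_{dom g}) ⟶ C^𝟐(U j, g)` and `restr`. -/
def compFunctor : Arrow C ⥤ Arrow (VObj P) where
  obj g := Arrow.mk (((W P (U.U₁.obj x.snd)).obj g).hom ≫ U.restr P x g)
  map {g g'} s := Arrow.homMk
    (f := Arrow.mk (((W P (U.U₁.obj x.snd)).obj g).hom ≫ U.restr P x g))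
    (g := Arrow.mk (((W P (U.U₁.obj x.snd)).obj g').hom ≫ U.restr P x g'))
    ((W P (U.U₁.obj x.snd)).map s).left ((homFrom P (U.U₁.obj (J.comp.obj x))).map s) (by
      have h₁ : ((W P (U.U₁.obj x.snd)).map s).left ≫ ((W P (U.U₁.obj x.snd)).obj g').hom =
        ((W P (U.U₁.obj x.snd)).obj g).hom ≫ (homFrom P (U.U₁.obj x.snd)).map s :=
        Arrow.w ((W P (U.U₁.obj x.snd)).map s)
      have h₂ : (homFrom P (U.U₁.obj x.snd)).map s ≫ U.restr P x g' =
        U.restr P x g ≫ (homFrom P (U.U₁.obj (J.comp.obj x))).map s :=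
        ((homToMap P s).naturality (U.down x).op).symm
      change ((W P (U.U₁.obj x.snd)).map s).left ≫ ((W P (U.U₁.obj x.snd)).obj g').hom ≫
        U.restr P x g' = (((W P (U.U₁.obj x.snd)).obj g).hom ≫ U.restr P x g) ≫
          (homFrom P (U.U₁.obj (J.comp.obj x))).map s
      rw [← Category.assoc, h₁, Category.assoc, h₂, Category.assoc])
  map_id g := Arrow.hom_ext _ _ ((homFrom P (U.U₁.obj x.snd)).map_id (Arrow.mk (𝟙 g.left)))
    ((homFrom P (U.U₁.obj (J.comp.obj x))).map_id g)
  map_comp s t := Arrow.hom_ext _ _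
    ((homFrom P (U.U₁.obj x.snd)).map_comp (((domF C).comp (idF C)).map s)
      (((domF C).comp (idF C)).map t))
    ((homFrom P (U.U₁.obj (J.comp.obj x))).map_comp s t)

variable (P) in
theorem corner_naturality {g g' : Arrow C} (s : g ⟶ g') :
    (homFrom P (U.U₁.obj x.snd)).map s ≫ U.corner P x g' =
      U.corner P x g ≫ ((W P (U.U₁.obj x.fst)).map s).left := by
  let F := (domF C).comp (idF C)
  refine HomCat.functor_ext (fun (f : U.U₁.obj x.snd ⟶ g) => ?_) (fun {f f'} α => ?_)
  · exact (congrArg (U.toId x ≫ ·) (F.map_comp f s)).trans (Category.assoc _ _ _).symm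
  · exact (congrArg (hcomp (one (U.toId x))) ((F.mapCell_hcomp α.1 (one s)).trans
      (congrArg (hcomp (F.mapCell α.1)) (F.mapCell_one s)))).trans (hcomp_assoc _ _ _).symm

variable (P) in
-- With `compIso_naturality`, this lets the two conditions in `RespectsComp` be moved along
-- morphisms of `C^𝟐`, in particular along the legs of a cocone.
theorem pbSquare_naturality {g g' : Arrow C} (s : g ⟶ g') :
    (U.restrFunctor P x).map s ≫ U.pbSquare P x g' =
      U.pbSquare P x g ≫ (W P (U.U₁.obj x.fst)).map s :=
  Arrow.hom_ext _ _ (U.corner_naturality P x s) ((homToMap P s).naturality (U.up x).op).symm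

variable (P) in
theorem compIso_naturality {g g' : Arrow C} (s : g ⟶ g') :
    (U.compFunctor P x).map s ≫ U.compIso P x g' =
      U.compIso P x g ≫ (W P (U.U₁.obj (J.comp.obj x))).map s :=
  Arrow.hom_ext _ _
    ((homToMap P (((domF C).comp (idF C)).map s)).naturality (U.down x).op).symm rfl

end InternalCat.ToSq

variable {EM : AWFS (VObj P)} {I : Type w} [SmallCategory I]

/-- The structures on `restr` in the definition of `RespectsComp` are compatible with morphisms. -/
theorem isAlgHom_restr {a b : LiftAlg U.U₁ EM} {t : a.arrow ⟶ b.arrow}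
    (ht : EM.IsAlgHom (a.str.app (op x.fst)) (b.str.app (op x.fst)) ((W P (U.U₁.obj x.fst)).map t))
    {p : EM.K.obj (Arrow.mk (U.restr P x a.arrow)) ⟶ homObj P (U.U₁.obj x.snd) a.arrow}
    {q : EM.K.obj (Arrow.mk (U.restr P x b.arrow)) ⟶ homObj P (U.U₁.obj x.snd) b.arrow}
    (hp : EM.IsAlg (Arrow.mk (U.restr P x a.arrow)) p)
    (hq : EM.IsAlg (Arrow.mk (U.restr P x b.arrow)) q)
    (hp' : EM.IsAlgHom p (a.str.app (op x.fst)) (U.pbSquare P x a.arrow))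
    (hq' : EM.IsAlgHom q (b.str.app (op x.fst)) (U.pbSquare P x b.arrow)) :
    EM.IsAlgHom p q ((U.restrFunctor P x).map t) := by
  refine AWFS.IsAlgHom.of_jointly_monic hp hq (fun h h' => U.corner_restr_ext x h h') hq' ?_
  exact (hp'.comp ht).of_eq (U.pbSquare_naturality P x t).symm

/-- By `isAlgHom_restr` the structures on `restr` at the stages are compatible, hence have a colimit
structure. The two conditions on it say that certain squares out of colimits are morphisms of
algebras, which is detected on the legs. -/
theorem RespectsComp.of_colimit (hK : PreservesConical I EM.K) {D : I ⥤ (lift U.U₁ EM).Obj}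
    (c : Cocone D) (hc : ∀ j, IsHomColimit P ((lift U.U₁ EM).forget.toFunctor.mapCocone c)
      (U.U₁.obj j))
    (hD : ∀ i, RespectsComp U x (D.obj i)) : RespectsComp U x c.pt := by
  choose p hp hp' hp'' using hD
  let c₀ := (lift U.U₁ EM).forget.toFunctor.mapCocone c
  have hl : IsConicalColimit
      ((domF (VObj P)).toFunctor.mapCocone ((U.restrFunctor P x).mapCocone c₀)) :=
    (hc x.snd).cod
  have hr : IsConicalColimit
      ((codF (VObj P)).toFunctor.mapCocone ((U.restrFunctor P x).mapCocone c₀)) :=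
    (hc (J.comp.obj x)).cod
  have hl' : IsConicalColimit
      ((domF (VObj P)).toFunctor.mapCocone ((U.compFunctor P x).mapCocone c₀)) :=
    (hc x.snd).dom
  have hr' : IsConicalColimit
      ((codF (VObj P)).toFunctor.mapCocone ((U.compFunctor P x).mapCocone c₀)) :=
    (hc (J.comp.obj x)).cod
  obtain ⟨q, hq, hq'⟩ := AWFS.exists_isAlg hK hl hr p hp fun {i j} k =>
    isAlgHom_restr U x ((D.map k).2 x.fst) (hp i) (hp j) (hp' i) (hp' j)
  refine ⟨q, hq, ?_, ?_⟩
  · refine AWFS.IsAlgHom.of_colimit (hK _ _ (.arrow hl hr)) hq' fun i => ?_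
    exact ((hp' i).comp ((c.ι.app i).2 x.fst)).of_eq (U.pbSquare_naturality P x _).symm
  -- The composite structure at the vertex is the colimit of the composite structures at the stages,
  -- because composition of algebras is natural; so this condition too can be tested on legs.
  · refine AWFS.IsAlgHom.of_colimit (hK _ _ (.arrow hl' hr'))
      (p := fun i => EM.compStr (f := ((W P (U.U₁.obj x.snd)).obj (D.obj i).arrow).hom)
        (g := U.restr P x (D.obj i).arrow) ((D.obj i).str.app (op x.snd)) (hp i))
      (fun i => ?_) fun i => ?_
    · exact AWFS.IsAlgHom.compStr (hp i) hq _ _ _ ((c.ι.app i).2 x.snd) (hq' i)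
    · exact ((hp'' i).comp ((c.ι.app i).2 (J.comp.obj x))).of_eq
        (U.compIso_naturality P x _).symm

end composites

/-! ### Creation of colimits by the lifting structures. -/

section creation

variable {P : ObjectProperty Cat.{w, w}} [IsBase P] {C : Type u} [Category.{w} C] [TwoCat C]
  [HomsIn P C] {J₀ : Type w} [Category.{w} J₀] [TwoCat J₀] {J₁ : Type w} [Category.{w} J₁]
  [TwoCat J₁] {J : InternalCat J₀ J₁} (U : J.ToSq C) {EM : AWFS (VObj P)}

section

variable {I : Type w} [SmallCategory I] {D : I ⥤ (dblLift U EM).Obj}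

theorem exists_dblLift_cocone (hK : PreservesConical I EM.K)
    {c : Cocone (D ⋙ (dblLift U EM).forget.toFunctor)}
    (hc : ∀ j, IsHomColimit P c (U.U₁.obj j)) :
    ∃ c' : Cocone D, (dblLift U EM).forget.toFunctor.mapCocone c' = c := by
  -- The same diagram without the composition condition: the structure at the vertex is found first,
  -- and the condition is verified for it afterwards.
  let D' : I ⥤ (lift U.U₁ EM).Obj :=
    { obj := fun i => (D.obj i).1
      map := fun k => ⟨(D.map k).1, (D.map k).2⟩
      map_id := fun i => Subtype.ext (congrArg Subtype.val (D.map_id i))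
      map_comp := fun k l => Subtype.ext (congrArg Subtype.val (D.map_comp k l)) }
  obtain ⟨q, hq, hq'⟩ := exists_colimit_str hK hc (fun i => (D.obj i).1.str)
    (fun i => (D.obj i).1.isAlg) fun k => (D.map k).2
  let c₀ : Cocone D' :=
    { pt := ⟨c.pt, q, hq⟩
      ι := { app := fun i => ⟨c.ι.app i, hq' i⟩
             naturality := fun i j k => Subtype.ext (c.ι.naturality k) } }
  exact ⟨{ pt := ⟨c₀.pt, fun x => RespectsComp.of_colimit U x hK c₀ hc fun i => (D.obj i).2 x⟩
           ι := { app := fun i => ⟨c.ι.app i, hq' i⟩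
                  naturality := fun i j k => Subtype.ext (c.ι.naturality k) } }, rfl⟩

theorem dblLift_cocone_ext (hK : PreservesConical I EM.K) {c c' : Cocone D}
    (hc : ∀ j, IsHomColimit P ((dblLift U EM).forget.toFunctor.mapCocone c) (U.U₁.obj j))
    (h : (dblLift U EM).forget.toFunctor.mapCocone c' =
      (dblLift U EM).forget.toFunctor.mapCocone c) : c' = c := by
  obtain ⟨⟨⟨g, q, hq⟩, hq'⟩, ⟨ι, hι⟩⟩ := c
  obtain ⟨⟨⟨g', r, hr⟩, hr'⟩, ⟨ι', hι'⟩⟩ := c'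
  obtain rfl : g' = g := congrArg Cocone.pt h
  have hιι : ∀ i, (ι' i).1 = (ι i).1 := by
    have h' := eq_of_heq (Cocone.mk.inj h).2
    exact fun i => congrArg (fun n => n.app i) h'
  obtain rfl : r = q := by
    -- Both structures make the same legs into morphisms of algebras, so they agree by
    -- `AWFS.str_ext`; the rest of the data is propositional.
    have key : r.app = q.app := by
      funext j
      refine AWFS.str_ext ((hc j.unop).map_K hK) (fun i => ?_) (fun i => (ι i).2 j.unop)
      have := (ι' i).2 j.unop
      rw [hιι] at this
      exact this
    obtain ⟨r, _, _⟩ := r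
    obtain ⟨q, _, _⟩ := q
    obtain rfl : r = q := key
    rfl
  obtain rfl : ι' = ι := funext fun i => Subtype.ext (hιι i)
  rfl

/-- The induced morphisms and 2-cells exist uniquely in `C^𝟐`. It only remains that they respect the
structures, and this is detected on the legs since `K (W c)` is a colimit. -/
theorem isConicalColimit_dblLift (hK : PreservesConical I EM.K) {c : Cocone D}
    (hc : ∀ j, IsHomColimit P ((dblLift U EM).forget.toFunctor.mapCocone c) (U.U₁.obj j))
    (h : IsConicalColimit ((dblLift U EM).forget.toFunctor.mapCocone c)) : IsConicalColimit c where
  isColimit := by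
    obtain ⟨k⟩ := h.isColimit
    refine ⟨{ desc := fun t => ⟨k.desc ((dblLift U EM).forget.toFunctor.mapCocone t), fun j => ?_⟩
              fac := fun t i => Subtype.ext (k.fac ((dblLift U EM).forget.toFunctor.mapCocone t) i)
              uniq := fun t m hm => Subtype.ext
                (k.uniq ((dblLift U EM).forget.toFunctor.mapCocone t) m.1
                  fun i => congrArg Subtype.val (hm i)) }⟩
    refine AWFS.IsAlgHom.of_colimit ((hc j).map_K hK) (fun i => (c.ι.app i).2 j) fun i => ?_
    refine AWFS.IsAlgHom.of_eq ((t.ι.app i).2 j) ?_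
    refine Eq.trans ?_ ((W P (U.U₁.obj j)).map_comp _ _)
    exact congrArg (W P (U.U₁.obj j)).map
      (k.fac ((dblLift U EM).forget.toFunctor.mapCocone t) i).symm
  cell X Γ hΓ := by
    obtain ⟨θ, h₁, h₂⟩ := h.cell X.1.arrow (fun i => (Γ i).1)
      fun k => congrArg Subtype.val (hΓ k)
    refine ⟨⟨θ, fun j => ?_⟩, fun i => Subtype.ext (h₁ i), fun η hη => Subtype.ext
      (h₂ η.1 fun i => congrArg Subtype.val (hη i))⟩
    refine AWFS.IsAlgCell.of_colimit ((hc j).map_K hK) (fun i => (c.ι.app i).2 j) fun i => ?_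
    refine AWFS.IsAlgCell.of_eq ((Γ i).2 j) (Eq.symm ?_)
    refine Eq.trans ?_ (congrArg (W P (U.U₁.obj j)).mapCell (h₁ i))
    exact (congrArg (hcomp · _) ((W P (U.U₁.obj j)).mapCell_one _).symm).trans
      ((W P (U.U₁.obj j)).mapCell_hcomp _ _).symm

end

theorem isHomColimit_of_rank {M : MorphismProperty C} {κ : Cardinal.{w}} [Fact κ.IsRegular]
    [HasColimitsOfSize.{w, w} C] {I : Type w} [SmallCategory I] [IsCardinalFiltered I κ]
    {E : I ⥤ Arrow C} (s : Cocone E) (hs : ∀ i, M (s.ι.app i).left ∧ M (s.ι.app i).right)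
    {c : Cocone E} (hc : IsColimit c) {a : Arrow C} (hl : HasCellRankLE M κ a.left)
    (hr : HasCellRankLE M κ a.right) : IsHomColimit P c a := by
  obtain ⟨⟨h₁⟩, ⟨h₂⟩⟩ := isColimit_dom_cod hc
  exact
    -- The diagram of identities `1_{dom g}` consists of domains on both sides, so its cocone lies
    -- in `M` by the condition on domains alone.
    { dom := isConicalColimit_homFrom hl hr (((domF C).comp (idF C)).toFunctor.mapCocone s)
        (fun i => ⟨(hs i).1, (hs i).1⟩) h₁ h₁
      cod := isConicalColimit_homFrom hl hr s hs h₁ h₂ }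

/-- The cocone `s` in `M` serves only to make the ranks applicable; the colimit cocone `c`, which
need not lie in `M`, is then preserved by each `C^𝟐(U j, -)`, and its lift is built, unique and a
colimit. -/
theorem dblLift_creates (hEM : IsCocontinuous P EM.K) {M : MorphismProperty C} {κ : Cardinal.{w}}
    [Fact κ.IsRegular] [HasColimitsOfSize.{w, w} C]
    (hU : ∀ j, HasCellRankLE M κ (U.U₁.obj j).left ∧ HasCellRankLE M κ (U.U₁.obj j).right) :
    CreatesFilteredColimitsOfSubobjects (dblLift U EM) M κ := by
  intro I _ _ D s hs c hc
  have hK : PreservesConical I EM.K := hEM.preservesConical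
  have hc' : ∀ j, IsHomColimit P c (U.U₁.obj j) := fun j =>
    isHomColimit_of_rank s hs hc.isColimit.some (hU j).1 (hU j).2
  obtain ⟨c', rfl⟩ := exists_dblLift_cocone U hK hc'
  refine ⟨⟨c', rfl, fun c'' h => dblLift_cocone_ext U hK hc' h⟩, fun c'' h => ?_⟩
  rw [dblLift_cocone_ext U hK hc' h]
  exact isConicalColimit_dblLift U hK hc' hc

end creation

/-! ### Transport along isomorphisms -/

section transport

/-- Stated for a variable `H` so that the equation with the identity can be substituted; the
composites to which it is applied are not variables. -/
theorem mapCocone_bijective_of_eq_id {A : Type u₁} [Category.{w} A] {I : Type w} [SmallCategory I]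
    {H : A ⥤ A} (h : H = 𝟭 A) (D : I ⥤ A) :
    Function.Bijective (H.mapCocone : Cocone D → Cocone (D ⋙ H)) := by
  subst h
  exact ⟨fun _ _ h => h, fun c => ⟨c, rfl⟩⟩

/-- The two-out-of-six argument: the composites of successive maps in `F`, `G`, `F` are bijective on
cocones, hence so is the first map. It avoids transporting cocones along `F ⋙ G = 𝟭 A`. -/
theorem mapCocone_bijective {A : Type u₁} [Category.{w} A] {B : Type u₂} [Category.{w} B]
    {I : Type w} [SmallCategory I] {F : A ⥤ B} {G : B ⥤ A} (h : F ⋙ G = 𝟭 A) (h' : G ⋙ F = 𝟭 B)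
    (D : I ⥤ A) : Function.Bijective (F.mapCocone : Cocone D → Cocone (D ⋙ F)) := by
  have h₁ := mapCocone_bijective_of_eq_id h D
  have h₂ := mapCocone_bijective_of_eq_id h' (D ⋙ F)
  refine ⟨fun c c' e => h₁.1 (congrArg G.mapCocone e), fun c => ?_⟩
  obtain ⟨c', hc'⟩ := h₁.2 (G.mapCocone c)
  exact ⟨c', h₂.1 (congrArg F.mapCocone hc')⟩

variable {A : Type u₁} [Category.{w} A] [TwoCat A] {B : Type u₂} [Category.{w} B] [TwoCat B]
  {I : Type w} [SmallCategory I]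

theorem mapCell_bijective_of_eq_id {H : TwoFunctor A A} (h : H = TwoFunctor.id A) (X Y : A) :
    Function.Bijective (H.mapCell : Cell X Y → Cell (H.obj X) (H.obj Y)) ∧
      Function.Bijective (H.map : (X ⟶ Y) → (H.obj X ⟶ H.obj Y)) := by
  subst h
  exact ⟨Function.bijective_id, Function.bijective_id⟩

theorem mapCell_bijective {F : TwoFunctor A B} {G : TwoFunctor B A}
    (h : F.comp G = TwoFunctor.id A) (h' : G.comp F = TwoFunctor.id B) (X Y : A) :
    Function.Bijective (F.mapCell : Cell X Y → Cell (F.obj X) (F.obj Y)) ∧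
      Function.Bijective (F.map : (X ⟶ Y) → (F.obj X ⟶ F.obj Y)) := by
  have h₁ := mapCell_bijective_of_eq_id h X Y
  have h₂ := mapCell_bijective_of_eq_id h' (F.obj X) (F.obj Y)
  refine ⟨⟨fun c c' e => h₁.1.1 (congrArg G.mapCell e), fun c => ?_⟩,
    ⟨fun c c' e => h₁.2.1 (congrArg G.map e), fun c => ?_⟩⟩
  · obtain ⟨c', hc'⟩ := h₁.1.2 (G.mapCell c)
    exact ⟨c', h₂.1.1 (congrArg F.mapCell hc')⟩
  · obtain ⟨c', hc'⟩ := h₁.2.2 (G.map c)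
    exact ⟨c', h₂.2.1 (congrArg F.map hc')⟩

theorem IsConicalColimit.of_mapCocone {F : TwoFunctor A B}
    (hcell : ∀ X Y, Function.Bijective (F.mapCell : Cell X Y → Cell (F.obj X) (F.obj Y)))
    (hmap : ∀ X Y, Function.Bijective (F.map : (X ⟶ Y) → (F.obj X ⟶ F.obj Y))) {D : I ⥤ A}
    {c : Cocone D} (hc : IsConicalColimit (F.toFunctor.mapCocone c)) : IsConicalColimit c where
  isColimit := by
    have : F.toFunctor.Full := ⟨fun {X Y} => (hmap X Y).2⟩
    have : F.toFunctor.Faithful := ⟨fun {X Y} _ _ h => (hmap X Y).1 h⟩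
    exact ⟨isColimitOfReflects F.toFunctor hc.isColimit.some⟩
  cell X Γ hΓ := by
    have key : ∀ (θ : Cell c.pt X) (i : I), F.mapCell (hcomp (one (c.ι.app i)) θ) =
        hcomp (one ((F.toFunctor.mapCocone c).ι.app i)) (F.mapCell θ) := fun θ i =>
      (F.mapCell_hcomp _ _).trans (congrArg (hcomp · (F.mapCell θ)) (F.mapCell_one _))
    obtain ⟨θ', h₁, h₂⟩ := hc.cell (F.obj X) (fun i => F.mapCell (Γ i)) fun {i j} k => by
      rw [← hΓ k, F.mapCell_hcomp, F.mapCell_one]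
      rfl
    obtain ⟨θ, rfl⟩ := (hcell c.pt X).2 θ'
    exact ⟨θ, fun i => (hcell _ _).1 ((key θ i).trans (h₁ i)), fun η hη => (hcell _ _).1
      (h₂ _ fun i => (key η i).symm.trans (congrArg F.mapCell (hη i)))⟩

/-- Creation of colimits is invariant under isomorphisms over `C^𝟐`. -/
theorem CreatesFilteredColimitsOfSubobjects.of_iso {C : Type u} [Category.{w} C] [TwoCat C]
    {S T : ConcreteTwoCat (Arrow C)} {M : MorphismProperty C} {κ : Cardinal.{w}} [Fact κ.IsRegular]
    (F : TwoFunctor S.Obj T.Obj) (G : TwoFunctor T.Obj S.Obj) (h : F.comp G = TwoFunctor.id _)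
    (h' : G.comp F = TwoFunctor.id _) (hF : F.comp T.forget = S.forget)
    (hT : CreatesFilteredColimitsOfSubobjects T M κ) :
    CreatesFilteredColimitsOfSubobjects S M κ := by
  intro I _ _ D
  -- After this rewriting, the image of `D` in `C^𝟐` is literally that of `D ⋙ F`, so `hT` applies
  -- to the same cocones `s` and `c`.
  rw [← hF]
  intro s hs c hc
  obtain ⟨⟨c₁, h₁, h₂⟩, h₃⟩ := hT I (D ⋙ F.toFunctor) s hs c hc
  have hb := mapCocone_bijective (congrArg TwoFunctor.toFunctor h)
    (congrArg TwoFunctor.toFunctor h') D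
  obtain ⟨c', rfl⟩ := hb.2 c₁
  refine ⟨⟨c', h₁, fun c'' e => hb.1 (h₂ _ e)⟩, fun c'' e => ?_⟩
  exact .of_mapCocone (fun X Y => (mapCell_bijective h h' X Y).1)
    (fun X Y => (mapCell_bijective h h' X Y).2) (h₃ (F.toFunctor.mapCocone c'') e)

end transport

end TwoDim

/-! ### The choice of `κ` and the conclusion. -/

open TwoDim
theorem mainTheorem8 {P : ObjectProperty Cat.{w, w}} [IsBase P] (EM : AWFS (VObj P))
    (hEM : IsCocontinuous P EM.K) {C : Type u} [Category.{w} C] [TwoCat C] [HomsIn P C]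
    (hC : IsCocomplete P C) (E M : MorphismProperty C) (hr : IsLocallyRanked E M)
    (LR : AWFS C) (hLR : LR.IsCofibrantlyGenerated EM) :
    ∃ (κ : Cardinal.{w}) (_ : Fact κ.IsRegular),
      CreatesFilteredColimitsOfSubobjects LR.alg M κ := by
  obtain ⟨J₀, _, _, _, J₁, _, _, _, J, U, F, G, h, h', hF, -⟩ := hLR
  have := hr.hasColimits
  choose T ν hν using hC.exists_tensorTwo
  -- The two summands index the tensors with `𝟐` of the domains and of the codomains of the
  -- generating morphisms; there is a common rank because `J₁` is small.
  obtain ⟨κ, hκ, hT⟩ := hr.exists_rank (T := J₁ ⊕ J₁)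
    (Sum.elim (fun j => T (U.U₁.obj j).left) fun j => T (U.U₁.obj j).right)
  exact ⟨κ, hκ, .of_iso F G h h' hF (dblLift_creates U hEM fun j =>
    ⟨⟨_, _, hν _, hT (.inl j)⟩, ⟨_, _, hν _, hT (.inr j)⟩⟩)⟩
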